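/- Throughout, $n$ is the security parameter, a function is negligible if it decays faster than every inverse polynomial, algorithms get $1^n$ as input, and PPT means (uniform) probabilistic polynomial time. All interactive protocols below have a constant number of rounds. A commitment is the transcript of the commit phase, and (canonical verification) an opening of it to a message consists of the message and sender coins that are consistent with the transcript. Let the following be given. (a) A promise problem $(\Pi_Y,\Pi_N)$ (two disjoint sets of strings) with a polynomial-time sampler $\Pi$, whose support is $\Pi_Y\cup\Pi_N$; $\Pi(r)$ is the instance sampled with random string $r$. The problem is *hard on average* if for every PPT decider $D$, $\Pr_{r\leftarrow\{0,1\}^n}[x\in\Pi_{D(1^n,x)} \mid x=\Pi(r)]\le \frac12+\mathrm{negl}(n)$, where $D$ answers $Y$ or $N$. (b) A commitment scheme $\mathcal{SBC}$ for strings in $\{0,1\}^n$ that is statistically binding and computationally hiding (against PPT receivers that choose the two messages). (c) An instance-dependent commitment scheme $\mathcal{IDC}$ for bits for $(\Pi_Y,\Pi_N)$: both parties get an instance $x$ as additional input, and the scheme $\mathcal{IDC}_x$ is statistically hiding for $x\in\Pi_Y$ and statistically binding for $x\in\Pi_N$ (with errors negligible in $n$, uniformly over $x$ of length polynomial in $n$).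 (d) A proof system $\mathcal{WI}$ (complete, statistically sound, with a PPT prover that is given a witness) for the relation in step 2 below, that is witness indistinguishable: for every PPT verifier with auxiliary input, the probabilities that it outputs 1 after a proof of $s$ with witness $w_0$ and with witness $w_1$ differ by at most $\mathrm{negl}(n)$, uniformly over statements $s$, witnesses $w_0,w_1$ of $s$ and auxiliary inputs, all of length polynomial in $n$. Consider the following protocol, by which a sender $\mathcal S$ commits to a bit $m$ towards a receiver $\mathcal R$. 1. *Coin tossing into the well.* $\mathcal R$ samples $\rho_{i,b}\leftarrow\{0,1\}^n$ for $i\in[n]$, $b\in\{0,1\}$, and commits to each of them with $\mathcal{SBC}$, in parallel; let $C_{i,b}$ be the transcripts. Then $\mathcal S$ sends random $\sigma_{i,b}\leftarrow\{0,1\}^n$. $\mathcal R$ sets $r_{i,b}=\rho_{i,b}\oplus\sigma_{i,b}$. 2. *Generating hard instances.* $\mathcal R$ sends $x_{i,b}=\Pi(r_{i,b})$ for all $i,b$, and proves with $\mathcal{WI}$ that there are $\beta\in\{0,1\}$ and strings $\rho_i$, $i\in[n]$, such that for all $i$, $C_{i,\beta}$ is consistent with a commitment to $\rho_i$ and $x_{i,\beta}=\Pi(\rho_i\oplus\sigma_{i,\beta})$.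 The witness used is $\beta=0$, with the strings $\rho_{i,0}$ and the coins of their commitments. $\mathcal S$ aborts if the proof is rejected. 3. *Instance-binding commitment.* $\mathcal S$ samples random bits $m_{i,b}$ with $\bigoplus_{i,b}m_{i,b}=m$ and commits to each $m_{i,b}$ with $\mathcal{IDC}_{x_{i,b}}$, in parallel. The commitment is opened to $m$ by openings of all the $\mathcal{IDC}_{x_{i,b}}$-commitments, to bits whose exclusive or is $m$. For a PPT sender $\mathcal S^*$ let $\varepsilon(n)$ be the probability that $\mathcal S^*$, after the commit phase with the honest receiver, outputs an opening to $0$ and an opening to $1$. The protocol is *computationally binding* if $\varepsilon$ is negligible for every PPT sender $\mathcal S^*$. **Proposition.** (i) If $(\Pi_Y,\Pi_N)$ with the sampler $\Pi$ is hard on average, then the protocol is computationally binding. (ii) Quantitatively (and without assuming hardness on average): for every PPT sender $\mathcal S^*$ that breaks binding with probability $\varepsilon(n)$ there are a PPT decider $D$ and a negligible function $\nu$ such that for all $n\ge1$ $$\Pr_{r\leftarrow\{0,1\}^n}\bigl[x\in\Pi_{D(1^n,x)} \mid x=\Pi(r)\bigr]\ \ge\ \frac12+\frac{\varepsilon(n)}{4n}-\nu(n).$$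 -/

import Mathlib

open Filter

/-! ### Data, programs and running time -/

/-- Finite binary trees: the values on which programs compute and which parties exchange. -/
inductive Data : Type
  | nil : Data
  | cons : Data → Data → Data

namespace Data

/-- The number of nodes and leaves, which measures input lengths and the cost of an operation. -/
def size : Data → ℕ
  | nil => 1
  | cons a d => a.size + d.size + 1

def head : Data → Data
  | nil => nil
  | cons a _ => a

def tail : Data → Data
  | nil => nil
  | cons _ d => d

/-- A list of trees, as a tree. -/
def ofList : List Data → Data
  | [] => nil
  | a :: l => cons a (ofList l)

/-- A bit; both bits have the same size, and neither is `nil`. -/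
def ofBit : Bool → Data
  | false => cons nil (cons nil nil)
  | true => cons (cons nil nil) nil

/-- A bit string. -/
def ofBits (s : List Bool) : Data := ofList (s.map ofBit)

/-- The security parameter in unary, `1^n`. -/
def unary (n : ℕ) : Data := ofList (List.replicate n nil)

/-- A family indexed by `(i, b)` with `i ∈ [n]` and `b ∈ {0,1}`. -/
def ofFam {n : ℕ} (f : Fin n → Bool → Data) : Data :=
  ofList (List.ofFn fun i => cons (f i false) (f i true))

/-- A transcript: a list of exchanges (first party's message, second party's answer). -/
def ofTranscript (t : List (Data × Data)) : Data :=
  ofList (t.map fun e => cons e.1 e.2)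

/-- The `k`-th entry of a list (`nil` if there is none). -/
def nth : Data → ℕ → Data
  | d, 0 => d.head
  | d, k + 1 => nth d.tail k

/-- The entry `(i, b)` of a family; total, so that malformed messages are read as something. -/
def fam {n : ℕ} (d : Data) (i : Fin n) (b : Bool) : Data :=
  if b then (d.nth i).tail else (d.nth i).head

/-- Reads one bit. -/
def toBit (d : Data) : Bool :=
  match d.head with
  | nil => false
  | cons _ _ => true

/-- Reads exactly `n` bits; missing bits are read as `0`. -/
def toBits (n : ℕ) (d : Data) : Fin n → Bool := fun i => (d.nth i).toBit

/-- Reads a bit string of any length. -/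
def toStr : Data → List Bool
  | nil => []
  | cons a d => a.toBit :: toStr d

end Data

/-- Programs of a WHILE language over binary trees; a program maps a tree to a tree. -/
inductive Code : Type
  | copy : Code
  | mkNil : Code
  | head : Code
  | tail : Code
  | pair : Code → Code → Code
  | comp : Code → Code → Code
  | ite : Code → Code → Code → Code
  | loop : Code → Code → Code

/-- `Runs c x t y`: on input `x`, the program `c` halts after `t` steps with output `y`.  A basic
operation costs the size of its argument, so that running times (and the sizes of the outputs,
which they bound) agree with those of Turing machines up to a polynomial. -/
inductive Runs : Code → Data → ℕ → Data → Prop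
  | copy (x : Data) : Runs .copy x x.size x
  | mkNil (x : Data) : Runs .mkNil x x.size .nil
  | head (x : Data) : Runs .head x x.size x.head
  | tail (x : Data) : Runs .tail x x.size x.tail
  | pair {f g : Code} {x y z : Data} {s t : ℕ} :
      Runs f x s y → Runs g x t z → Runs (.pair f g) x (s + t + 1) (.cons y z)
  | comp {f g : Code} {x y z : Data} {s t : ℕ} :
      Runs f x s y → Runs g y t z → Runs (.comp g f) x (s + t + 1) z
  | iteThen {c f g : Code} {x v y : Data} {s t : ℕ} :
      Runs c x s v → v ≠ .nil → Runs f x t y → Runs (.ite c f g) x (s + t + 1) y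
  | iteElse {c f g : Code} {x y : Data} {s t : ℕ} :
      Runs c x s .nil → Runs g x t y → Runs (.ite c f g) x (s + t + 1) y
  | loopStop {c f : Code} {x : Data} {s : ℕ} :
      Runs c x s .nil → Runs (.loop c f) x (s + 1) x
  | loopStep {c f : Code} {x v y z : Data} {s t u : ℕ} :
      Runs c x s v → v ≠ .nil → Runs f x t y → Runs (.loop c f) y u z →
        Runs (.loop c f) x (s + t + u + 1) z

/-- `f` is computed by a program in time polynomial in the size of the input. -/
def PolyTime (f : Data → Data) : Prop :=
  ∃ (c : Code) (p : Polynomial ℕ), ∀ x, ∃ t, t ≤ p.eval x.size ∧ Runs c x t (f x)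

/-- A function on bit strings is computable in polynomial time. -/
def PolyTimeStr (f : List Bool → List Bool) : Prop :=
  ∃ F : Data → Data, PolyTime F ∧ ∀ s, F (Data.ofBits s) = Data.ofBits (f s)

/-- A probabilistic polynomial-time (interactive) algorithm, given by its next-message function,
which is applied to the input, the random coins and the messages received so far.  The number of
coins is a polynomial in the security parameter (plus, where indicated, the length of the common
input).  A non-interactive algorithm is the case of an empty list of messages. -/
structure PPT where
  fn : Data → Data
  polyTime : PolyTime fn
  coins : Polynomial ℕ

namespace PPT

/-- The coin strings for length parameter `k`. -/
abbrev Coins (A : PPT) (k : ℕ) : Type := Fin (A.coins.eval k) → Bool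

/-- The next message, for input `x`, coins `r` and received messages `l`. -/
def next (A : PPT) (x : Data) {k : ℕ} (r : A.Coins k) (l : List Data) : Data :=
  A.fn (.cons x (.cons (Data.ofBits (List.ofFn r)) (Data.ofList l)))

end PPT

/-! ### Probability and interaction -/

/-- The uniform distribution on a finite non-empty type. -/
noncomputable def unif (α : Type) [Fintype α] [Nonempty α] : PMF α := PMF.uniformOfFintype α

/-- The probability of an event. -/
noncomputable def Pr {α : Type} (p : PMF α) (E : Set α) : ℝ := (p.toOuterMeasure E).toReal

/-- Negligible functions: those that decay faster than every inverse polynomial. -/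
def Negligible (ν : ℕ → ℝ) : Prop :=
  Asymptotics.SuperpolynomialDecay atTop (fun n : ℕ => (n : ℝ)) ν

/-- The transcript of `k` rounds of interaction; in each round the strategy `A` sends a message
and `B` answers.  A strategy maps the list of messages received so far to the next message. -/
def interact (A B : List Data → Data) : ℕ → List (Data × Data)
  | 0 => []
  | k + 1 =>
    let t := interact A B k
    let a := A (t.map Prod.snd)
    t ++ [(a, B (t.map Prod.fst ++ [a]))]

/-! ### Promise problems -/

structure PromiseProblem where
  yes : Set (List Bool)
  no : Set (List Bool)
  disjoint : Disjoint yes no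

/-- `gen` is a polynomial-time sampler, as a function of its random string, whose support is the
set of all yes- and no-instances. -/
def IsSampler (P : PromiseProblem) (gen : List Bool → List Bool) : Prop :=
  PolyTimeStr gen ∧ Set.range gen = P.yes ∪ P.no

/-- The probability that `D`, on input `1^n` and an instance sampled with `n` random bits, answers
correctly; the answer `nil` means "no-instance", every other answer means "yes-instance". -/
noncomputable def successProb (P : PromiseProblem) (gen : List Bool → List Bool) (D : PPT)
    (n : ℕ) : ℝ :=
  Pr (do
      let r ← unif (Fin n → Bool)
      let s ← unif (D.Coins n)
      let x := gen (List.ofFn r)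
      pure (x, D.next (.cons (Data.unary n) (Data.ofBits x)) s []))
    {o | (o.2 ≠ .nil ∧ o.1 ∈ P.yes) ∨ (o.2 = .nil ∧ o.1 ∈ P.no)}

def HardOnAverage (P : PromiseProblem) (gen : List Bool → List Bool) : Prop :=
  IsSampler P gen ∧
    ∀ D : PPT, ∃ ν, Negligible ν ∧ ∀ n, successProb P gen D n ≤ 1 / 2 + ν n

/-! ### Commitment schemes -/

/-- A constant-round commitment scheme in which both parties have a common auxiliary input
`x ∈ {0,1}*` (an instance, or the empty string for an ordinary scheme).  In each round the sender
speaks and the receiver answers; messages may be empty.  The commitment is the transcript. -/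
structure CommitmentScheme where
  rounds : ℕ
  sender : PPT
  receiver : PPT

namespace CommitmentScheme

variable (C : CommitmentScheme)

abbrev SenderCoins (n : ℕ) (x : List Bool) : Type := C.sender.Coins (n + x.length)

abbrev ReceiverCoins (n : ℕ) (x : List Bool) : Type := C.receiver.Coins (n + x.length)

/-- The honest sender committing to the string `m`. -/
def send (n : ℕ) (x m : List Bool) (r : C.SenderCoins n x) : List Data → Data :=
  C.sender.next (.cons (Data.unary n) (.cons (Data.ofBits x) (Data.ofBits m))) r

/-- The honest receiver. -/
def receive (n : ℕ) (x : List Bool) (r : C.ReceiverCoins n x) : List Data → Data :=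
  C.receiver.next (.cons (Data.unary n) (Data.ofBits x)) r

/-- The canonical verifier: the sender's coins `r` and the message `m` are consistent with the
transcript `t`. -/
def Opens (n : ℕ) (x : List Bool) (t : List (Data × Data)) (m : List Bool)
    (r : C.SenderCoins n x) : Prop :=
  t.length = C.rounds ∧
    ∀ (j : ℕ) (hj : j < t.length), t[j].1 = C.send n x m r ((t.take j).map Prod.snd)

/-- Statistical binding for all auxiliary inputs in `X`, for messages of length `len n`: whatever
an unbounded sender does, the transcript has openings to two messages only with negligible
probability (over the receiver's coins), uniformly over auxiliary inputs of polynomial length. -/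
def StatBinding (X : Set (List Bool)) (len : ℕ → ℕ) : Prop :=
  ∀ p : Polynomial ℕ, ∃ ν, Negligible ν ∧
    ∀ n, ∀ x ∈ X, x.length ≤ p.eval n → ∀ A : List Data → Data,
      Pr (unif (C.ReceiverCoins n x))
        {r | ∃ m m' : List Bool, m.length = len n ∧ m'.length = len n ∧ m ≠ m' ∧
          ∃ s s' : C.SenderCoins n x,
            C.Opens n x (interact A (C.receive n x r) C.rounds) m s ∧
            C.Opens n x (interact A (C.receive n x r) C.rounds) m' s'} ≤ ν n

/-- Statistical hiding for all auxiliary inputs in `X`, for messages of length `len n`: the views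
of an unbounded receiver for any two messages are negligibly close in statistical distance (the
maximum over all events of the difference of the probabilities). -/
def StatHiding (X : Set (List Bool)) (len : ℕ → ℕ) : Prop :=
  ∀ p : Polynomial ℕ, ∃ ν, Negligible ν ∧
    ∀ n, ∀ x ∈ X, x.length ≤ p.eval n → ∀ B : List Data → Data,
      ∀ m m' : List Bool, m.length = len n → m'.length = len n →
        ∀ E : Set (List (Data × Data)),
          |Pr (unif (C.SenderCoins n x)) {r | interact (C.send n x m r) B C.rounds ∈ E}
            - Pr (unif (C.SenderCoins n x)) {r | interact (C.send n x m' r) B C.rounds ∈ E}|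
            ≤ ν n

/-- The hiding experiment for messages of `n` bits (no auxiliary input): the adversary first
outputs a pair of messages, then acts as the receiver while one of them is committed to, and
finally (activated with the extra message `nil`) outputs a guess, which is 1 unless it is `nil`.
The result is the probability that the guess is 1. -/
noncomputable def hidingExp (A : PPT) (n : ℕ) (second : Bool) : ℝ :=
  Pr (do
      let a ← unif (A.Coins n)
      let r ← unif (C.SenderCoins n [])
      let adv := A.next (Data.unary n) a
      let m := if second then (adv []).tail.toBits n else (adv []).head.toBits n
      let t := interact (C.send n [] (List.ofFn m) r) adv C.rounds
      pure (adv (t.map Prod.fst ++ [.nil])))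
    {g | g ≠ .nil}

/-- Computational hiding, for messages of `n` bits. -/
def CompHiding : Prop :=
  ∀ A : PPT, ∃ ν, Negligible ν ∧ ∀ n, |C.hidingExp A n false - C.hidingExp A n true| ≤ ν n

/-- A statistically binding (and computationally hiding) commitment scheme for strings in
`{0,1}^n`. -/
structure IsStatBindingCommitment : Prop where
  isBinding : C.StatBinding {[]} (fun n => n)
  isHiding : C.CompHiding

/-- An instance-dependent commitment scheme for bits: statistically hiding on yes-instances,
statistically binding on no-instances. -/
structure IsInstanceDependent (P : PromiseProblem) : Prop where
  isHiding : C.StatHiding P.yes (fun _ => 1)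
  isBinding : C.StatBinding P.no (fun _ => 1)

end CommitmentScheme

/-! ### Witness-indistinguishable proofs -/

/-- A constant-round interactive proof system with an efficient prover that is given a witness.  In
each round the prover speaks and the verifier answers. -/
structure ProofSystem where
  rounds : ℕ
  prover : PPT
  verifier : PPT

namespace ProofSystem

variable (W : ProofSystem)

abbrev ProverCoins (n : ℕ) (s : Data) : Type := W.prover.Coins (n + s.size)

abbrev VerifierCoins (n : ℕ) (s : Data) : Type := W.verifier.Coins (n + s.size)

/-- The honest prover with statement `s` and witness `w`. -/
def prove (n : ℕ) (s w : Data) (r : W.ProverCoins n s) : List Data → Data :=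
  W.prover.next (.cons (Data.unary n) (.cons s w)) r

/-- The honest verifier with statement `s`. -/
def verify (n : ℕ) (s : Data) (r : W.VerifierCoins n s) : List Data → Data :=
  W.verifier.next (.cons (Data.unary n) s) r

/-- After the prover's messages `l`, the honest verifier accepts: its verdict is not `nil`. -/
def Accepts (n : ℕ) (s : Data) (r : W.VerifierCoins n s) (l : List Data) : Prop :=
  W.verify n s r (l ++ [.nil]) ≠ .nil

/-- The probability that the verifier `V`, with auxiliary input `z`, outputs 1 (that is, anything
but `nil`) after a proof of `s` with witness `w`. -/
noncomputable def outputProb (V : PPT) (n : ℕ) (s w z : Data) : ℝ :=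
  Pr (do
      let r ← unif (W.ProverCoins n s)
      let v ← unif (V.Coins n)
      let adv := V.next (.cons (Data.unary n) (.cons s z)) v
      let t := interact (W.prove n s w r) adv W.rounds
      pure (adv (t.map Prod.fst ++ [.nil])))
    {g | g ≠ .nil}

/-- `W` is a witness-indistinguishable proof system for the relation `R n`, where `n` is the
security parameter and lengths are polynomial in `n`. -/
structure IsWIProof (R : ℕ → Data → Data → Prop) : Prop where
  complete : ∀ p : Polynomial ℕ, ∃ ν, Negligible ν ∧
    ∀ n s w, s.size ≤ p.eval n → w.size ≤ p.eval n → R n s w →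
      1 - ν n ≤ Pr (do
          let r ← unif (W.ProverCoins n s)
          let v ← unif (W.VerifierCoins n s)
          pure (r, v))
        {o | W.Accepts n s o.2
          ((interact (W.prove n s w o.1) (W.verify n s o.2) W.rounds).map Prod.fst)}
  sound : ∀ p : Polynomial ℕ, ∃ ν, Negligible ν ∧
    ∀ n s, s.size ≤ p.eval n → (¬ ∃ w, R n s w) → ∀ A : List Data → Data,
      Pr (unif (W.VerifierCoins n s))
        {v | W.Accepts n s v ((interact A (W.verify n s v) W.rounds).map Prod.fst)} ≤ ν n
  indistinguishable : ∀ (p : Polynomial ℕ) (V : PPT), ∃ ν, Negligible ν ∧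
    ∀ n s w₀ w₁ z, s.size ≤ p.eval n → w₀.size ≤ p.eval n → w₁.size ≤ p.eval n →
      z.size ≤ p.eval n → R n s w₀ → R n s w₁ →
        |W.outputProb V n s w₀ z - W.outputProb V n s w₁ z| ≤ ν n

end ProofSystem

/-! ### The commitment protocol -/

/-- The bitwise exclusive or. -/
def xorBits {n : ℕ} (u v : Fin n → Bool) : Fin n → Bool := fun j => xor (u j) (v j)

/-- The exclusive or of all bits of a family. -/
def xorFam {n : ℕ} (m : Fin n → Bool → Bool) : Bool :=
  (List.ofFn fun i => xor (m i false) (m i true)).foldr xor false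

/-- The sessions run in parallel: the `(i, b)`-th entry of a message belongs to session `(i, b)`. -/
def parallel {n : ℕ} (A : Fin n → Bool → List Data → Data) : List Data → Data :=
  fun l => Data.ofFam fun i b => A i b (l.map fun d => d.fam i b)

/-- The transcript of session `(i, b)` of a parallel execution. -/
def session {n : ℕ} (t : List (Data × Data)) (i : Fin n) (b : Bool) : List (Data × Data) :=
  t.map fun e => (e.1.fam i b, e.2.fam i b)

/-- The ingredients of the protocol: a sampler of instances, a statistically binding commitment
scheme, a proof system and an instance-dependent commitment scheme. -/
structure Ingredients where
  gen : List Bool → List Bool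
  sbc : CommitmentScheme
  wi : ProofSystem
  idc : CommitmentScheme

namespace Ingredients

variable (I : Ingredients)

/-- The statement: the transcripts `C i b` of the receiver's commitments, the sender's strings
`σ i b` and the instances `x i b`. -/
def statement {n : ℕ} (C : Fin n → Bool → List (Data × Data)) (σ : Fin n → Bool → Fin n → Bool)
    (x : Fin n → Bool → List Bool) : Data :=
  .cons (Data.ofFam fun i b => Data.ofTranscript (C i b))
    (.cons (Data.ofFam fun i b => Data.ofBits (List.ofFn (σ i b)))
      (Data.ofFam fun i b => Data.ofBits (x i b)))

/-- The witness: a bit `β`, the strings `ρ i` and the coins `c i` with which they are committed. -/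
def witness {n : ℕ} (β : Bool) (ρ : Fin n → Fin n → Bool)
    (c : Fin n → I.sbc.SenderCoins n []) : Data :=
  .cons (Data.ofBit β)
    (.cons (Data.ofList (List.ofFn fun i => Data.ofBits (List.ofFn (ρ i))))
      (Data.ofList (List.ofFn fun i => Data.ofBits (List.ofFn (c i)))))

/-- The relation of the proof: for the bit `β` of the witness, each `x i β` is generated from
`ρ i ⊕ σ i β`, where `ρ i` is consistent with the commitment `C i β`. -/
def consistent (n : ℕ) (s w : Data) : Prop :=
  ∃ (C : Fin n → Bool → List (Data × Data)) (σ : Fin n → Bool → Fin n → Bool)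
    (x : Fin n → Bool → List Bool) (β : Bool) (ρ : Fin n → Fin n → Bool)
    (c : Fin n → I.sbc.SenderCoins n []),
    s = statement C σ x ∧ w = I.witness β ρ c ∧
      ∀ i, I.sbc.Opens n [] (C i β) (List.ofFn (ρ i)) (c i) ∧
        x i β = I.gen (List.ofFn (xorBits (ρ i) (σ i β)))

/-- The outcome of the commit phase: the instances, the transcripts of the instance-dependent
commitments, and what the sender outputs in the end. -/
structure Outcome (n : ℕ) where
  inst : Fin n → Bool → List Bool
  com : Fin n → Bool → List (Data × Data)
  output : Data

/-- The commit phase with security parameter `n`, between the honest receiver and a sender with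
strategy `S` (its coins being fixed).  A message `nil` of the receiver only asks for the sender's
next message. -/
noncomputable def commitPhase (n : ℕ) (S : List Data → Data) : PMF (Outcome n) := do
  -- coin tossing into the well
  let ρ ← unif (Fin n → Bool → Fin n → Bool)
  let c ← unif (Fin n → Bool → I.sbc.SenderCoins n [])
  let t₁ := interact (parallel fun i b => I.sbc.send n [] (List.ofFn (ρ i b)) (c i b)) S
    I.sbc.rounds
  let h₁ := t₁.map Prod.fst ++ [.nil]
  let σ : Fin n → Bool → Fin n → Bool := fun i b => ((S h₁).fam i b).toBits n
  -- generating hard instances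
  let x : Fin n → Bool → List Bool := fun i b => I.gen (List.ofFn (xorBits (ρ i b) (σ i b)))
  let h₂ := h₁ ++ [Data.ofFam fun i b => Data.ofBits (x i b)]
  let s := statement (session t₁) σ x
  let w := I.witness false (fun i => ρ i false) (fun i => c i false)
  let r ← unif (I.wi.ProverCoins n s)
  let t₂ := interact (I.wi.prove n s w r) (fun l => S (h₂ ++ l)) I.wi.rounds
  let h₃ := h₂ ++ t₂.map Prod.fst ++ [.nil]
  -- instance-binding commitment
  let d ← unif ((i : Fin n) → (b : Bool) → I.idc.ReceiverCoins n (x i b))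
  let t₃ := interact (fun l => S (h₃ ++ l)) (parallel fun i b => I.idc.receive n (x i b) (d i b))
    I.idc.rounds
  pure ⟨x, session t₃, S (h₃ ++ t₃.map Prod.snd)⟩

/-- The verification: `D` opens the commitment to the bit `m` if it consists of openings of all the
instance-dependent commitments, to bits whose exclusive or is `m`. -/
def Opens {n : ℕ} (o : Outcome n) (D : Data) (m : Bool) : Prop :=
  ∃ (μ : Fin n → Bool → Bool) (r : (i : Fin n) → (b : Bool) → I.idc.SenderCoins n (o.inst i b)),
    D = Data.ofFam (fun i b => .cons (Data.ofBit (μ i b)) (Data.ofBits (List.ofFn (r i b)))) ∧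
      (∀ i b, I.idc.Opens n (o.inst i b) (o.com i b) [μ i b] (r i b)) ∧ xorFam μ = m

/-- The random choices of the honest sender that commits to `m`; all are uniform, the shares subject
to `xorFam share = m`.  Of a tape, as many bits are read as are needed. -/
structure SenderRandomness (n : ℕ) (m : Bool) where
  sbcCoins : Fin n → Bool → I.sbc.ReceiverCoins n []
  σ : Fin n → Bool → Fin n → Bool
  wiTape : ℕ → Bool
  share : Fin n → Bool → Bool
  xor_share : xorFam share = m
  idcTape : Fin n → Bool → ℕ → Bool

/-- The strategy of the honest sender in the commit phase; it aborts (sends `nil` from then on) if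
the proof is rejected, and outputs its decommitment in the end. -/
noncomputable def honestSender {n : ℕ} {m : Bool} (R : I.SenderRandomness n m)
    (l : List Data) : Data :=
  let sbcReply : List Data → Fin n → Bool → Data := fun l' i b =>
    I.sbc.receive n [] (R.sbcCoins i b) (l'.map fun d => d.fam i b)
  if l.length ≤ I.sbc.rounds then Data.ofFam (sbcReply l)
  else if l.length = I.sbc.rounds + 1 then
    Data.ofFam fun i b => Data.ofBits (List.ofFn (R.σ i b))
  else
    let x : Fin n → Bool → List Bool :=
      fun i b => ((l.getD (I.sbc.rounds + 1) .nil).fam i b).toStr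
    let C : Fin n → Bool → List (Data × Data) := fun i b =>
      (List.range I.sbc.rounds).map fun j =>
        ((l.getD j .nil).fam i b, sbcReply (l.take (j + 1)) i b)
    let s := statement C R.σ x
    let l₂ := l.drop (I.sbc.rounds + 2)
    let v : I.wi.VerifierCoins n s := fun j => R.wiTape j
    if l₂.length ≤ I.wi.rounds then I.wi.verify n s v l₂
    else
      open Classical in
      if I.wi.Accepts n s v (l₂.take I.wi.rounds) then
        let l₃ := l₂.drop (I.wi.rounds + 1)
        let r : (i : Fin n) → (b : Bool) → I.idc.SenderCoins n (x i b) :=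
          fun i b j => R.idcTape i b j
        if l₃.length < I.idc.rounds then
          parallel (fun i b => I.idc.send n (x i b) [R.share i b] (r i b)) l₃
        else
          Data.ofFam fun i b =>
            .cons (Data.ofBit (R.share i b)) (Data.ofBits (List.ofFn (r i b)))
      else .nil

/-- The probability that the sender `S` breaks binding: it outputs two decommitments, the first of
which opens the commitment to 0 and the second of which opens it to 1. -/
noncomputable def breakProb (S : PPT) (n : ℕ) : ℝ :=
  Pr (do
      let r ← unif (S.Coins n)
      I.commitPhase n (S.next (Data.unary n) r))
    {o | I.Opens o o.output.head false ∧ I.Opens o o.output.tail true}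

/-- The protocol is computationally binding. -/
def CompBinding : Prop :=
  ∀ S : PPT, ∃ ν, Negligible ν ∧ ∀ n, I.breakProb S n ≤ ν n

end Ingredients

/-! ### Programs -/

namespace Data

/-! If a sender opens one commitment to 0 and to 1, the two families of opened bits have different
exclusive ors. Hence in some session `(i, b)` the instance-dependent commitment is opened to both
bits: the sender equivocates there (`equivocates_of_opens`). By a union bound over the 2n sessions
(`breakProb_le`), it equivocates in a random target session with probability at least ε/(2n), up to
the error n/2^n made by drawing the index with coin flips (`expect_index_ge`).

The target instance is made independent of everything else in two moves. Witness
indistinguishability allows the proof to use the bit `!b` instead of 0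
(`exists_equivocationProb_sub_le`), because an honest receiver has valid witnesses for both bits.
After that, the string `ρ i b` and its commitment coins enter the execution after the coin tossing
only through the target instance (`equivocatesOn_patch`), so hiding applies to the commitment `C i
b`. The adversary offers a mask `u` and an independent `ρ i b` as messages, and computes the target
instance from `u ⊕ σ`. If `u` is committed, this is an honest execution (`hidingExp_first`). If `ρ i
b` is committed, then `u` is independent of the coin tossing, so `u ⊕ σ` is uniform and the instance
is a fresh sample (`hidingExp_second`).

The decider plants its input at a random target, answers "yes" if the sender equivocates there, and
otherwise flips a coin. On a no-instance equivocation has negligible probability by statistical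
binding (`exists_expect_equivocates_le`), so the advantage is half of ε/(2n), up to negligible terms
(`expect_guess_ge`, `exists_successProb_ge`). Computational binding follows because 4n times a
negligible function is negligible.

The bulk of the formal work is to show that the reductions are polynomial time. The relation `Eff e
f` ("`f` is computable from the encoding `e`") is closed under all the constructions of the
protocol, for arguments of dependent type. Probabilities are written as iterated finite averages
(`Pr_bind`). All random choices of a reduction are read from disjoint places of one bit string
(`expect_choices`), and a party whose number of coins depends on an instance reads a tape that is
long enough (`Adequate`). -/

def toList : Data → List Data
  | nil => []
  | cons a d => a :: toList d

@[simp] theorem ofList_toList (d : Data) : ofList d.toList = d := by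
  induction d with
  | nil => rfl
  | cons a d _ ih => simp [toList, ofList, ih]

@[simp] theorem toList_ofList (l : List Data) : (ofList l).toList = l := by
  induction l with
  | nil => rfl
  | cons a l ih => simp [toList, ofList, ih]

theorem size_pos (d : Data) : 1 ≤ d.size := by cases d <;> simp [size]

theorem size_head_le (d : Data) : d.head.size ≤ d.size := by
  cases d <;> simp [size, head]; omega

theorem size_tail_le (d : Data) : d.tail.size ≤ d.size := by
  cases d <;> simp [size, tail]; omega

theorem size_ofList (l : List Data) : (ofList l).size = (l.map fun d => d.size + 1).sum + 1 := by
  induction l with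
  | nil => rfl
  | cons a l ih => simp [ofList, size, ih]; omega

theorem length_toList_le (d : Data) : d.toList.length + 1 ≤ d.size := by
  induction d with
  | nil => simp [toList, size]
  | cons a d _ ih => simp [toList, size]; omega

def isNil : Data → Bool
  | nil => true
  | cons _ _ => false

theorem isNil_iff (d : Data) : d.isNil = true ↔ d = nil := by cases d <;> simp [isNil]

@[simp] theorem head_cons (a d : Data) : (cons a d).head = a := rfl
@[simp] theorem tail_cons (a d : Data) : (cons a d).tail = d := rfl
@[simp] theorem head_nil : nil.head = nil := rfl
@[simp] theorem tail_nil : nil.tail = nil := rfl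

end Data

theorem Polynomial.eval_mono_nat (p : Polynomial ℕ) {a b : ℕ} (h : a ≤ b) :
    p.eval a ≤ p.eval b := by
  induction p using Polynomial.induction_on' with
  | add p q hp hq => simpa using Nat.add_le_add hp hq
  | monomial n c => simpa using Nat.mul_le_mul_left c (Nat.pow_le_pow_left h n)

theorem Runs.size_input_le {c : Code} {x y : Data} {t : ℕ} (h : Runs c x t y) : x.size ≤ t := by
  induction h <;> omega

/-- Basic operations are charged the size of their argument, so time bounds size; this is what makes
polynomial time closed under composition. -/
theorem Runs.size_output_le {c : Code} {x y : Data} {t : ℕ} (h : Runs c x t y) : y.size ≤ t := by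
  induction h with
  | copy => rfl
  | mkNil x => exact x.size_pos
  | head x => exact x.size_head_le
  | tail x => exact x.size_tail_le
  | pair => simp only [Data.size]; omega
  | loopStop h => have := h.size_input_le; omega
  | _ => omega

namespace PolyTime

variable {f g h : Data → Data}

theorem size_le (hf : PolyTime f) : ∃ p : Polynomial ℕ, ∀ x, (f x).size ≤ p.eval x.size := by
  obtain ⟨c, p, hp⟩ := hf
  refine ⟨p, fun x => ?_⟩
  obtain ⟨t, ht, hr⟩ := hp x
  exact hr.size_output_le.trans ht

theorem id : PolyTime fun x => x :=
  ⟨.copy, Polynomial.X, fun x => ⟨x.size, by simp, .copy x⟩⟩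

theorem head' : PolyTime Data.head :=
  ⟨.head, Polynomial.X, fun x => ⟨x.size, by simp, .head x⟩⟩

theorem tail' : PolyTime Data.tail :=
  ⟨.tail, Polynomial.X, fun x => ⟨x.size, by simp, .tail x⟩⟩

theorem cons (hf : PolyTime f) (hg : PolyTime g) : PolyTime fun x => .cons (f x) (g x) := by
  obtain ⟨c, p, hp⟩ := hf
  obtain ⟨d, q, hq⟩ := hg
  refine ⟨.pair c d, p + q + 1, fun x => ?_⟩
  obtain ⟨s, hs, hr⟩ := hp x
  obtain ⟨t, ht, hr'⟩ := hq x
  exact ⟨_, by simp; omega, hr.pair hr'⟩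

theorem const (d : Data) : PolyTime fun _ => d := by
  induction d with
  | nil => exact ⟨.mkNil, Polynomial.X, fun x => ⟨x.size, by simp, .mkNil x⟩⟩
  | cons a d ha hd => exact ha.cons hd

theorem comp (hg : PolyTime g) (hf : PolyTime f) : PolyTime fun x => g (f x) := by
  obtain ⟨r, hr⟩ := hf.size_le
  obtain ⟨c, p, hp⟩ := hf
  obtain ⟨d, q, hq⟩ := hg
  refine ⟨.comp d c, p + q.comp r + 1, fun x => ?_⟩
  obtain ⟨s, hs, hs'⟩ := hp x
  obtain ⟨t, ht, ht'⟩ := hq (f x)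
  have := q.eval_mono_nat (hr x)
  exact ⟨_, by simp; omega, hs'.comp ht'⟩

theorem head (hf : PolyTime f) : PolyTime fun x => (f x).head := head'.comp hf

theorem tail (hf : PolyTime f) : PolyTime fun x => (f x).tail := tail'.comp hf

theorem ite (hh : PolyTime h) (hf : PolyTime f) (hg : PolyTime g) :
    PolyTime fun x => if (h x).isNil then f x else g x := by
  obtain ⟨c, p, hp⟩ := hh
  obtain ⟨d, q, hq⟩ := hf
  obtain ⟨e, r, hr⟩ := hg
  refine ⟨.ite c e d, p + q + r + 1, fun x => ?_⟩
  obtain ⟨s, hs, hs'⟩ := hp x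
  obtain ⟨t, ht, ht'⟩ := hq x
  obtain ⟨u, hu, hu'⟩ := hr x
  by_cases hn : h x = .nil
  · refine ⟨s + t + 1, by simp; omega, ?_⟩
    beta_reduce
    rw [if_pos ((Data.isNil_iff _).2 hn)]
    exact .iteElse (hn ▸ hs') ht'
  · refine ⟨s + u + 1, by simp; omega, ?_⟩
    beta_reduce
    rw [if_neg (fun h' => hn ((Data.isNil_iff _).1 h'))]
    exact .iteThen hs' hn hu'

/-- The bound `q` on all intermediate states cannot be dropped: a polynomial-time body may square
the size at each turn. With it, every turn costs at most one fixed polynomial in the size of the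
input. `N x` is exactly the turn at which the guard first yields `nil`. -/
theorem loop {c f g : Data → Data} (hc : PolyTime c) (hf : PolyTime f) (hg : PolyTime g)
    (N : Data → ℕ) (hpos : ∀ x, ∀ j < N x, c (f^[j] (g x)) ≠ .nil)
    (hdone : ∀ x, c (f^[N x] (g x)) = .nil) (r q : Polynomial ℕ)
    (hr : ∀ x, N x ≤ r.eval x.size) (hq : ∀ x, ∀ j ≤ N x, (f^[j] (g x)).size ≤ q.eval x.size) :
    PolyTime fun x => f^[N x] (g x) := by
  obtain ⟨u, v, huv⟩ := hg
  obtain ⟨cc, pc, hpc⟩ := hc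
  obtain ⟨cf, pf, hpf⟩ := hf
  -- The size bound `Q` is detached from the input, so that the induction on the number of turns may
  -- move the starting state.
  have key : ∀ (Q m : ℕ) (y : Data), (∀ j < m, c (f^[j] y) ≠ .nil) → c (f^[m] y) = .nil →
      (∀ j ≤ m, (f^[j] y).size ≤ Q) →
      ∃ t, t ≤ (m + 1) * (pc.eval Q + pf.eval Q + 1) ∧ Runs (.loop cc cf) y t (f^[m] y) := by
    intro Q m
    induction m with
    | zero =>
      intro y _ h0 hQ
      obtain ⟨s, hs, hs'⟩ := hpc y
      have := pc.eval_mono_nat (hQ 0 le_rfl)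
      simp only [Function.iterate_zero, id_eq] at *
      exact ⟨s + 1, by omega, .loopStop (h0 ▸ hs')⟩
    | succ m ih =>
      intro y h1 h0 hQ
      obtain ⟨s, hs, hs'⟩ := hpc y
      obtain ⟨t, ht, ht'⟩ := hpf y
      obtain ⟨w, hw, hw'⟩ := ih (f y) (fun j hj => by simpa using h1 (j + 1) (by omega))
        (by simpa using h0) (fun j hj => by simpa using hQ (j + 1) (by omega))
      have h2 := pc.eval_mono_nat (hQ 0 (Nat.zero_le _))
      have h3 := pf.eval_mono_nat (hQ 0 (Nat.zero_le _))
      simp only [Function.iterate_zero, id_eq] at h2 h3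
      refine ⟨s + t + w + 1, ?_, ?_⟩
      · rw [add_mul (m + 1)]; omega
      · rw [Function.iterate_succ_apply]
        exact .loopStep hs' (by simpa using h1 0 (by omega)) ht' hw'
  refine ⟨.comp (.loop cc cf) u, v + (r + 1) * (pc.comp q + pf.comp q + 1) + 1, fun x => ?_⟩
  obtain ⟨s, hs, hs'⟩ := huv x
  obtain ⟨t, ht, ht'⟩ := key (q.eval x.size) (N x) (g x) (hpos x) (hdone x) (hq x)
  refine ⟨s + t + 1, ?_, hs'.comp ht'⟩
  have : (N x + 1) * (pc.eval (q.eval x.size) + pf.eval (q.eval x.size) + 1)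
      ≤ (r.eval x.size + 1) * (pc.eval (q.eval x.size) + pf.eval (q.eval x.size) + 1) :=
    Nat.mul_le_mul_right _ (Nat.add_le_add_right (hr x) 1)
  simp
  omega

/-- Folding over a list, if the accumulator stays of polynomial size. -/
theorem foldl {l init step : Data → Data} (hl : PolyTime l) (hi : PolyTime init)
    (hs : PolyTime step) (q : Polynomial ℕ)
    (hq : ∀ x k, (((l x).toList.take k).foldl (fun acc y => step (.cons x (.cons acc y)))
      (init x)).size ≤ q.eval x.size) :
    PolyTime fun x => (l x).toList.foldl (fun acc y => step (.cons x (.cons acc y))) (init x) := by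
  -- A state is the triple of `x`, the accumulator and the rest of the list; the loop ends when the
  -- rest is `nil`.
  let body : Data → Data := fun st => .cons st.head
    (.cons (step (.cons st.head (.cons st.tail.head st.tail.tail.head))) st.tail.tail.tail)
  have hbody : PolyTime body :=
    .cons id.head (.cons (hs.comp (.cons id.head (.cons id.tail.head id.tail.tail.head)))
      id.tail.tail.tail)
  have hit : ∀ x j, j ≤ (l x).toList.length →
      body^[j] (.cons x (.cons (init x) (l x))) =
        .cons x (.cons (((l x).toList.take j).foldl (fun acc y => step (.cons x (.cons acc y)))
          (init x)) (Data.ofList ((l x).toList.drop j))) := by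
    intro x j
    induction j with
    | zero => simp
    | succ j ih =>
      intro hj
      rw [Function.iterate_succ_apply', ih (by omega), List.take_add_one,
        List.drop_eq_getElem_cons (by omega : j < (l x).toList.length),
        List.getElem?_eq_getElem (by omega)]
      simp only [body, Data.ofList, Data.head_cons, Data.tail_cons, Option.toList_some,
        List.foldl_append, List.foldl_cons, List.foldl_nil]
  obtain ⟨p, hp⟩ := hl.size_le
  have := PolyTime.loop (c := fun st => st.tail.tail) (g := fun x => .cons x (.cons (init x) (l x)))
    id.tail.tail hbody (id.cons (hi.cons hl)) (fun x => (l x).toList.length)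
    (fun x j hj => by
      rw [hit x j hj.le, List.drop_eq_getElem_cons hj]; simp [Data.ofList])
    (fun x => by rw [hit x _ le_rfl]; simp [Data.ofList])
    p (Polynomial.X + q + p + 2)
    (fun x => by have := hp x; have := (l x).length_toList_le; omega)
    (fun x j hj => by
      rw [hit x j hj]
      have h1 := hq x j
      have h2 : (Data.ofList ((l x).toList.drop j)).size ≤ (l x).size := by
        conv_rhs => rw [← Data.ofList_toList (l x), ← List.take_append_drop j (l x).toList]
        simp only [Data.size_ofList, List.map_append, List.sum_append]
        omega
      have h3 := hp x
      simp only [Data.size, Polynomial.eval_add, Polynomial.eval_X, Polynomial.eval_ofNat]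
      omega)
  convert this.tail.head using 2 with x
  rw [hit x _ le_rfl]
  simp

end PolyTime

/-! ### Functions computable from given data -/

/-- `f a` can be computed in polynomial time from `e a`. -/
def Eff {α : Type} (e f : α → Data) : Prop := ∃ F, PolyTime F ∧ ∀ a, F (e a) = f a

namespace Eff

variable {α β : Type} {e f g h : α → Data}

theorem refl (e : α → Data) : Eff e e := ⟨_, .id, fun _ => rfl⟩

theorem of_polyTime {F : Data → Data} (hF : PolyTime F) (hf : Eff e f) : Eff e fun a => F (f a) := by
  obtain ⟨G, hG, h⟩ := hf
  exact ⟨_, hF.comp hG, fun a => by rw [h]⟩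

theorem polyTime {F : Data → Data} (h : Eff (fun x => x) F) : PolyTime F := by
  obtain ⟨G, hG, h⟩ := h
  exact (funext h : G = F) ▸ hG

theorem trans (hf : Eff e f) (hg : Eff f g) : Eff e g := by
  obtain ⟨F, hF, h1⟩ := hf
  obtain ⟨G, hG, h2⟩ := hg
  exact ⟨_, hG.comp hF, fun a => by rw [h1, h2]⟩

theorem pull (hf : Eff e f) (φ : β → α) : Eff (fun b => e (φ b)) fun b => f (φ b) := by
  obtain ⟨F, hF, h1⟩ := hf
  exact ⟨F, hF, fun b => h1 _⟩

/-- The substitution principle: to compute `f` at `φ b`, it is enough to compute the encoding of `φ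
b`. It carries facts from one context to a richer one. -/
theorem lift {e' : β → Data} (hf : Eff e f) (φ : β → α) (h : Eff e' fun b => e (φ b)) :
    Eff e' fun b => f (φ b) :=
  h.trans (hf.pull φ)

theorem const (d : Data) : Eff e fun _ => d := ⟨_, .const d, fun _ => rfl⟩

theorem cons (hf : Eff e f) (hg : Eff e g) : Eff e fun a => .cons (f a) (g a) := by
  obtain ⟨F, hF, h1⟩ := hf
  obtain ⟨G, hG, h2⟩ := hg
  exact ⟨_, hF.cons hG, fun a => by rw [h1, h2]⟩

theorem head (hf : Eff e f) : Eff e fun a => (f a).head := of_polyTime .head' hf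

theorem tail (hf : Eff e f) : Eff e fun a => (f a).tail := of_polyTime .tail' hf

theorem fst (hf : Eff e fun a => .cons (f a) (g a)) : Eff e f := hf.head

theorem snd (hf : Eff e fun a => .cons (f a) (g a)) : Eff e g := hf.tail

theorem size_le (hf : Eff e f) :
    ∃ p : Polynomial ℕ, ∀ a, (f a).size ≤ p.eval (e a).size := by
  obtain ⟨F, hF, h1⟩ := hf
  obtain ⟨p, hp⟩ := hF.size_le
  exact ⟨p, fun a => h1 a ▸ hp _⟩

theorem of_eq (hf : Eff e f) (h : ∀ a, f a = g a) : Eff e g := (funext h : f = g) ▸ hf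

/-! Booleans -/

theorem ite_isNil (hh : Eff e h) (hf : Eff e f) (hg : Eff e g) :
    Eff e fun a => if (h a).isNil then f a else g a := by
  obtain ⟨H, hH, h0⟩ := hh
  obtain ⟨F, hF, h1⟩ := hf
  obtain ⟨G, hG, h2⟩ := hg
  exact ⟨_, hH.ite hF hG, fun a => by rw [h0, h1, h2]⟩

theorem isNil_head_ofBit (b : Bool) : (Data.ofBit b).head.isNil = !b := by cases b <;> rfl

theorem ite {c : α → Bool} (hc : Eff e fun a => .ofBit (c a)) (hf : Eff e f) (hg : Eff e g) :
    Eff e fun a => if c a then f a else g a :=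
  (hc.head.ite_isNil hg hf).of_eq fun a => by
    rw [isNil_head_ofBit]; cases c a <;> rfl

/-- The program for `f` is total, although its output is meaningful only where `c` holds; so an
ordinary conditional on its output serves. -/
theorem dite {c : α → Prop} [DecidablePred c] (hc : Eff e fun a => .ofBit (decide (c a)))
    {f : ∀ a, c a → Data} (hf : Eff (fun a : {a // c a} => e a) fun a => f a a.2) (hg : Eff e g) :
    Eff e fun a => if h : c a then f a h else g a := by
  obtain ⟨F, hF, h1⟩ := hf
  refine (hc.ite (of_polyTime hF (refl e)) hg).of_eq fun a => ?_
  by_cases h : c a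
  · simpa [h] using h1 ⟨a, h⟩
  · simp [h]

theorem isNil (hf : Eff e f) : Eff e fun a => .ofBit (f a).isNil :=
  (hf.ite_isNil (const (.ofBit true)) (const (.ofBit false))).of_eq fun a => by
    cases (f a).isNil <;> rfl

theorem cond {c f g : α → Bool} (hc : Eff e fun a => .ofBit (c a))
    (hf : Eff e fun a => .ofBit (f a)) (hg : Eff e fun a => .ofBit (g a)) :
    Eff e fun a => .ofBit (if c a then f a else g a) :=
  (hc.ite hf hg).of_eq fun a => by cases c a <;> rfl

theorem not {c : α → Bool} (hc : Eff e fun a => .ofBit (c a)) : Eff e fun a => .ofBit (!c a) :=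
  (hc.cond (f := fun _ => false) (g := fun _ => true) (const _) (const _)).of_eq fun a => by
    cases c a <;> rfl

theorem and {c d : α → Bool} (hc : Eff e fun a => .ofBit (c a)) (hd : Eff e fun a => .ofBit (d a)) :
    Eff e fun a => .ofBit (c a && d a) :=
  (hc.cond (g := fun _ => false) hd (const _)).of_eq fun a => by cases c a <;> rfl

theorem xor {c d : α → Bool} (hc : Eff e fun a => .ofBit (c a)) (hd : Eff e fun a => .ofBit (d a)) :
    Eff e fun a => .ofBit (Bool.xor (c a) (d a)) :=
  (hc.cond hd.not hd).of_eq fun a => by cases c a <;> cases d a <;> rfl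

theorem toBit (hf : Eff e f) : Eff e fun a => .ofBit (f a).toBit :=
  hf.head.isNil.not.of_eq fun a => by
    rw [Data.toBit]; cases (f a).head <;> rfl

end Eff

/-! ### Lists -/

namespace Data

@[simp] theorem toBit_ofBit (b : Bool) : (ofBit b).toBit = b := by cases b <;> rfl

@[simp] theorem toBit_nil : nil.toBit = false := rfl

theorem toStr_eq (d : Data) : d.toStr = d.toList.map toBit := by
  induction d with
  | nil => rfl
  | cons a d _ ih => simp [toStr, toList, ih]

@[simp] theorem toStr_ofBits (s : List Bool) : (ofBits s).toStr = s := by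
  simp [toStr_eq, ofBits, Function.comp_def]

@[simp] theorem toList_unary (n : ℕ) : (unary n).toList = List.replicate n nil := by simp [unary]

@[simp] theorem toList_cons (a d : Data) : (cons a d).toList = a :: d.toList := rfl

@[simp] theorem toList_nil : nil.toList = [] := rfl

@[simp] theorem ofList_cons (a : Data) (l : List Data) : ofList (a :: l) = cons a (ofList l) := rfl

@[simp] theorem ofList_nil : ofList [] = nil := rfl

theorem unary_succ (n : ℕ) : unary (n + 1) = cons nil (unary n) := rfl

theorem size_ofList_append (l l' : List Data) :
    (ofList (l ++ l')).size + 1 = (ofList l).size + (ofList l').size := by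
  simp only [size_ofList, List.map_append, List.sum_append]; omega

theorem size_unary (n : ℕ) : (unary n).size = 2 * n + 1 := by
  simp [unary, size_ofList, size, List.map_replicate]; omega

theorem size_ofBit (b : Bool) : (ofBit b).size = 5 := by cases b <;> rfl

theorem size_ofBits (s : List Bool) : (ofBits s).size = 6 * s.length + 1 := by
  simp [ofBits, size_ofList, Function.comp_def, size_ofBit]; omega

theorem nth_eq (d : Data) (k : ℕ) : d.nth k = (tail^[k] d).head := by
  induction k generalizing d with
  | zero => rfl
  | succ k ih => rw [nth, ih, Function.iterate_succ_apply]

theorem nth_ofList (l : List Data) (k : ℕ) : (ofList l).nth k = l.getD k nil := by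
  induction k generalizing l with
  | zero => cases l <;> rfl
  | succ k ih =>
    cases l with
    | nil => simpa [nth] using ih []
    | cons a l => simpa [nth] using ih l

end Data

/-! ### List operations and unary arithmetic in polynomial time. -/

namespace PolyTime

variable {f g : Data → Data}

theorem of_eq (hf : PolyTime f) (h : ∀ x, f x = g x) : PolyTime g := (funext h : f = g) ▸ hf

/-- A fold that conses reverses its list. Two such passes give appending, and one more restores the
order after `map` and `range`. -/
theorem revAppend :
    PolyTime fun x => Data.ofList (x.head.toList.reverse ++ x.tail.toList) := by
  have key : ∀ (l : List Data) (d : Data),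
      l.foldl (fun acc y => Data.cons y acc) d = Data.ofList (l.reverse ++ d.toList) := by
    intro l
    induction l with
    | nil => simp
    | cons a l ih => intro d; simp [ih]
  refine (PolyTime.foldl (l := Data.head) (init := Data.tail)
    (step := fun s => .cons s.tail.tail s.tail.head) head' tail' (.cons id.tail.tail id.tail.head)
    Polynomial.X fun x k => ?_).of_eq fun x => ?_
  · simp only [Data.tail_cons, Data.head_cons, key, Polynomial.eval_X]
    have h1 := Data.size_ofList_append (x.head.toList.take k).reverse x.tail.toList
    have h2 := Data.size_ofList_append (x.head.toList.take k) (x.head.toList.drop k)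
    have h3 : (Data.ofList (x.head.toList.take k).reverse).size =
        (Data.ofList (x.head.toList.take k)).size := by
      simp [Data.size_ofList, List.sum_reverse]
    have h4 := (Data.ofList (x.head.toList.drop k)).size_pos
    simp only [List.take_append_drop, Data.ofList_toList] at h1 h2
    cases x with
    | nil => simp [Data.size]
    | cons a d => simp only [Data.size, Data.head_cons, Data.tail_cons] at *; omega
  · simp only [Data.tail_cons, Data.head_cons, key]

/-- Mapping a polynomial-time function, with a fixed first argument, over a list. -/
theorem map (hf : PolyTime f) :
    PolyTime fun x => Data.ofList (x.tail.toList.map fun y => f (.cons x.head y)) := by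
  obtain ⟨p, hp⟩ := hf.size_le
  have key : ∀ (x : Data) (l : List Data) (d : Data),
      l.foldl (fun acc y => Data.cons (f (.cons x.head y)) acc) d =
        Data.ofList ((l.map fun y => f (.cons x.head y)).reverse ++ d.toList) := by
    intro x l
    induction l with
    | nil => simp
    | cons a l ih => intro d; simp [ih]
  -- The fold yields the images in reverse order. There are at most `x.size` of them, each of size
  -- at most `p.eval x.size`, whence the quadratic factor in the bound.
  have h1 : PolyTime fun x =>
      Data.ofList ((x.tail.toList.map fun y => f (.cons x.head y)).reverse) := by
    refine (PolyTime.foldl (l := Data.tail) (init := fun _ => .nil)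
      (step := fun s => .cons (f (.cons s.head.head s.tail.tail)) s.tail.head) tail' (const _)
      (.cons (hf.comp (.cons id.head.head id.tail.tail)) id.tail.head)
      (Polynomial.X * (p + 1) + 1) fun x k => ?_).of_eq fun x => ?_
    · simp only [Data.head_cons, Data.tail_cons, key, Data.size_ofList, Data.toList_nil,
        List.append_nil, List.map_reverse, List.sum_reverse, List.map_map]
      have : ((x.tail.toList.take k).map ((fun d => d.size + 1) ∘ fun y =>
          f (.cons x.head y))).sum ≤ x.tail.toList.length * (p.eval x.size + 1) := by
        refine (List.sum_le_card_nsmul _ (p.eval x.size + 1) ?_).trans ?_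
        · simp only [List.mem_map, Function.comp_apply, forall_exists_index, and_imp]
          rintro _ y hy rfl
          refine Nat.add_le_add_right ((hp _).trans (p.eval_mono_nat ?_)) 1
          have hy' : y ∈ x.tail.toList := List.mem_of_mem_take hy
          have h5 : y.size + 1 ≤ x.tail.size := by
            rw [← Data.ofList_toList x.tail, Data.size_ofList]
            have := List.single_le_sum (l := x.tail.toList.map fun d => d.size + 1)
              (by simp) (y.size + 1) (List.mem_map.2 ⟨y, hy', rfl⟩)
            omega
          cases x with
          | nil => simp at hy'
          | cons a d => simp only [Data.size, Data.head_cons, Data.tail_cons] at *; omega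
        · simp only [List.length_map, smul_eq_mul]
          exact Nat.mul_le_mul_right _ (by simp)
      have h2 := Nat.mul_le_mul_right (p.eval x.size + 1)
        ((Nat.le_succ _).trans (x.tail.length_toList_le.trans x.size_tail_le))
      simp only [Polynomial.eval_add, Polynomial.eval_mul, Polynomial.eval_X, Polynomial.eval_one]
      omega
    · simp only [Data.head_cons, Data.tail_cons, key]; simp
  exact (revAppend.comp (h1.cons (const .nil))).of_eq fun x => by simp

/-- The accumulator holds the next number and the reversed list of the numbers before it; in unary
this is of quadratic size. -/
theorem range : PolyTime fun x => Data.ofList ((List.range x.toList.length).map Data.unary) := by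
  have key : ∀ (l : List Data) (k : ℕ),
      l.foldl (fun acc _ => Data.cons (.cons .nil acc.head) (.cons acc.head acc.tail))
        (Data.cons (.unary k) (Data.ofList ((List.range k).map Data.unary).reverse)) =
      Data.cons (.unary (k + l.length))
        (Data.ofList ((List.range (k + l.length)).map Data.unary).reverse) := by
    intro l
    induction l with
    | nil => simp
    | cons a l ih =>
      intro k
      have := ih (k + 1)
      rw [List.range_succ] at this
      simpa [Data.unary_succ, add_assoc, add_comm 1] using this
  have key0 := fun l => key l 0
  simp only [List.range_zero, List.map_nil, List.reverse_nil, Data.ofList_nil, zero_add] at key0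
  have h1 := PolyTime.foldl (l := fun x => x) (init := fun _ => .cons (.unary 0) .nil)
    (step := fun s => Data.cons (.cons .nil s.tail.head.head)
      (.cons s.tail.head.head s.tail.head.tail)) id (const _)
    (.cons (.cons (const _) id.tail.head.head) (.cons id.tail.head.head id.tail.head.tail))
    (Polynomial.X * (2 * Polynomial.X + 2) + 2 * Polynomial.X + 3) fun x k => by
      simp only [Data.head_cons, Data.tail_cons]
      rw [key0]
      simp only [Data.size, Data.size_unary, Data.size_ofList, List.map_reverse, List.sum_reverse,
        List.map_map, Polynomial.eval_add, Polynomial.eval_mul, Polynomial.eval_X,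
        Polynomial.eval_ofNat]
      have hl : (x.toList.take k).length ≤ x.size := by
        have := x.length_toList_le
        rw [List.length_take]; omega
      generalize (x.toList.take k).length = m at hl
      have : ((List.range m).map ((fun d => Data.size d + 1) ∘ Data.unary)).sum ≤
          m * (2 * x.size + 2) := by
        refine (List.sum_le_card_nsmul _ (2 * x.size + 2) ?_).trans (by simp)
        simp only [List.mem_map, List.mem_range, Function.comp_apply, forall_exists_index, and_imp,
          Data.size_unary]
        rintro _ j hj rfl
        omega
      have := Nat.mul_le_mul_right (2 * x.size + 2) hl
      omega
  refine ((revAppend.comp (h1.tail.cons (const .nil)))).of_eq fun x => ?_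
  simp only [Data.head_cons, Data.tail_cons]
  rw [key0]
  simp

theorem iterate_tail : PolyTime fun x => Data.tail^[x.head.toList.length] x.tail := by
  have key : ∀ (l : List Data) (d : Data),
      l.foldl (fun acc _ => acc.tail) d = Data.tail^[l.length] d := by
    intro l
    induction l with
    | nil => simp
    | cons a l ih => intro d; simp [ih]
  refine (PolyTime.foldl (l := Data.head) (init := Data.tail)
    (step := fun s => s.tail.head.tail) head' tail' id.tail.head.tail
    Polynomial.X fun x k => ?_).of_eq fun x => ?_
  · simp only [Data.tail_cons, Data.head_cons, key, Polynomial.eval_X]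
    generalize (x.head.toList.take k).length = m
    refine le_trans ?_ x.size_tail_le
    induction m with
    | zero => simp
    | succ m ih => rw [Function.iterate_succ_apply']; exact (Data.size_tail_le _).trans ih
  · simp only [Data.tail_cons, Data.head_cons, key]

theorem nth : PolyTime fun x => x.tail.nth x.head.toList.length :=
  iterate_tail.head.of_eq fun x => by rw [Data.nth_eq]

theorem mul : PolyTime fun x => Data.unary (x.head.toList.length * x.tail.toList.length) := by
  have hadd : PolyTime fun x => Data.ofList (x.head.toList ++ x.tail.toList) :=
    (revAppend.comp ((revAppend.comp (id.head.cons (const .nil))).cons id.tail)).of_eq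
      fun x => by simp
  have hnorm : PolyTime fun x => Data.unary x.toList.length :=
    ((map (const .nil)).comp ((const .nil).cons id)).of_eq fun x => by
      simp [Data.unary]
  have key : ∀ (l : List Data) (x : Data) (k : ℕ),
      l.foldl (fun acc _ => Data.ofList (Data.toList (.unary x.toList.length) ++ acc.toList))
        (.unary k) = .unary (l.length * x.toList.length + k) := by
    intro l x
    induction l with
    | nil => simp
    | cons a l ih =>
      intro k
      have := ih (x.toList.length + k)
      simp only [List.foldl_cons, List.length_cons]
      rw [show Data.ofList (Data.toList (.unary x.toList.length) ++ Data.toList (.unary k)) =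
        .unary (x.toList.length + k) by simp [Data.unary, List.replicate_append_replicate], this]
      congr 1; ring
  refine (PolyTime.foldl (l := Data.head) (init := fun _ => .unary 0)
    (step := fun s => .ofList (Data.toList (.unary s.head.tail.toList.length) ++ s.tail.head.toList))
    head' (const _) ((hadd.comp (((hnorm.comp id.head.tail)).cons id.tail.head)).of_eq
      fun x => by simp)
    (2 * (Polynomial.X * Polynomial.X) + 1) fun x k => ?_).of_eq fun x => ?_
  · simp only [Data.tail_cons, Data.head_cons]
    rw [key]
    simp only [Data.size_unary, Polynomial.eval_add, Polynomial.eval_mul, Polynomial.eval_X,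
      Polynomial.eval_ofNat, Polynomial.eval_one]
    have : (x.head.toList.take k).length * x.tail.toList.length ≤ x.size * x.size := by
      refine Nat.mul_le_mul ?_ ?_
      · have := x.head.length_toList_le; have := x.size_head_le
        rw [List.length_take]; omega
      · have := x.tail.length_toList_le; have := x.size_tail_le; omega
    omega
  · simp only [Data.tail_cons, Data.head_cons]
    rw [key]
    rfl

end PolyTime

/-! ### Measuring and comparing trees with an explicit stack. -/

namespace Data

/-- One step of a traversal of a list of trees, in which a tree counts as its nodes and leaves. -/
def traverse : List Data → List Data
  | [] => []
  | nil :: l => l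
  | cons a d :: l => a :: d :: l

/-- Each step consumes exactly one node or leaf, so a stack holding only `x` is empty after exactly
`x.size` steps; counting the steps computes the size. -/
theorem sum_size_traverse (l : List Data) :
    ((traverse l).map size).sum = (l.map size).sum - 1 := by
  match l with
  | [] => rfl
  | nil :: l => simp [traverse, size]
  | cons a d :: l => simp [traverse, size]; omega

theorem sum_size_traverse_iterate (l : List Data) (j : ℕ) :
    ((traverse^[j] l).map size).sum = (l.map size).sum - j := by
  induction j with
  | zero => rfl
  | succ j ih => rw [Function.iterate_succ_apply', sum_size_traverse, ih]; omega

theorem size_ofList_le (l : List Data) : (ofList l).size ≤ 2 * (l.map size).sum + 1 := by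
  induction l with
  | nil => simp [size]
  | cons a l ih => have := a.size_pos; simp [size]; omega

theorem eq_nil_of_sum_size {l : List Data} (h : (l.map size).sum = 0) : l = [] := by
  cases l with
  | nil => rfl
  | cons a l => have := a.size_pos; simp at h; omega

open Classical in
/-- One step of a comparison of pairs of trees; the flag tells whether a difference was found. -/
noncomputable def compareStep : Bool × List (Data × Data) → Bool × List (Data × Data)
  | (b, []) => (b, [])
  | (b, (nil, nil) :: l) => (b, l)
  | (b, (cons a d, cons a' d') :: l) => (b, (a, a') :: (d, d') :: l)
  | (_, _ :: _) => (false, [])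

open Classical in
-- A step that finds no difference uses up one node or leaf of a first component, and on the empty
-- list nothing changes. So any number of steps that is at least the total size of the first
-- components gives the verdict.
theorem compareStep_iterate (k : ℕ) (b : Bool) (l : List (Data × Data))
    (h : (l.map fun p => p.1.size).sum ≤ k) :
    compareStep^[k] (b, l) = (b && l.all fun p => decide (p.1 = p.2), []) := by
  induction k generalizing b l with
  | zero =>
    cases l with
    | nil => simp
    | cons p l => have := p.1.size_pos; simp at h; omega
  | succ k ih =>
    have h0 : ∀ b, compareStep^[k] (b, []) = (b, []) := fun b => by simpa using ih b [] (by simp)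
    rw [Function.iterate_succ_apply]
    match l with
    | [] => simpa [compareStep] using h0 b
    | (nil, nil) :: l =>
      simp only [List.map_cons, List.sum_cons, size] at h
      rw [compareStep, ih _ _ (by omega)]; simp
    | (cons a d, cons a' d') :: l =>
      simp only [List.map_cons, List.sum_cons, size] at h
      rw [compareStep, ih _ _ (by simp; omega)]
      simp [Bool.decide_and, Bool.and_assoc]
    | (nil, cons a d) :: l => simp [compareStep, h0]
    | (cons a d, nil) :: l => simp [compareStep, h0]

def ofCompare (s : Bool × List (Data × Data)) : Data :=
  cons (ofBit s.1) (ofTranscript s.2)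

/-- The encoded state never grows, which gives the size bound that `PolyTime.foldl` requires. -/
theorem size_compareStep_le (s : Bool × List (Data × Data)) :
    (ofCompare (compareStep s)).size ≤ (ofCompare s).size := by
  obtain ⟨b, l⟩ := s
  match l with
  | [] => simp [compareStep]
  | (nil, nil) :: l => simp [compareStep, ofCompare, ofTranscript, size]; omega
  | (cons a d, cons a' d') :: l => simp [compareStep, ofCompare, ofTranscript, size]; omega
  | (nil, cons a d) :: l => simp [compareStep, ofCompare, ofTranscript, size, size_ofBit]; omega
  | (cons a d, nil) :: l => simp [compareStep, ofCompare, ofTranscript, size, size_ofBit]; omega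

theorem unary_injective : Function.Injective unary := fun m n h => by
  simpa using congrArg (fun d => d.toList.length) h

theorem ofBit_injective : Function.Injective ofBit := fun a b h => by
  simpa using congrArg toBit h

end Data

namespace PolyTime

theorem size : PolyTime fun x => Data.unary x.size := by
  -- The state is the stack of pending trees together with a unary counter of the steps made.
  let f : Data → Data := fun s => if s.head.isNil then s else
    .cons (if s.head.head.isNil then s.head.tail
      else .cons s.head.head.head (.cons s.head.head.tail s.head.tail)) (.cons .nil s.tail)
  have hf : PolyTime f := id.head.ite id (.cons (id.head.head.ite id.head.tail
    (.cons id.head.head.head (.cons id.head.head.tail id.head.tail))) (.cons (const _) id.tail))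
  have hstep : ∀ (l : List Data) (c : ℕ), 0 < (l.map Data.size).sum →
      f (.cons (.ofList l) (.unary c)) = .cons (.ofList (Data.traverse l)) (.unary (c + 1)) := by
    intro l c h
    match l with
    | [] => simp at h
    | .nil :: l => simp [f, Data.isNil, Data.traverse, Data.unary_succ]
    | .cons a d :: l => simp [f, Data.isNil, Data.traverse, Data.unary_succ]
  have hit : ∀ (x : Data) (j : ℕ), j ≤ x.size → f^[j] (.cons (.cons x .nil) .nil) =
      .cons (.ofList (Data.traverse^[j] [x])) (.unary j) := by
    intro x j
    induction j with
    | zero => intro _; rfl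
    | succ j ih =>
      intro hj
      rw [Function.iterate_succ_apply', ih (by omega), hstep, Function.iterate_succ_apply']
      rw [Data.sum_size_traverse_iterate]
      simp; omega
  have := PolyTime.loop (c := Data.head) (g := fun x => .cons (.cons x .nil) .nil) head' hf
    ((id.cons (const _)).cons (const _)) Data.size
    (fun x j hj => by
      rw [hit x j hj.le]
      intro h
      have h1 := Data.sum_size_traverse_iterate [x] j
      rw [show Data.traverse^[j] [x] = [] by simpa using congrArg Data.toList h] at h1
      simp at h1; omega)
    (fun x => by
      rw [hit x _ le_rfl, Data.head_cons, Data.eq_nil_of_sum_size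
        (l := Data.traverse^[x.size] [x]) (by rw [Data.sum_size_traverse_iterate]; simp)]
      rfl)
    Polynomial.X (4 * Polynomial.X + 3) (fun x => by simp)
    (fun x j hj => by
      rw [hit x j hj]
      have h1 := Data.sum_size_traverse_iterate [x] j
      have h2 := Data.size_ofList_le (Data.traverse^[j] [x])
      simp only [Data.size, Data.size_unary, Polynomial.eval_add, Polynomial.eval_mul,
        Polynomial.eval_X, Polynomial.eval_ofNat, List.map_cons, List.map_nil, List.sum_cons,
        List.sum_nil] at *
      omega)
  exact this.tail.of_eq fun x => by rw [hit x _ le_rfl, Data.tail_cons]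

open Classical in
theorem eq : PolyTime fun x => Data.ofBit (decide (x.head = x.tail)) := by
  let step : Data → Data := fun s => if s.tail.isNil then s else
    if s.tail.head.head.isNil then
      if s.tail.head.tail.isNil then .cons s.head s.tail.tail else .cons (.ofBit false) .nil
    else if s.tail.head.tail.isNil then .cons (.ofBit false) .nil
    else .cons s.head (.cons (.cons s.tail.head.head.head s.tail.head.tail.head)
      (.cons (.cons s.tail.head.head.tail s.tail.head.tail.tail) s.tail.tail))
  have hstep : PolyTime step := by
    refine id.tail.ite id (id.tail.head.head.ite
      (id.tail.head.tail.ite (id.head.cons id.tail.tail) (const _))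
      (id.tail.head.tail.ite (const _) (id.head.cons (.cons (.cons ?_ ?_) (.cons (.cons ?_ ?_) ?_)))))
    exacts [id.tail.head.head.head, id.tail.head.tail.head, id.tail.head.head.tail,
      id.tail.head.tail.tail, id.tail.tail]
  have h1 : ∀ s, step (Data.ofCompare s) = Data.ofCompare (Data.compareStep s) := by
    rintro ⟨b, l⟩
    match l with
    | [] => simp [step, Data.ofCompare, Data.compareStep, Data.ofTranscript, Data.isNil]
    | (.nil, .nil) :: l =>
      simp [step, Data.ofCompare, Data.compareStep, Data.ofTranscript, Data.isNil]
    | (.cons a d, .cons a' d') :: l =>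
      simp [step, Data.ofCompare, Data.compareStep, Data.ofTranscript, Data.isNil]
    | (.nil, .cons a d) :: l =>
      simp [step, Data.ofCompare, Data.compareStep, Data.ofTranscript, Data.isNil]
    | (.cons a d, .nil) :: l =>
      simp [step, Data.ofCompare, Data.compareStep, Data.ofTranscript, Data.isNil]
  have h2 : ∀ (l : List Data) s, l.foldl (fun acc _ => step acc) (Data.ofCompare s) =
      Data.ofCompare (Data.compareStep^[l.length] s) := by
    intro l
    induction l with
    | nil => intro s; rfl
    | cons a l ih => intro s; simp [h1, ih]
  have h3 : ∀ k s, (Data.ofCompare (Data.compareStep^[k] s)).size ≤ (Data.ofCompare s).size := by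
    intro k s
    induction k with
    | zero => rfl
    | succ k ih =>
      rw [Function.iterate_succ_apply']; exact (Data.size_compareStep_le _).trans ih
  -- The list folded over is only a clock: it allows `x.size` steps, which is at least the size of
  -- `x.head`.
  have h4 := PolyTime.foldl (l := fun x => .unary x.size)
    (init := fun x => Data.ofCompare (true, [(x.head, x.tail)])) (step := fun s => step s.tail.head)
    size (.cons (const _) (.cons (id.head.cons id.tail) (const _))) (hstep.comp id.tail.head)
    (2 * Polynomial.X + 10) (fun x k => by
      simp only [Data.head_cons, Data.tail_cons]
      rw [h2]
      refine (h3 _ _).trans ?_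
      have := x.size_head_le; have := x.size_tail_le
      simp [Data.ofCompare, Data.size, Data.size_ofBit, Data.ofTranscript]
      omega)
  refine h4.head.of_eq fun x => ?_
  simp only [Data.head_cons, Data.tail_cons]
  rw [h2, Data.compareStep_iterate]
  · simp [Data.ofCompare]
  · simpa using x.size_head_le

open Classical in
-- A counter that is reset when it reaches the modulus. The modulus 0 is never reached after an
-- increment, in accordance with `k % 0 = k`.
theorem mod : PolyTime fun x => Data.unary (x.head.toList.length % x.tail.toList.length) := by
  have hnorm : PolyTime fun x => Data.unary x.toList.length :=
    ((map (const .nil)).comp ((const .nil).cons id)).of_eq fun x => by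
      simp [Data.unary]
  let step : Data → Data := fun s =>
    if (Data.ofBit (decide (Data.cons .nil s.tail.head = .unary s.head.tail.toList.length))).head.isNil
    then .cons .nil s.tail.head else .nil
  have hstep : PolyTime step := (eq.comp (((const _).cons id.tail.head).cons
    (hnorm.comp id.head.tail))).head.ite ((const _).cons id.tail.head) (const _)
  have h1 : ∀ (x : Data) (l : List Data) (k : ℕ), l.foldl (fun acc y => step (.cons x (.cons acc y)))
      (.unary (k % x.tail.toList.length)) = .unary ((k + l.length) % x.tail.toList.length) := by
    intro x l
    induction l with
    | nil => intro k; rfl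
    | cons a l ih =>
      intro k
      rw [List.foldl_cons, List.length_cons, add_comm l.length, ← add_assoc, ← ih]
      congr 1
      simp only [step, Data.head_cons, Data.tail_cons, Eff.isNil_head_ofBit, ← Data.unary_succ,
        Data.unary_injective.eq_iff]
      by_cases h : k % x.tail.toList.length + 1 = x.tail.toList.length
      · rw [if_neg (by simpa using h), ← Nat.mod_add_mod, h, Nat.mod_self]; rfl
      · rw [if_pos (by simpa using h), ← Nat.mod_add_mod]
        rcases Nat.eq_zero_or_pos x.tail.toList.length with h0 | h0
        · simp [h0]
        · rw [Nat.mod_eq_of_lt (a := _ + 1)]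
          have := Nat.mod_lt k h0
          omega
  have h2 : ∀ (x : Data) (l : List Data), l.foldl (fun acc y => step (.cons x (.cons acc y)))
      .nil = .unary (l.length % x.tail.toList.length) := by
    intro x l
    have := h1 x l 0
    rw [Nat.zero_mod, zero_add] at this
    exact this
  have h4 := PolyTime.foldl (l := Data.head) (init := fun _ => .nil) (step := step)
    head' (const _) hstep (2 * Polynomial.X + 1) (fun x k => by
      rw [h2, Data.size_unary]
      have := Nat.mod_le (x.head.toList.take k).length x.tail.toList.length
      have := x.size_head_le; have := x.head.length_toList_le
      have : (x.head.toList.take k).length ≤ x.head.toList.length := by simp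
      simp only [Polynomial.eval_add, Polynomial.eval_mul, Polynomial.eval_X,
        Polynomial.eval_ofNat, Polynomial.eval_one]
      omega)
  exact h4.of_eq fun x => h2 _ _

end PolyTime

/-- The number with the given binary digits, reduced modulo `n`, by Horner's scheme. -/
def hornerMod (n : ℕ) (l : List Bool) : ℕ :=
  l.foldl (fun a b => if n = 0 then 0 else (2 * a + b.toNat) % n) 0

theorem hornerMod_lt {n : ℕ} (hn : 0 < n) (l : List Bool) : hornerMod n l < n := by
  rw [hornerMod]
  induction l using List.reverseRecOn with
  | nil => exact hn
  | append_singleton l b _ =>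
    rw [List.foldl_append]
    simp only [List.foldl_cons, List.foldl_nil]
    rw [if_neg hn.ne']
    exact Nat.mod_lt _ hn

/-! ### Closure of `Eff` under lists, unary arithmetic, tapes and families. -/

namespace Eff

variable {α β : Type} {e f g : α → Data}

theorem length {l : α → List Data} (h : Eff e fun a => .ofList (l a)) :
    Eff e fun a => .unary (l a).length :=
  (of_polyTime (PolyTime.map (.const .nil)) ((const .nil).cons h)).of_eq fun a => by
    simp [Data.unary]

theorem append {l l' : α → List Data} (h : Eff e fun a => .ofList (l a))
    (h' : Eff e fun a => .ofList (l' a)) : Eff e fun a => .ofList (l a ++ l' a) :=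
  (of_polyTime .revAppend ((of_polyTime .revAppend (h.cons (const .nil))).cons h')).of_eq
    fun a => by simp

theorem unary_const (k : ℕ) : Eff e fun _ => .unary k := const _

theorem add {k m : α → ℕ} (hk : Eff e fun a => .unary (k a)) (hm : Eff e fun a => .unary (m a)) :
    Eff e fun a => .unary (k a + m a) :=
  (hk.append hm).of_eq fun a => by simp [Data.unary, List.replicate_append_replicate]

theorem mul {k m : α → ℕ} (hk : Eff e fun a => .unary (k a)) (hm : Eff e fun a => .unary (m a)) :
    Eff e fun a => .unary (k a * m a) :=
  (of_polyTime .mul (hk.cons hm)).of_eq fun a => by simp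

theorem mod {k m : α → ℕ} (hk : Eff e fun a => .unary (k a)) (hm : Eff e fun a => .unary (m a)) :
    Eff e fun a => .unary (k a % m a) :=
  (of_polyTime .mod (hk.cons hm)).of_eq fun a => by simp

theorem eval (p : Polynomial ℕ) {k : α → ℕ} (hk : Eff e fun a => .unary (k a)) :
    Eff e fun a => .unary (p.eval (k a)) := by
  induction p using Polynomial.induction_on' with
  | add p q hp hq => simpa using hp.add hq
  | monomial m c =>
    have : Eff e fun a => .unary (k a ^ m) := by
      induction m with
      | zero => simpa using const _
      | succ m ih => simpa [pow_succ] using ih.mul hk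
    simpa using (unary_const c).mul this

theorem size (hf : Eff e f) : Eff e fun a => .unary (f a).size := of_polyTime .size hf

open Classical in
theorem eq (hf : Eff e f) (hg : Eff e g) : Eff e fun a => .ofBit (decide (f a = g a)) :=
  of_polyTime .eq (hf.cons hg)

theorem eq_nat {k m : α → ℕ} (hk : Eff e fun a => .unary (k a)) (hm : Eff e fun a => .unary (m a)) :
    Eff e fun a => .ofBit (decide (k a = m a)) :=
  (hk.eq hm).of_eq fun a => by simp [Data.unary_injective.eq_iff]

theorem eq_bool {b c : α → Bool} (hb : Eff e fun a => .ofBit (b a))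
    (hc : Eff e fun a => .ofBit (c a)) : Eff e fun a => .ofBit (decide (b a = c a)) :=
  (hb.eq hc).of_eq fun a => by simp [Data.ofBit_injective.eq_iff]

theorem nth {k : α → ℕ} (hf : Eff e f) (hk : Eff e fun a => .unary (k a)) :
    Eff e fun a => (f a).nth (k a) :=
  (of_polyTime .nth (hk.cons hf)).of_eq fun a => by simp

theorem map {l : α → List β} {enc : β → Data} {φ : α → β → Data}
    (hl : Eff e fun a => .ofList ((l a).map enc))
    (hφ : Eff (fun p : α × β => .cons (e p.1) (enc p.2)) fun p => φ p.1 p.2) :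
    Eff e fun a => .ofList ((l a).map (φ a)) := by
  obtain ⟨F, hF, h⟩ := hφ
  exact (of_polyTime hF.map ((refl e).cons hl)).of_eq fun a => by
    simp only [Data.head_cons, Data.tail_cons, Data.toList_ofList, List.map_map]
    congr 2
    funext y
    exact h (a, y)

/-- The context `e`, extended by an index. -/
def ctxFin (e : α → Data) (k : α → ℕ) (p : Σ a, Fin (k a)) : Data :=
  .cons (e p.1) (.unary p.2)

theorem ofFn {k : α → ℕ} {φ : ∀ a, Fin (k a) → Data} (hk : Eff e fun a => .unary (k a))
    (hφ : Eff (ctxFin e k) fun p => φ p.1 p.2) : Eff e fun a => .ofList (List.ofFn (φ a)) := by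
  obtain ⟨F, hF, h⟩ := hφ
  exact (of_polyTime hF.map ((refl e).cons (of_polyTime .range hk))).of_eq fun a => by
    simp only [Data.head_cons, Data.tail_cons, Data.toList_ofList, List.map_map, Data.toList_unary,
      List.length_replicate]
    congr 1
    refine List.ext_getElem (by simp) fun j h1 h2 => ?_
    simpa [ctxFin] using h ⟨a, ⟨j, by simpa using h1⟩⟩

theorem ofBits_ofFn {k : α → ℕ} {φ : ∀ a, Fin (k a) → Bool} (hk : Eff e fun a => .unary (k a))
    (hφ : Eff (ctxFin e k) fun p => .ofBit (φ p.1 p.2)) :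
    Eff e fun a => .ofBits (List.ofFn (φ a)) :=
  (hk.ofFn (φ := fun a i => .ofBit (φ a i)) hφ).of_eq fun a => by
    simp [Data.ofBits, List.map_ofFn, Function.comp_def]

/-- The infinite tape `τ a` can be computed from `e a`. -/
def Tape (e : α → Data) (τ : α → ℕ → Bool) : Prop :=
  Eff (fun p : α × ℕ => .cons (e p.1) (.unary p.2)) fun p => .ofBit (τ p.1 p.2)

theorem Tape.read {τ : α → ℕ → Bool} (h : Tape e τ) {k : α → ℕ}
    (hk : Eff e fun a => .unary (k a)) :
    Eff e fun a => .ofBits (List.ofFn fun j : Fin (k a) => τ a j) :=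
  hk.ofBits_ofFn (h.pull fun p : Σ a, Fin (k a) => (p.1, (p.2 : ℕ)))

theorem Tape.at {τ : α → ℕ → Bool} (h : Tape e τ) {k : α → ℕ}
    (hk : Eff e fun a => .unary (k a)) : Eff e fun a => .ofBit (τ a (k a)) :=
  h.lift (fun a => (a, k a)) ((refl e).cons hk)

theorem Tape.shift {τ : α → ℕ → Bool} (h : Tape e τ) {k : α → ℕ}
    (hk : Eff e fun a => .unary (k a)) : Tape e fun a j => τ a (k a + j) :=
  h.lift (fun p : α × ℕ => (p.1, k p.1 + p.2))
    (.cons (refl _).fst ((hk.lift Prod.fst (refl _).fst).add (refl _).snd))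

theorem Tape.lift {e' : β → Data} {τ : α → ℕ → Bool} (h : Tape e τ) (φ : β → α)
    (h' : Eff e' fun b => e (φ b)) : Tape e' fun b => τ (φ b) :=
  Eff.lift h (fun p : β × ℕ => (φ p.1, p.2))
    ((h'.lift Prod.fst (refl _).fst).cons (refl _).snd)

theorem tape (hf : Eff e f) : Tape e fun a j => ((f a).nth j).toBit :=
  ((hf.lift Prod.fst (refl _).fst).nth (refl _).snd).toBit

/-- The context `e`, extended by the index of a member of a family. -/
def ctxFam (e : α → Data) (n : α → ℕ) (p : Σ a, Fin (n a) × Bool) : Data :=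
  .cons (e p.1) (.cons (.unary p.2.1) (.ofBit p.2.2))

theorem ctxFam_fst {e : α → Data} {n : α → ℕ} : Eff (ctxFam e n) fun p => e p.1 := (refl _).fst

theorem ctxFam_index {e : α → Data} {n : α → ℕ} : Eff (ctxFam e n) fun p => .unary p.2.1 :=
  (refl (ctxFam e n)).tail.head

theorem ctxFam_bit {e : α → Data} {n : α → ℕ} : Eff (ctxFam e n) fun p => .ofBit p.2.2 :=
  (refl (ctxFam e n)).tail.tail

theorem liftFam {n : α → ℕ} (h : Eff e f) : Eff (ctxFam e n) fun p => f p.1 :=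
  h.lift Sigma.fst ctxFam_fst

theorem ofFam {n : α → ℕ} {φ : ∀ a, Fin (n a) → Bool → Data} (hn : Eff e fun a => .unary (n a))
    (h : Eff (ctxFam e n) fun p => φ p.1 p.2.1 p.2.2) : Eff e fun a => .ofFam (φ a) := by
  have h' : ∀ b, Eff (ctxFin e n) fun p => φ p.1 p.2 b := fun b =>
    h.lift (fun p : Σ a, Fin (n a) => ⟨p.1, p.2, b⟩)
      ((refl (ctxFin e n)).fst.cons ((refl (ctxFin e n)).snd.cons (const (.ofBit b))))
  exact hn.ofFn ((h' false).cons (h' true))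

theorem fam {n : α → ℕ} {i : ∀ a, Fin (n a)} {b : α → Bool} (hf : Eff e f)
    (hi : Eff e fun a => .unary (i a)) (hb : Eff e fun a => .ofBit (b a)) :
    Eff e fun a => (f a).fam (i a) (b a) :=
  hb.ite (hf.nth hi).tail (hf.nth hi).head

/-- A member of a family that can be computed from `e`. -/
theorem app {n : α → ℕ} {φ : ∀ a, Fin (n a) → Bool → Data}
    (h : Eff (ctxFam e n) fun p => φ p.1 p.2.1 p.2.2) {i : ∀ a, Fin (n a)} {b : α → Bool}
    (hi : Eff e fun a => .unary (i a)) (hb : Eff e fun a => .ofBit (b a)) :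
    Eff e fun a => φ a (i a) (b a) :=
  h.lift (fun a => ⟨a, i a, b a⟩) ((refl e).cons (hi.cons hb))

theorem toStr (hf : Eff e f) : Eff e fun a => .ofBits (f a).toStr :=
  (Eff.map (l := fun a => (f a).toList) (enc := fun d => d) (φ := fun _ d => .ofBit d.toBit)
    (hf.of_eq fun a => by simp) (refl _).snd.toBit).of_eq fun a => by
      simp [Data.toStr_eq, Data.ofBits, Function.comp_def]

/-- Numbers are kept in unary, so an n-digit number cannot be formed before it is reduced. Reducing
at every digit keeps the accumulator at most `n`; the separate case `n = 0` is there because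
reduction modulo 0 would not bound it. -/
theorem hornerMod {n : α → ℕ} {l : α → List Bool} (hn : Eff e fun a => .unary (n a))
    (hl : Eff e fun a => .ofBits (l a)) : Eff e fun a => .unary (hornerMod (n a) (l a)) := by
  let step : Data → Data := fun s =>
    if decide (s.head.head.toList.length = 0) then .unary 0 else
      .unary ((2 * s.tail.head.toList.length +
        (if s.tail.tail.toBit then 1 else 0)) % s.head.head.toList.length)
  have hlen : ∀ {F : Data → Data}, Eff (fun x => x) F →
      Eff (fun x => x) fun x => .unary (F x).toList.length := fun h =>
    length (h.of_eq fun x => (Data.ofList_toList _).symm)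
  have hid := refl fun x : Data => x
  have hstep : PolyTime step := polyTime <| ite ((hlen hid.head.head).eq_nat (unary_const 0))
    (unary_const 0) (mod (((unary_const 2).mul (hlen hid.tail.head)).add
      ((ite hid.tail.tail.toBit (unary_const 1) (unary_const 0)).of_eq fun x => by
        cases x.tail.tail.toBit <;> rfl)) (hlen hid.head.head))
  have h1 : ∀ (x : Data) (l : List Data),
      l.foldl (fun acc y => step (.cons x (.cons acc y))) (.unary 0) =
        .unary (_root_.hornerMod x.head.toList.length (l.map Data.toBit)) := by
    intro x l
    induction l using List.reverseRecOn with
    | nil => rfl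
    | append_singleton l b ih =>
      rw [List.foldl_append, ih]
      conv_rhs => rw [_root_.hornerMod, List.map_append, List.foldl_append]
      simp only [List.foldl_cons, List.foldl_nil, List.map_cons, List.map_nil, step,
        Data.head_cons, Data.tail_cons, Data.toList_unary, List.length_replicate,
        decide_eq_true_eq]
      rw [← _root_.hornerMod]
      split_ifs <;> simp_all
  have h2 := PolyTime.foldl (l := Data.tail) (init := fun _ => .unary 0) .tail' (.const _) hstep
    (2 * Polynomial.X + 1) (fun x k => by
      rw [h1, Data.size_unary]
      have : _root_.hornerMod x.head.toList.length ((x.tail.toList.take k).map Data.toBit) ≤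
          x.head.toList.length := by
        rcases Nat.eq_zero_or_pos x.head.toList.length with h0 | h0
        · rw [h0, _root_.hornerMod]
          induction (x.tail.toList.take k).map Data.toBit using List.reverseRecOn with
          | nil => simp
          | append_singleton l b _ => rw [List.foldl_append]; simp
        · exact (hornerMod_lt h0 _).le
      have := x.size_head_le; have := x.head.length_toList_le
      simp only [Polynomial.eval_add, Polynomial.eval_mul, Polynomial.eval_X,
        Polynomial.eval_ofNat, Polynomial.eval_one]
      omega)
  exact (of_polyTime h2 (hn.cons hl)).of_eq fun a => by
    simp only [Data.tail_cons]
    rw [h1]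
    simp [Data.ofBits, Function.comp_def]

end Eff

/-! ### Interaction -/

theorem interact_succ (A B : List Data → Data) (k : ℕ) :
    interact A B (k + 1) = interact A B k ++
      [(A ((interact A B k).map Prod.snd),
        B ((interact A B k).map Prod.fst ++ [A ((interact A B k).map Prod.snd)]))] := rfl

@[simp] theorem length_interact (A B : List Data → Data) (k : ℕ) :
    (interact A B k).length = k := by
  induction k with
  | zero => rfl
  | succ k ih => simp [interact_succ, ih]

theorem interact_take (A B : List Data → Data) {j k : ℕ} (h : j ≤ k) :
    (interact A B k).take j = interact A B j := by
  induction k with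
  | zero => obtain rfl : j = 0 := by omega
            rfl
  | succ k ih =>
    rcases Nat.lt_or_ge j (k + 1) with h' | h'
    · rw [interact_succ, List.take_append_of_le_length (by simp; omega), ih (by omega)]
    · obtain rfl : j = k + 1 := by omega
      rw [List.take_of_length_le (by simp)]

theorem interact_getElem (A B : List Data → Data) {j k : ℕ} (h : j < (interact A B k).length) :
    (interact A B k)[j] = (A ((interact A B j).map Prod.snd),
        B ((interact A B j).map Prod.fst ++ [A ((interact A B j).map Prod.snd)])) := by
  have hk : j + 1 ≤ k := by simpa using h
  have h1 := interact_take A B hk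
  have h2 : (interact A B k)[j] = (interact A B (j + 1))[j]'(by simp) := by
    simp only [← h1, List.getElem_take]
  rw [h2]
  simp [interact_succ]

/-- The first party is consulted only on fewer than `k` messages and the second only on 1 to `k` of
them. A strategy may therefore reserve other lengths, such as the final activation, for another
purpose. -/
theorem interact_congr {A B A' B' : List Data → Data} {k : ℕ}
    (hA : ∀ l, l.length < k → A l = A' l) (hB : ∀ l, 1 ≤ l.length → l.length ≤ k → B l = B' l) :
    interact A B k = interact A' B' k := by
  induction k with
  | zero => rfl
  | succ k ih =>
    rw [interact_succ, interact_succ, ih (fun l hl => hA l (by omega))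
      (fun l hl hl' => hB l hl (by omega)), hA _ (by simp), hB _ (by simp) (by simp)]

namespace CommitmentScheme

variable (C : CommitmentScheme)

open Classical in
/-- Rerunning the sender against the recorded answers reproduces the transcript. -/
noncomputable def replays (n : ℕ) (x : List Bool) (t : List (Data × Data)) (m : List Bool)
    (r : C.SenderCoins n x) : Bool :=
  decide (interact (C.send n x m r) (fun l => (Data.ofList (.nil :: t.map Prod.snd)).nth l.length)
    C.rounds = t)

open Classical in
-- Both sides say that each recorded sender message is the honest answer to the recorded prefix. The
-- replay form is a single equality of trees, which a program can test. The list of answers starts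
-- with `nil` because the second party is first called with one message.
theorem replays_iff (n : ℕ) (x : List Bool) (t : List (Data × Data)) (m : List Bool)
    (r : C.SenderCoins n x) : C.replays n x t m r = true ↔ C.Opens n x t m r := by
  rw [replays, decide_eq_true_eq]
  set B : List Data → Data := fun l => (Data.ofList (.nil :: t.map Prod.snd)).nth l.length with hB
  constructor
  · intro h
    refine ⟨by rw [← h]; simp, fun j hj => ?_⟩
    have h1 := interact_getElem (C.send n x m r) B (j := j) (k := C.rounds) (by rw [h]; exact hj)
    have h2 : j ≤ C.rounds := by rw [← length_interact (C.send n x m r) B C.rounds, h]; exact hj.le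
    rw [← interact_take _ _ h2] at h1
    simp only [h] at h1
    rw [h1]
  · rintro ⟨hl, h⟩
    have : ∀ k ≤ C.rounds, interact (C.send n x m r) B k = t.take k := by
      intro k
      induction k with
      | zero => intro _; rfl
      | succ k ih =>
        intro hk
        have hk' : k < t.length := by omega
        rw [interact_succ, ih (by omega), List.take_add_one, List.getElem?_eq_getElem hk', ← h k hk']
        congr 1
        simp [hB, Data.nth, Data.nth_ofList, hk', Nat.min_eq_left hk'.le]
    rw [this _ le_rfl, ← hl, List.take_length]

end CommitmentScheme

theorem Data.ofTranscript_injective : Function.Injective Data.ofTranscript := by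
  intro s t h
  have h' := congrArg Data.toList h
  simp only [Data.ofTranscript, Data.toList_ofList] at h'
  refine (List.map_injective_iff.2 ?_) h'
  rintro ⟨a, b⟩ ⟨c, d⟩ h
  simpa using h

/-! ### Computable strategies and their executions. -/

namespace Eff

variable {α β : Type} {e f g : α → Data}

/-- A strategy that can be computed from `e a`. -/
def Strat (e : α → Data) (A : α → List Data → Data) : Prop :=
  Eff (fun p : α × List Data => .cons (e p.1) (.ofList p.2)) fun p => A p.1 p.2

theorem Strat.app {A : α → List Data → Data} (hA : Strat e A) {l : α → List Data}
    (hl : Eff e fun a => .ofList (l a)) : Eff e fun a => A a (l a) :=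
  Eff.lift hA (fun a => (a, l a)) ((refl e).cons hl)

theorem Strat.append {A : α → List Data → Data} (hA : Strat e A) {h : α → List Data}
    (hh : Eff e fun a => .ofList (h a)) : Strat e fun a l => A a (h a ++ l) :=
  Eff.lift hA (fun p : α × List Data => (p.1, h p.1 ++ p.2))
    ((refl _).fst.cons ((hh.lift Prod.fst (refl _).fst).append (refl _).snd))

theorem next (A : PPT) {k : α → ℕ} {r : ∀ a, A.Coins (k a)}
    (hf : Eff e f) (hr : Eff e fun a => .ofBits (List.ofFn (r a))) :
    Strat e fun a => A.next (f a) (r a) :=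
  of_polyTime A.polyTime ((hf.lift Prod.fst (refl _).fst).cons
    ((hr.lift Prod.fst (refl _).fst).cons (refl _).snd))

theorem map_fst {t : α → List (Data × Data)} (ht : Eff e fun a => .ofTranscript (t a)) :
    Eff e fun a => .ofList ((t a).map Prod.fst) :=
  Eff.map (enc := fun p : Data × Data => .cons p.1 p.2) (φ := fun _ p => p.1) ht (refl _).snd.fst

theorem map_snd {t : α → List (Data × Data)} (ht : Eff e fun a => .ofTranscript (t a)) :
    Eff e fun a => .ofList ((t a).map Prod.snd) :=
  Eff.map (enc := fun p : Data × Data => .cons p.1 p.2) (φ := fun _ p => p.2) ht (refl _).snd.snd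

theorem singleton (hf : Eff e f) : Eff e fun a => .ofList [f a] := hf.cons (const .nil)

/-- The rounds are unrolled: `k` does not depend on `a`, so the program is a composition of a fixed
number of polynomial-time steps. This is where a constant number of rounds is needed. -/
theorem interact {A B : α → List Data → Data} (hA : Strat e A) (hB : Strat e B) (k : ℕ) :
    Eff e fun a => .ofTranscript (interact (A a) (B a) k) := by
  induction k with
  | zero => exact const .nil
  | succ k ih =>
    have h1 := hA.app ih.map_snd
    have h2 := hB.app (ih.map_fst.append h1.singleton)
    exact (append (l := fun a => (_root_.interact (A a) (B a) k).map fun p => .cons p.1 p.2) ih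
      (h1.cons h2).singleton).of_eq fun a => by
        simp [interact_succ, Data.ofTranscript]

theorem map_fam {n : α → ℕ} {i : ∀ a, Fin (n a)} {b : α → Bool} {l : α → List Data}
    (hl : Eff e fun a => .ofList (l a))
    (hi : Eff e fun a => .unary (i a)) (hb : Eff e fun a => .ofBit (b a)) :
    Eff e fun a => .ofList ((l a).map fun d => d.fam (i a) (b a)) :=
  Eff.map (enc := fun d : Data => d) (φ := fun a d => d.fam (i a) (b a)) (by simpa using hl)
    ((refl _).snd.fam (n := fun p => n p.1) (hi.lift Prod.fst (refl _).fst)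
      (hb.lift Prod.fst (refl _).fst))

theorem session {n : α → ℕ} {i : ∀ a, Fin (n a)} {b : α → Bool} {t : α → List (Data × Data)}
    (ht : Eff e fun a => .ofTranscript (t a))
    (hi : Eff e fun a => .unary (i a)) (hb : Eff e fun a => .ofBit (b a)) :
    Eff e fun a => .ofTranscript (session (t a) (i a) (b a)) := by
  have hi' := hi.lift (Prod.fst (β := Data × Data)) (refl (fun p : α × (Data × Data) =>
    .cons (e p.1) (.cons p.2.1 p.2.2))).fst
  have hb' := hb.lift (Prod.fst (β := Data × Data)) (refl (fun p : α × (Data × Data) =>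
    .cons (e p.1) (.cons p.2.1 p.2.2))).fst
  exact (Eff.map (enc := fun p : Data × Data => .cons p.1 p.2)
    (φ := fun a p => .cons (p.1.fam (i a) (b a)) (p.2.fam (i a) (b a))) ht
    (((refl _).snd.fst.fam (n := fun p => n p.1) hi' hb').cons
      ((refl _).snd.snd.fam (n := fun p => n p.1) hi' hb'))).of_eq fun a => by
        simp [_root_.session, Data.ofTranscript, Function.comp_def]

theorem parallel {n : α → ℕ} {A : ∀ a, Fin (n a) → Bool → List Data → Data}
    (hn : Eff e fun a => .unary (n a))
    (hA : Strat (ctxFam e n) fun p => A p.1 p.2.1 p.2.2) : Strat e fun a => parallel (A a) := by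
  let e' : α × List Data → Data := fun p => .cons (e p.1) (.ofList p.2)
  have h1 : Eff (ctxFam e' fun p => n p.1) fun p => ctxFam e n ⟨p.1.1, p.2⟩ :=
    Eff.cons (e := ctxFam e' fun p => n p.1) (f := fun p => e p.1.1) (g := fun p => .cons (.unary p.2.1) (.ofBit p.2.2))
      (ctxFam_fst (e := e')).fst (refl (ctxFam e' fun p => n p.1)).tail
  exact ofFam (e := e') (n := fun p => n p.1)
    (φ := fun p i b => A p.1 i b (p.2.map fun d => d.fam i b)) (hn.lift Prod.fst (refl _).fst)
    (Eff.lift hA (fun p : Σ a : α × List Data, Fin (n a.1) × Bool =>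
      (⟨p.1.1, p.2⟩, p.1.2.map fun d => d.fam p.2.1 p.2.2))
      (h1.cons (map_fam (n := fun p => n p.1.1) (ctxFam_fst (e := e')).snd ctxFam_index ctxFam_bit)))

theorem strat_nth (hf : Eff e f) : Strat e fun a l => (f a).nth l.length :=
  (hf.lift Prod.fst (refl _).fst).nth (length (refl _).snd)

theorem strat_ite {c : α → Bool} {A B : α → List Data → Data} (hc : Eff e fun a => .ofBit (c a))
    (hA : Strat e A) (hB : Strat e B) : Strat e fun a l => if c a then A a l else B a l :=
  Eff.ite (e := fun p : α × List Data => .cons (e p.1) (.ofList p.2)) (c := fun p => c p.1)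
    (hc.lift Prod.fst (refl _).fst) hA hB

/-- The bits read from data that can be computed from `e a`. -/
theorem toBits {k : α → ℕ} (hf : Eff e f) (hk : Eff e fun a => .unary (k a)) :
    Eff e fun a => .ofBits (List.ofFn ((f a).toBits (k a))) :=
  hf.tape.read hk

theorem replays (C : CommitmentScheme) {n : α → ℕ} {x m : α → List Bool}
    {t : α → List (Data × Data)} {r : ∀ a, C.SenderCoins (n a) (x a)}
    (hn : Eff e fun a => .unary (n a)) (hx : Eff e fun a => .ofBits (x a))
    (hm : Eff e fun a => .ofBits (m a)) (ht : Eff e fun a => .ofTranscript (t a))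
    (hr : Eff e fun a => .ofBits (List.ofFn (r a))) :
    Eff e fun a => .ofBit (C.replays (n a) (x a) (t a) (m a) (r a)) :=
  ((interact (next C.sender (hn.cons (hx.cons hm)) hr)
    (strat_nth ((const .nil).cons ht.map_snd)) C.rounds).eq ht).of_eq fun a => by
      rw [CommitmentScheme.replays]
      congr 2
      exact propext Data.ofTranscript_injective.eq_iff

end Eff

/-! ### The protocol in terms of given coins -/

namespace CommitmentScheme

variable (C : CommitmentScheme)

/-- The transcript `t` is opened by `d₀` and by `d₁`, to different bits. -/
noncomputable def opensTwice (n : ℕ) (x : List Bool) (t : List (Data × Data)) (d₀ d₁ : Data) :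
    Bool :=
  Bool.xor d₀.head.toBit d₁.head.toBit &&
    (C.replays n x t [d₀.head.toBit] (d₀.tail.toBits _) &&
      C.replays n x t [d₁.head.toBit] (d₁.tail.toBits _))

end CommitmentScheme

/-- The messages of the first party in `t`, followed by a request for another message. -/
def query (t : List (Data × Data)) : List Data := t.map Prod.fst ++ [.nil]

/-- The family `f` with the member `(i₀, b₀)` replaced by `y`. -/
def patch {β : Type} {n : ℕ} (f : Fin n → Bool → β) (i₀ : Fin n) (b₀ : Bool) (y : β) :
    Fin n → Bool → β :=
  fun i b => if i = i₀ ∧ b = b₀ then y else f i b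

namespace Ingredients

variable (I : Ingredients)

/-- This and the following definitions are the stages of `commitPhase` with all coins as arguments,
so that a reduction can compute each stage and alter a single session. -/
def commitTranscript {n : ℕ} (S : List Data → Data) (ρ : Fin n → Bool → Fin n → Bool)
    (c : Fin n → Bool → I.sbc.SenderCoins n []) : List (Data × Data) :=
  interact (parallel fun i b => I.sbc.send n [] (List.ofFn (ρ i b)) (c i b)) S I.sbc.rounds

def tossed (n : ℕ) (S : List Data → Data) (t : List (Data × Data)) :
    Fin n → Bool → Fin n → Bool :=
  fun i b => ((S (query t)).fam i b).toBits n

def instances {n : ℕ} (S : List Data → Data) (t : List (Data × Data))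
    (ρ : Fin n → Bool → Fin n → Bool) : Fin n → Bool → List Bool :=
  fun i b => I.gen (List.ofFn (xorBits (ρ i b) (tossed n S t i b)))

def provenStatement {n : ℕ} (S : List Data → Data) (t : List (Data × Data))
    (x : Fin n → Bool → List Bool) : Data :=
  statement (session t) (tossed n S t) x

def history {n : ℕ} (t : List (Data × Data)) (x : Fin n → Bool → List Bool) : List Data :=
  query t ++ [Data.ofFam fun i b => Data.ofBits (x i b)]

def proofTranscript (n : ℕ) (S : List Data → Data) (h : List Data) (s w : Data)
    (r : I.wi.ProverCoins n s) : List (Data × Data) :=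
  interact (I.wi.prove n s w r) (fun l => S (h ++ l)) I.wi.rounds

def bindingTranscript {n : ℕ} (S : List Data → Data) (h : List Data) (x : Fin n → Bool → List Bool)
    (d : (i : Fin n) → (b : Bool) → I.idc.ReceiverCoins n (x i b)) : List (Data × Data) :=
  interact (fun l => S (h ++ l)) (parallel fun i b => I.idc.receive n (x i b) (d i b)) I.idc.rounds

/-- After the messages `h`, the sender `S` ends up with two openings of session `(i, b)`. -/
noncomputable def equivocates {n : ℕ} (S : List Data → Data) (h : List Data)
    (x : Fin n → Bool → List Bool) (d : (i : Fin n) → (b : Bool) → I.idc.ReceiverCoins n (x i b))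
    (i : Fin n) (b : Bool) : Bool :=
  let t := I.bindingTranscript S h x d
  let o := S (h ++ t.map Prod.snd)
  I.idc.opensTwice n (x i b) (session t i b) (o.head.fam i b) (o.tail.fam i b)

/-- `S` equivocates in session `(i, b)` in an execution that continues from the transcript `t` of
the coin tossing with instances `x` and a proof with witness `w`. -/
noncomputable def equivocatesAfter {n : ℕ} (S : List Data → Data) (t : List (Data × Data))
    (x : Fin n → Bool → List Bool) (w : Data) (r : I.wi.ProverCoins n (provenStatement S t x))
    (d : (i : Fin n) → (b : Bool) → I.idc.ReceiverCoins n (x i b)) (i : Fin n) (b : Bool) : Bool :=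
  I.equivocates S (history t x ++
    (I.proofTranscript n S (history t x) (provenStatement S t x) w r).map Prod.fst ++ [.nil]) x d i b

/-- `equivocates`, with coins that are read from tapes. -/
noncomputable def equivocatesRead {n : ℕ} (S : List Data → Data) (h : List Data)
    (x : Fin n → Bool → List Bool) (δ : Fin n → Bool → ℕ → Bool) (i : Fin n) (b : Bool) : Bool :=
  I.equivocates S h x (fun i b j => δ i b j) i b

/-- `equivocatesAfter`, with coins that are read from tapes. -/
noncomputable def equivocatesAfterRead {n : ℕ} (S : List Data → Data) (t : List (Data × Data))
    (x : Fin n → Bool → List Bool) (w : Data) (τ : ℕ → Bool) (δ : Fin n → Bool → ℕ → Bool)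
    (i : Fin n) (b : Bool) : Bool :=
  I.equivocatesAfter S t x w (fun j => τ j) (fun i b j => δ i b j) i b

/-- The witness for the bit `β`. -/
def bitWitness {n : ℕ} (ρ : Fin n → Bool → Fin n → Bool)
    (c : Fin n → Bool → I.sbc.SenderCoins n []) (β : Bool) : Data :=
  I.witness β (fun i => ρ i β) (fun i => c i β)

/-- `S` equivocates in session `(i, b)`, in an execution in which the instance `(i, b)` is replaced
by `y` and the witness does not involve this instance. -/
noncomputable def equivocatesOn {n : ℕ} (S : List Data → Data) (t : List (Data × Data))
    (ρ : Fin n → Bool → Fin n → Bool) (c : Fin n → Bool → I.sbc.SenderCoins n [])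
    (τ : ℕ → Bool) (δ : Fin n → Bool → ℕ → Bool) (i : Fin n) (b : Bool) (y : List Bool) : Bool :=
  I.equivocatesAfterRead S t (patch (I.instances S t ρ) i b y) (I.bitWitness ρ c (!b)) τ δ i b

/-- The transcript of the coin tossing when the messages of session `(i, b)` are given by `l`. -/
def relayTranscript {n : ℕ} (S : List Data → Data) (ρ : Fin n → Bool → Fin n → Bool)
    (c : Fin n → Bool → I.sbc.SenderCoins n []) (i₀ : Fin n) (b₀ : Bool) (l : List Data) :
    List (Data × Data) :=
  interact (parallel fun i b l' => if decide (i = i₀) && decide (b = b₀)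
    then (Data.ofList l).nth l'.length else I.sbc.send n [] (List.ofFn (ρ i b)) (c i b) l') S
    I.sbc.rounds

end Ingredients

/-! ### Computability of the stages of the protocol. -/

namespace Eff

variable {α β : Type} {e f g : α → Data}

theorem length_bits {x : α → List Bool} (hx : Eff e fun a => .ofBits (x a)) :
    Eff e fun a => .unary (x a).length :=
  (length hx).of_eq fun a => by rw [List.length_map]

theorem opensTwice (C : CommitmentScheme) {n : α → ℕ} {x : α → List Bool}
    {t : α → List (Data × Data)} {d₀ d₁ : α → Data}
    (hn : Eff e fun a => .unary (n a)) (hx : Eff e fun a => .ofBits (x a))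
    (ht : Eff e fun a => .ofTranscript (t a)) (h₀ : Eff e d₀) (h₁ : Eff e d₁) :
    Eff e fun a => .ofBit (C.opensTwice (n a) (x a) (t a) (d₀ a) (d₁ a)) := by
  have hk : Eff e fun a => .unary (C.sender.coins.eval (n a + (x a).length)) :=
    eval _ (hn.add hx.length_bits)
  refine (h₀.head.toBit.xor h₁.head.toBit).and ((replays C hn hx ?_ ht (h₀.tail.toBits hk)).and
    (replays C hn hx ?_ ht (h₁.tail.toBits hk)))
  · exact h₀.head.toBit.singleton
  · exact h₁.head.toBit.singleton

theorem query {t : α → List (Data × Data)} (ht : Eff e fun a => .ofTranscript (t a)) :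
    Eff e fun a => .ofList (query (t a)) :=
  ht.map_fst.append (const .nil).singleton

variable (I : Ingredients) {n : α → ℕ} {S : α → List Data → Data} {t : α → List (Data × Data)}
  {x : ∀ a, Fin (n a) → Bool → List Bool} {ρ : ∀ a, Fin (n a) → Bool → Fin (n a) → Bool}
  {c : ∀ a, Fin (n a) → Bool → I.sbc.SenderCoins (n a) []} {i : ∀ a, Fin (n a)} {b : α → Bool}

theorem tossed (hn : Eff e fun a => .unary (n a)) (hS : Strat e S)
    (ht : Eff e fun a => .ofTranscript (t a)) :
    Eff (ctxFam e n) fun p =>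
      .ofBits (List.ofFn (Ingredients.tossed (n p.1) (S p.1) (t p.1) p.2.1 p.2.2)) :=
  ((hS.app ht.query).liftFam.fam (n := fun p => n p.1) ctxFam_index ctxFam_bit).toBits
    hn.liftFam

theorem xorBits {u v : ∀ a, Fin (n a) → Bool} (hn : Eff e fun a => .unary (n a))
    (hu : Eff e fun a => .ofBits (List.ofFn (u a))) (hv : Eff e fun a => .ofBits (List.ofFn (v a))) :
    Eff e fun a => .ofBits (List.ofFn (xorBits (u a) (v a))) := by
  have key : ∀ {u : ∀ a, Fin (n a) → Bool}, (Eff e fun a => .ofBits (List.ofFn (u a))) →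
      Eff (ctxFin e n) fun p => .ofBit (u p.1 p.2) := fun h =>
    (((h.lift Sigma.fst (refl (ctxFin e n)).fst).nth (refl (ctxFin e n)).snd).of_eq fun p => by
      simp [Data.ofBits, Data.nth_ofList])
  exact ofBits_ofFn hn ((key hu).xor (key hv))

theorem gen {P : PromiseProblem} (hgen : IsSampler P I.gen) {s : α → List Bool}
    (hs : Eff e fun a => .ofBits (s a)) : Eff e fun a => .ofBits (I.gen (s a)) := by
  obtain ⟨F, hF, h⟩ := hgen.1
  exact (of_polyTime hF hs).of_eq fun a => h _

theorem instances {P : PromiseProblem} (hgen : IsSampler P I.gen)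
    (hn : Eff e fun a => .unary (n a)) (hS : Strat e S)
    (ht : Eff e fun a => .ofTranscript (t a))
    (hρ : Eff (ctxFam e n) fun p => .ofBits (List.ofFn (ρ p.1 p.2.1 p.2.2))) :
    Eff (ctxFam e n) fun p => .ofBits (I.instances (S p.1) (t p.1) (ρ p.1) p.2.1 p.2.2) :=
  gen I hgen (xorBits (n := fun p : Σ a, Fin (n a) × Bool => n p.1) hn.liftFam hρ
    (tossed hn hS ht))

theorem provenStatement (hn : Eff e fun a => .unary (n a)) (hS : Strat e S)
    (ht : Eff e fun a => .ofTranscript (t a))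
    (hx : Eff (ctxFam e n) fun p => .ofBits (x p.1 p.2.1 p.2.2)) :
    Eff e fun a => Ingredients.provenStatement (S a) (t a) (x a) :=
  (hn.ofFam (φ := fun a i b => .ofTranscript (_root_.session (t a) i b))
    (session (n := fun p : Σ a, Fin (n a) × Bool => n p.1) ht.liftFam ctxFam_index ctxFam_bit)).cons
    ((hn.ofFam (φ := fun a i b => .ofBits (List.ofFn (Ingredients.tossed (n a) (S a) (t a) i b)))
      (tossed hn hS ht)).cons (hn.ofFam (φ := fun a i b => .ofBits (x a i b)) hx))

theorem history (hn : Eff e fun a => .unary (n a))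
    (ht : Eff e fun a => .ofTranscript (t a))
    (hx : Eff (ctxFam e n) fun p => .ofBits (x p.1 p.2.1 p.2.2)) :
    Eff e fun a => .ofList (Ingredients.history (t a) (x a)) :=
  ht.query.append (hn.ofFam (φ := fun a i b => .ofBits (x a i b)) hx).singleton

theorem proofTranscript {h : α → List Data} {s w : α → Data} {r : ∀ a, I.wi.ProverCoins (n a) (s a)}
    (hn : Eff e fun a => .unary (n a)) (hS : Strat e S) (hh : Eff e fun a => .ofList (h a))
    (hs : Eff e s) (hw : Eff e w) (hr : Eff e fun a => .ofBits (List.ofFn (r a))) :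
    Eff e fun a => .ofTranscript (I.proofTranscript (n a) (S a) (h a) (s a) (w a) (r a)) :=
  interact (next I.wi.prover (hn.cons (hs.cons hw)) hr) (hS.append hh) _

theorem bindingTranscript {h : α → List Data}
    {d : ∀ a i b, I.idc.ReceiverCoins (n a) (x a i b)}
    (hn : Eff e fun a => .unary (n a)) (hS : Strat e S) (hh : Eff e fun a => .ofList (h a))
    (hx : Eff (ctxFam e n) fun p => .ofBits (x p.1 p.2.1 p.2.2))
    (hd : Eff (ctxFam e n) fun p => .ofBits (List.ofFn (d p.1 p.2.1 p.2.2))) :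
    Eff e fun a => .ofTranscript (I.bindingTranscript (S a) (h a) (x a) (d a)) :=
  interact (hS.append hh) (parallel hn (next I.idc.receiver (hn.liftFam.cons hx) hd)) _

theorem equivocates {h : α → List Data}
    {d : ∀ a i b, I.idc.ReceiverCoins (n a) (x a i b)}
    (hn : Eff e fun a => .unary (n a)) (hS : Strat e S) (hh : Eff e fun a => .ofList (h a))
    (hx : Eff (ctxFam e n) fun p => .ofBits (x p.1 p.2.1 p.2.2))
    (hd : Eff (ctxFam e n) fun p => .ofBits (List.ofFn (d p.1 p.2.1 p.2.2)))
    (hi : Eff e fun a => .unary (i a)) (hb : Eff e fun a => .ofBit (b a)) :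
    Eff e fun a => .ofBit (I.equivocates (S a) (h a) (x a) (d a) (i a) (b a)) := by
  have ht := bindingTranscript I hn hS hh hx hd
  have ho := hS.app (hh.append ht.map_snd)
  exact opensTwice I.idc hn (app (φ := fun a i b => .ofBits (x a i b)) hx hi hb)
    (session ht hi hb) (ho.head.fam hi hb) (ho.tail.fam hi hb)

theorem equivocatesAfter {w : α → Data}
    {r : ∀ a, I.wi.ProverCoins (n a) (Ingredients.provenStatement (S a) (t a) (x a))}
    {d : ∀ a i b, I.idc.ReceiverCoins (n a) (x a i b)}
    (hn : Eff e fun a => .unary (n a)) (hS : Strat e S)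
    (ht : Eff e fun a => .ofTranscript (t a))
    (hx : Eff (ctxFam e n) fun p => .ofBits (x p.1 p.2.1 p.2.2)) (hw : Eff e w)
    (hr : Eff e fun a => .ofBits (List.ofFn (r a)))
    (hd : Eff (ctxFam e n) fun p => .ofBits (List.ofFn (d p.1 p.2.1 p.2.2)))
    (hi : Eff e fun a => .unary (i a)) (hb : Eff e fun a => .ofBit (b a)) :
    Eff e fun a => .ofBit (I.equivocatesAfter (S a) (t a) (x a) (w a) (r a) (d a) (i a) (b a)) :=
  equivocates I hn hS (((history hn ht hx).append (proofTranscript I hn hS (history hn ht hx)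
    (provenStatement hn hS ht hx) hw hr).map_fst).append (const .nil).singleton) hx hd hi hb

theorem bitWitness (hn : Eff e fun a => .unary (n a))
    (hρ : Eff (ctxFam e n) fun p => .ofBits (List.ofFn (ρ p.1 p.2.1 p.2.2)))
    (hc : Eff (ctxFam e n) fun p => .ofBits (List.ofFn (c p.1 p.2.1 p.2.2)))
    (hb : Eff e fun a => .ofBit (b a)) :
    Eff e fun a => I.bitWitness (ρ a) (c a) (b a) := by
  have key : Eff (ctxFin e n) fun p => ctxFam e n ⟨p.1, p.2, b p.1⟩ :=
    Eff.cons (e := ctxFin e n) (f := fun p => e p.1)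
      (g := fun p => .cons (.unary p.2) (.ofBit (b p.1))) (refl (ctxFin e n)).fst
      ((refl (ctxFin e n)).snd.cons (hb.lift Sigma.fst (refl (ctxFin e n)).fst))
  exact hb.cons ((ofFn hn (hρ.lift (fun p : Σ a, Fin (n a) => ⟨p.1, p.2, b p.1⟩) key)).cons
    (ofFn hn (hc.lift (fun p : Σ a, Fin (n a) => ⟨p.1, p.2, b p.1⟩) key)))

theorem eq_index {n : α → ℕ} {i j : ∀ a, Fin (n a)} (hi : Eff e fun a => .unary (i a))
    (hj : Eff e fun a => .unary (j a)) : Eff e fun a => .ofBit (decide (i a = j a)) :=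
  (hi.eq_nat hj).of_eq fun a => by simp [Fin.ext_iff]

theorem eq_target (hi : Eff e fun a => .unary (i a)) (hb : Eff e fun a => .ofBit (b a)) :
    Eff (ctxFam e n) fun p => .ofBit (decide (p.2.1 = i p.1) && decide (p.2.2 = b p.1)) :=
  (eq_index (n := fun p : Σ a, Fin (n a) × Bool => n p.1) ctxFam_index hi.liftFam).and
    (ctxFam_bit.eq_bool hb.liftFam)

theorem patch {y : α → List Bool}
    (hx : Eff (ctxFam e n) fun p => .ofBits (x p.1 p.2.1 p.2.2))
    (hi : Eff e fun a => .unary (i a)) (hb : Eff e fun a => .ofBit (b a))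
    (hy : Eff e fun a => .ofBits (y a)) :
    Eff (ctxFam e n) fun p => .ofBits (patch (x p.1) (i p.1) (b p.1) (y p.1) p.2.1 p.2.2) :=
  ((eq_target hi hb).ite hy.liftFam hx).of_eq fun p => by
    simp only [_root_.patch, ← Bool.decide_and, decide_eq_true_eq]
    split_ifs <;> rfl

theorem equivocatesOn {P : PromiseProblem} (hgen : IsSampler P I.gen)
    {τ : α → ℕ → Bool} {δ : ∀ a, Fin (n a) → Bool → ℕ → Bool} {y : α → List Bool}
    (hn : Eff e fun a => .unary (n a)) (hS : Strat e S)
    (ht : Eff e fun a => .ofTranscript (t a))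
    (hρ : Eff (ctxFam e n) fun p => .ofBits (List.ofFn (ρ p.1 p.2.1 p.2.2)))
    (hc : Eff (ctxFam e n) fun p => .ofBits (List.ofFn (c p.1 p.2.1 p.2.2)))
    (hτ : Tape e τ) (hδ : Tape (ctxFam e n) fun p => δ p.1 p.2.1 p.2.2)
    (hi : Eff e fun a => .unary (i a)) (hb : Eff e fun a => .ofBit (b a))
    (hy : Eff e fun a => .ofBits (y a)) :
    Eff e fun a =>
      .ofBit (I.equivocatesOn (S a) (t a) (ρ a) (c a) (τ a) (δ a) (i a) (b a) (y a)) := by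
  have hx := patch (x := fun a => I.instances (S a) (t a) (ρ a)) (instances I hgen hn hS ht hρ) hi hb hy
  -- Replacing an instance changes the numbers of coins of the prover and of the receiver; reading
  -- them from tapes makes the same `τ` and `δ` usable for every `y`.
  exact equivocatesAfter I hn hS ht hx (bitWitness I hn hρ hc hb.not)
    (hτ.read (eval _ (hn.add (provenStatement hn hS ht hx).size)))
    (hδ.read (eval _ (hn.liftFam.add hx.length_bits))) hi hb

theorem send (hn : Eff e fun a => .unary (n a))
    (hρ : Eff (ctxFam e n) fun p => .ofBits (List.ofFn (ρ p.1 p.2.1 p.2.2)))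
    (hc : Eff (ctxFam e n) fun p => .ofBits (List.ofFn (c p.1 p.2.1 p.2.2))) :
    Strat (ctxFam e n) fun p => I.sbc.send (n p.1) [] (List.ofFn (ρ p.1 p.2.1 p.2.2))
      (c p.1 p.2.1 p.2.2) :=
  next I.sbc.sender (hn.liftFam.cons ((const (.ofBits [])).cons hρ)) hc

theorem commitTranscript (hn : Eff e fun a => .unary (n a)) (hS : Strat e S)
    (hρ : Eff (ctxFam e n) fun p => .ofBits (List.ofFn (ρ p.1 p.2.1 p.2.2)))
    (hc : Eff (ctxFam e n) fun p => .ofBits (List.ofFn (c p.1 p.2.1 p.2.2))) :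
    Eff e fun a => .ofTranscript (I.commitTranscript (S a) (ρ a) (c a)) :=
  interact (parallel hn (send I hn hρ hc)) hS _

theorem relayTranscript {l : α → List Data} (hn : Eff e fun a => .unary (n a)) (hS : Strat e S)
    (hρ : Eff (ctxFam e n) fun p => .ofBits (List.ofFn (ρ p.1 p.2.1 p.2.2)))
    (hc : Eff (ctxFam e n) fun p => .ofBits (List.ofFn (c p.1 p.2.1 p.2.2)))
    (hi : Eff e fun a => .unary (i a)) (hb : Eff e fun a => .ofBit (b a))
    (hl : Eff e fun a => .ofList (l a)) :
    Eff e fun a => .ofTranscript (I.relayTranscript (S a) (ρ a) (c a) (i a) (b a) (l a)) :=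
  interact (parallel hn (strat_ite (eq_target hi hb) (strat_nth hl.liftFam)
    (send I hn hρ hc))) hS _

end Eff

/-! ### The reductions -/

/-- Part `(r, k)` of a tape that is divided into rows of eight parts of length `m`. -/
def chunk (m : ℕ) (ω : ℕ → Bool) (r k : ℕ) (j : ℕ) : Bool :=
  if j < m then ω ((r * 8 + k) * m + j) else false

/-- The random choices made by the reductions. -/
structure Choices (I : Ingredients) (S : PPT) (n : ℕ) where
  coins : S.Coins n
  digits : Fin n → Bool
  bit : Bool
  guess : Bool
  proofTape : ℕ → Bool
  mask : Fin n → Bool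
  ρ : Fin n → Bool → Fin n → Bool
  c : Fin n → Bool → I.sbc.SenderCoins n []
  δ : Fin n → Bool → ℕ → Bool

namespace Choices

variable {I : Ingredients} {S : PPT} {n : ℕ}

/-- The choices, read from a tape; the last row contains those that do not belong to a family. -/
def ofTape (I : Ingredients) (S : PPT) (n m : ℕ) (ω : ℕ → Bool) : Choices I S n where
  coins j := chunk m ω n 0 j
  digits j := chunk m ω n 1 j
  bit := chunk m ω n 2 0
  guess := chunk m ω n 3 0
  proofTape := chunk m ω n 4
  mask j := chunk m ω n 5 j
  ρ i b j := chunk m ω i (if b then 1 else 0) j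
  c i b j := chunk m ω i (if b then 3 else 2) j
  δ i b := chunk m ω i (if b then 5 else 4)

variable (ch : Choices I S n)

def strategy : List Data → Data := S.next (.unary n) ch.coins

def index (hn : 0 < n) : Fin n :=
  ⟨hornerMod n (List.ofFn ch.digits), hornerMod_lt hn _⟩

/-- The test of the decider on the instance `y`. -/
noncomputable def test (hn : 0 < n) (y : List Bool) : Bool :=
  I.equivocatesOn ch.strategy (I.commitTranscript ch.strategy ch.ρ ch.c) ch.ρ ch.c ch.proofTape ch.δ
    (ch.index hn) ch.bit y

def relay (hn : 0 < n) (l : List Data) : List (Data × Data) :=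
  I.relayTranscript ch.strategy ch.ρ ch.c (ch.index hn) ch.bit l

/-- The guess of the adversary against hiding, after the sender's messages `l`. -/
noncomputable def relayTest (hn : 0 < n) (l : List Data) : Bool :=
  I.equivocatesOn ch.strategy (ch.relay hn l) ch.ρ ch.c ch.proofTape ch.δ (ch.index hn) ch.bit
    (I.gen (List.ofFn (xorBits ch.mask
      (Ingredients.tossed n ch.strategy (ch.relay hn l) (ch.index hn) ch.bit))))

/-- The answer `1` or the answer `0`. -/
def _root_.Data.verdict (b : Bool) : Data := if b then .cons .nil .nil else .nil

theorem _root_.Data.verdict_ne_nil (b : Bool) : Data.verdict b ≠ .nil ↔ b = true := by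
  cases b <;> simp [Data.verdict]

/-- Equivocation is evidence for a yes-instance. In its absence the coin `guess` is right with
probability one half, so nothing is lost. For `n = 0` there is no session to choose and the answer
is a default. -/
noncomputable def answer (y : List Bool) : Data :=
  if hn : 0 < n then .verdict (if ch.test hn y then true else ch.guess) else .nil

/-- The number of messages received tells the phase of the hiding experiment: none for the choice of
the two messages, `rounds + 1` for the guess, and otherwise a round of the commitment. In that round
the answer is the one which the simulated sender gives in the target session; the transcript is
shifted by a `nil` entry since the first answer follows one message. -/
noncomputable def attack (l : List Data) : Data :=
  if hn : 0 < n then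
    if decide (l.length = 0) then
      .cons (.ofBits (List.ofFn ch.mask)) (.ofBits (List.ofFn (ch.ρ (ch.index hn) ch.bit)))
    else if decide (l.length = I.sbc.rounds + 1) then .verdict (ch.relayTest hn l)
    else ((Data.cons .nil (.ofTranscript (ch.relay hn l))).nth l.length).tail.fam
      (ch.index hn) ch.bit
  else .nil

end Choices

/-- A verifier that runs the sender `S` and outputs 1 if `S` equivocates.  The auxiliary input `z`
consists of the coins of `S`, the messages sent so far, the instances, the coins for the last step
and the session in question. -/
noncomputable def equivocationVerifier (I : Ingredients) (S : PPT) (n : ℕ) (z : Data)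
    (l : List Data) : Data :=
  if hn : 0 < n then
    let s := S.next (.unary n) (z.head.toBits (S.coins.eval n))
    if decide (l.length = I.wi.rounds + 1) then
      .verdict (I.equivocatesRead (n := n) s (z.tail.head.toList ++ l)
        (fun i b => (z.tail.tail.head.fam i b).toStr)
        (fun i b j => ((z.tail.tail.tail.head.fam i b).nth j).toBit)
        -- The reduction modulo `n` makes the index legal for every auxiliary input; it changes
        -- nothing on an index below `n`.
        ⟨z.tail.tail.tail.tail.head.toList.length % n, Nat.mod_lt _ hn⟩
        z.tail.tail.tail.tail.tail.toBit)
    else s (z.tail.head.toList ++ l)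
  else .nil

/-! ### Computability of the random choices and of the tests. -/

namespace Eff

variable {α β : Type} {e f g : α → Data}

theorem toList_length (hf : Eff e f) : Eff e fun a => .unary (f a).toList.length :=
  length (hf.of_eq fun _ => (Data.ofList_toList _).symm)

/-- Comparison is obtained from the remainder: `k < m` exactly when `k % m = k` and `m ≠ 0`. -/
theorem lt {k m : α → ℕ} (hk : Eff e fun a => .unary (k a)) (hm : Eff e fun a => .unary (m a)) :
    Eff e fun a => .ofBit (decide (k a < m a)) :=
  (((hk.mod hm).eq_nat hk).and (hm.eq_nat (unary_const 0)).not).of_eq fun a => by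
    congr 1
    rw [Bool.eq_iff_iff]
    rcases Nat.eq_zero_or_pos (m a) with h | h
    · simp [h]
    · simp [Nat.mod_eq_iff_lt h.ne', h.ne']

theorem verdict {b : α → Bool} (hb : Eff e fun a => .ofBit (b a)) : Eff e fun a => .verdict (b a) :=
  hb.ite (const _) (const _)

theorem Tape.chunk {ω : α → ℕ → Bool} {m r k : α → ℕ} (hω : Tape e ω)
    (hm : Eff e fun a => .unary (m a)) (hr : Eff e fun a => .unary (r a))
    (hk : Eff e fun a => .unary (k a)) : Tape e fun a => chunk (m a) (ω a) (r a) (k a) := by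
  have h1 : Eff (fun p : α × ℕ => .cons (e p.1) (.unary p.2)) fun p => e p.1 := (refl _).fst
  have h2 : Tape e fun a j => ω a ((r a * 8 + k a) * m a + j) :=
    hω.shift (((hr.mul (unary_const 8)).add hk).mul hm)
  exact ((lt (refl _).snd (hm.lift Prod.fst h1)).cond h2 (const (.ofBit false))).of_eq fun p => by
    simp [_root_.chunk]

variable (I : Ingredients) (S : PPT) {n : α → ℕ} {ch : ∀ a, Choices I S (n a)}

/-- Choices that can be computed from `e a`. -/
structure Choose (e : α → Data) (ch : ∀ a, Choices I S (n a)) : Prop where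
  size : Eff e fun a => .unary (n a)
  coins : Eff e fun a => .ofBits (List.ofFn (ch a).coins)
  digits : Eff e fun a => .ofBits (List.ofFn (ch a).digits)
  bit : Eff e fun a => .ofBit (ch a).bit
  guess : Eff e fun a => .ofBit (ch a).guess
  proofTape : Tape e fun a => (ch a).proofTape
  mask : Eff e fun a => .ofBits (List.ofFn (ch a).mask)
  ρ : Eff (ctxFam e n) fun p => .ofBits (List.ofFn ((ch p.1).ρ p.2.1 p.2.2))
  c : Eff (ctxFam e n) fun p => .ofBits (List.ofFn ((ch p.1).c p.2.1 p.2.2))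
  δ : Tape (ctxFam e n) fun p => (ch p.1).δ p.2.1 p.2.2

theorem choose_ofTape {m : α → ℕ} {ω : α → ℕ → Bool} (hn : Eff e fun a => .unary (n a))
    (hm : Eff e fun a => .unary (m a)) (hω : Tape e ω) :
    Choose I S e fun a => Choices.ofTape I S (n a) (m a) (ω a) := by
  have h1 : ∀ k, Tape e fun a => _root_.chunk (m a) (ω a) (n a) k := fun k =>
    hω.chunk hm hn (unary_const k)
  have h2 : ∀ k k', Tape (ctxFam e n) fun p => _root_.chunk (m p.1) (ω p.1) p.2.1
      (if p.2.2 then k else k') := fun k k' =>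
    (hω.lift Sigma.fst ctxFam_fst).chunk hm.liftFam ctxFam_index
      ((ctxFam_bit.ite (unary_const k) (unary_const k')).of_eq fun p => by split_ifs <;> rfl)
  exact {
    size := hn
    coins := (h1 0).read (eval _ hn)
    digits := (h1 1).read hn
    bit := (h1 2).at (unary_const 0)
    guess := (h1 3).at (unary_const 0)
    proofTape := h1 4
    mask := (h1 5).read hn
    ρ := (h2 1 0).read hn.liftFam
    c := (h2 3 2).read (eval _ hn.liftFam)
    δ := h2 5 4 }

variable {I S}

theorem Choose.strategy (h : Choose I S e ch) : Strat e fun a => (ch a).strategy :=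
  next S h.size h.coins

theorem Choose.index (h : Choose I S e ch) (hn : ∀ a, 0 < n a) :
    Eff e fun a => .unary ((ch a).index (hn a)) :=
  hornerMod h.size h.digits

theorem Choose.test {P : PromiseProblem} (hgen : IsSampler P I.gen) (h : Choose I S e ch)
    (hn : ∀ a, 0 < n a) {y : α → List Bool} (hy : Eff e fun a => .ofBits (y a)) :
    Eff e fun a => .ofBit ((ch a).test (hn a) (y a)) :=
  equivocatesOn I hgen h.size h.strategy (commitTranscript I h.size h.strategy h.ρ h.c) h.ρ h.c
    h.proofTape h.δ (h.index hn) h.bit hy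

theorem Choose.relay (h : Choose I S e ch) (hn : ∀ a, 0 < n a) {l : α → List Data}
    (hl : Eff e fun a => .ofList (l a)) :
    Eff e fun a => .ofTranscript ((ch a).relay (hn a) (l a)) :=
  relayTranscript I h.size h.strategy h.ρ h.c (h.index hn) h.bit hl

theorem Choose.relayTest {P : PromiseProblem} (hgen : IsSampler P I.gen) (h : Choose I S e ch)
    (hn : ∀ a, 0 < n a) {l : α → List Data} (hl : Eff e fun a => .ofList (l a)) :
    Eff e fun a => .ofBit ((ch a).relayTest (hn a) (l a)) := by
  have ht := h.relay hn hl
  have h1 : Eff e fun a => .ofBits (List.ofFn (Ingredients.tossed (n a) (ch a).strategy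
      ((ch a).relay (hn a) (l a)) ((ch a).index (hn a)) (ch a).bit)) :=
    ((h.strategy.app ht.query).fam (h.index hn) h.bit).toBits h.size
  have h2 := gen I hgen (xorBits (u := fun a => (ch a).mask) (v := fun a =>
    Ingredients.tossed (n a) (ch a).strategy ((ch a).relay (hn a) (l a)) ((ch a).index (hn a))
      (ch a).bit) h.size h.mask h1)
  exact equivocatesOn I (S := fun a => (ch a).strategy) (ρ := fun a => (ch a).ρ)
    (c := fun a => (ch a).c) (τ := fun a => (ch a).proofTape) (δ := fun a => (ch a).δ) hgen
    h.size h.strategy ht h.ρ h.c h.proofTape h.δ (h.index hn) h.bit h2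

end Eff

/-! ### The three reductions as polynomial-time functions of their raw input. -/

section PPTs

variable {P : PromiseProblem} {I : Ingredients} (hgen : IsSampler P I.gen) (S : PPT)
  (M : Polynomial ℕ)

theorem polyTime_answer (hgen : IsSampler P I.gen) : PolyTime fun d =>
    (Choices.ofTape I S d.head.head.toList.length (M.eval d.head.head.toList.length)
      fun j => (d.tail.head.nth j).toBit).answer d.head.tail.toStr := by
  refine Eff.polyTime ?_
  unfold Choices.answer
  have hn : Eff (fun d : Data => d) fun d => .unary d.head.head.toList.length :=
    (Eff.refl _).head.head.toList_length
  refine Eff.dite ((Eff.unary_const 0).lt hn) ?_ (.const _)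
  have hid := Eff.refl fun d : {d : Data // 0 < d.head.head.toList.length} => d.1
  have hch := Eff.choose_ofTape I S hid.head.head.toList_length
    (Eff.eval M hid.head.head.toList_length) hid.tail.head.tape
  exact ((hch.test hgen (fun d => d.2) hid.head.tail.toStr).cond (.const (.ofBit true))
    hch.guess).verdict

theorem polyTime_attack (hgen : IsSampler P I.gen) : PolyTime fun d =>
    (Choices.ofTape I S d.head.toList.length (M.eval d.head.toList.length)
      fun j => (d.tail.head.nth j).toBit).attack d.tail.tail.toList := by
  refine Eff.polyTime ?_
  unfold Choices.attack
  have hn : Eff (fun d : Data => d) fun d => .unary d.head.toList.length :=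
    (Eff.refl _).head.toList_length
  refine Eff.dite ((Eff.unary_const 0).lt hn) ?_ (.const _)
  have hid := Eff.refl fun d : {d : Data // 0 < d.head.toList.length} => d.1
  have hch := Eff.choose_ofTape I S hid.head.toList_length
    (Eff.eval M hid.head.toList_length) hid.tail.head.tape
  have hl : Eff (fun d : {d : Data // 0 < d.head.toList.length} => d.1)
      fun d => .ofList d.1.tail.tail.toList := hid.tail.tail.of_eq fun d => by simp
  refine (hid.tail.tail.toList_length.eq_nat (.unary_const 0)).ite
    (hch.mask.cons (Eff.app (φ := fun d i b => .ofBits (List.ofFn ((Choices.ofTape I S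
      d.1.head.toList.length (M.eval d.1.head.toList.length)
        fun j => (d.1.tail.head.nth j).toBit).ρ i b))) hch.ρ (hch.index fun d => d.2) hch.bit))
    ((hid.tail.tail.toList_length.eq_nat (.unary_const _)).ite
      (hch.relayTest hgen (fun d => d.2) hl).verdict
      ((((Eff.const .nil).cons (hch.relay (fun d => d.2) hl)).nth
        hid.tail.tail.toList_length).tail.fam (hch.index fun d => d.2) hch.bit))

theorem polyTime_equivocationVerifier : PolyTime fun d =>
    equivocationVerifier I S d.head.head.toList.length d.head.tail.tail d.tail.tail.toList := by
  refine Eff.polyTime ?_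
  unfold equivocationVerifier
  have hn : Eff (fun d : Data => d) fun d => .unary d.head.head.toList.length :=
    (Eff.refl _).head.head.toList_length
  refine Eff.dite ((Eff.unary_const 0).lt hn) ?_ (.const _)
  have hid := Eff.refl fun d : {d : Data // 0 < d.head.head.toList.length} => d.1
  have hn := hid.head.head.toList_length
  have hz := hid.head.tail.tail
  have hS := Eff.next S (k := fun d : {d : Data // 0 < d.head.head.toList.length} =>
    d.1.head.head.toList.length) hn (hz.head.toBits (Eff.eval S.coins hn))
  have hh : Eff (fun d : {d : Data // 0 < d.head.head.toList.length} => d.1) fun d =>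
      .ofList (d.1.head.tail.tail.tail.head.toList ++ d.1.tail.tail.toList) :=
    Eff.append (hz.tail.head.of_eq fun d => by simp) (hid.tail.tail.of_eq fun d => by simp)
  have hx := (hz.tail.tail.head.liftFam.fam (n := fun p => p.1.1.head.head.toList.length)
    Eff.ctxFam_index (Eff.ctxFam_bit (n := fun d => d.1.head.head.toList.length))).toStr
  refine (hid.tail.tail.toList_length.eq_nat (.unary_const _)).ite
    (Eff.equivocates I hn hS hh hx (Eff.Tape.read
      (hz.tail.tail.tail.head.liftFam.fam (n := fun p => p.1.1.head.head.toList.length)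
        Eff.ctxFam_index Eff.ctxFam_bit).tape
      (Eff.eval _ (hn.liftFam.add hx.length_bits)))
      (hz.tail.tail.tail.tail.head.toList_length.mod hn) hz.tail.tail.tail.tail.tail.toBit).verdict
    (hS.app hh)

end PPTs

open scoped BigOperators

/-! ### Averages -/

open Classical in
/-- The number 1 if `p` holds, and 0 otherwise. -/
noncomputable def ind (p : Prop) : ℝ := if p then 1 else 0

theorem ind_true {p : Prop} (h : p) : ind p = 1 := if_pos h

theorem ind_false {p : Prop} (h : ¬p) : ind p = 0 := if_neg h

theorem ind_nonneg (p : Prop) : 0 ≤ ind p := by unfold ind; split_ifs <;> norm_num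

theorem ind_le_one (p : Prop) : ind p ≤ 1 := by unfold ind; split_ifs <;> norm_num

theorem ind_mono {p q : Prop} (h : p → q) : ind p ≤ ind q := by
  by_cases hp : p
  · rw [ind_true hp, ind_true (h hp)]
  · rw [ind_false hp]; exact ind_nonneg q

theorem expect_mono {α : Type} [Fintype α] {f g : α → ℝ} (h : ∀ a, f a ≤ g a) :
    𝔼 a, f a ≤ 𝔼 a, g a :=
  Finset.expect_le_expect fun a _ => h a

section Pr

variable {α β : Type} [Fintype α] [Nonempty α]

/-- Experiments become iterated finite averages, in which independent choices can be exchanged and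
transformed by bijections. -/
theorem Pr_bind (f : α → PMF β) (E : Set β) : Pr (unif α >>= f) E = 𝔼 a, Pr (f a) E := by
  have h : ∀ a, (f a).toOuterMeasure E ≠ ⊤ := fun a => by
    refine ne_top_of_le_ne_top ENNReal.one_ne_top ?_
    calc (f a).toOuterMeasure E ≤ (f a).toOuterMeasure Set.univ := MeasureTheory.measure_mono
          (Set.subset_univ _)
      _ = 1 := by rw [PMF.toOuterMeasure_apply]; simp [PMF.tsum_coe]
  rw [Pr, show (unif α >>= f) = (unif α).bind f from rfl, PMF.toOuterMeasure_bind_apply,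
    tsum_fintype, ENNReal.toReal_sum fun a _ => ENNReal.mul_ne_top (PMF.apply_ne_top _ _) (h a),
    Fintype.expect_eq_sum_div_card, Finset.sum_div]
  refine Finset.sum_congr rfl fun a _ => ?_
  rw [unif, PMF.uniformOfFintype_apply, ENNReal.toReal_mul, ENNReal.toReal_inv, Pr]
  simp [div_eq_inv_mul]

theorem Pr_pure (b : β) (E : Set β) : Pr (pure b) E = ind (b ∈ E) := by
  classical
  rw [Pr, show (pure b : PMF β) = PMF.pure b from rfl, PMF.toOuterMeasure_pure_apply, ind]
  split_ifs <;> simp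

theorem Pr_unif (E : Set α) : Pr (unif α) E = 𝔼 a, ind (a ∈ E) := by
  rw [← bind_pure (unif α), Pr_bind]
  simp only [Pr_pure]

theorem expect_le_const {f : α → ℝ} {c : ℝ} (h : ∀ a, f a ≤ c) : 𝔼 a, f a ≤ c :=
  (expect_mono h).trans (Fintype.expect_const c).le

theorem abs_expect_sub_le {f g : α → ℝ} {c : ℝ} (h : ∀ a, |f a - g a| ≤ c) :
    |𝔼 a, f a - 𝔼 a, g a| ≤ c := by
  rw [← Finset.expect_sub_distrib]
  exact (Finset.abs_expect_le _ _).trans (expect_le_const h)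

end Pr

/-! ### Reading some of the bits of a random string. -/

section Restriction

instance decidableEqSum {α β : Type} [DecidableEq α] [DecidableEq β] : DecidableEq (α ⊕ β) :=
  instDecidableEqSum

variable {J K : Type} [Fintype J] [Fintype K] [DecidableEq J] [DecidableEq K]

theorem expect_prod {α β : Type} [Fintype α] [Fintype β] (F : α → β → ℝ) :
    𝔼 p : α × β, F p.1 p.2 = 𝔼 a, 𝔼 b, F a b :=
  Finset.expect_product' Finset.univ Finset.univ F

/-- Some of the bits of a uniformly random string are uniformly random. -/
theorem expect_comp_injective (ι : J → K) (hι : Function.Injective ι) (F : (J → Bool) → ℝ) :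
    𝔼 ω : K → Bool, F (ω ∘ ι) = 𝔼 v : J → Bool, F v := by
  classical
  let e : (K → Bool) ≃ (J → Bool) × ({k // ¬ k ∈ Set.range ι} → Bool) :=
    (Equiv.piEquivPiSubtypeProd (fun k => k ∈ Set.range ι) fun _ => Bool).trans
      (Equiv.prodCongr (Equiv.arrowCongr (Equiv.ofInjective ι hι).symm (Equiv.refl _))
        (Equiv.refl _))
  rw [Fintype.expect_equiv e _ (fun p => F p.1) fun ω => ?_, expect_prod fun v _ => F v]
  · simp only [Fintype.expect_const]
  · congr 1

theorem expect_sum_arrow (F : (J ⊕ K → Bool) → ℝ) :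
    𝔼 v : J ⊕ K → Bool, F v = 𝔼 a : J → Bool, 𝔼 b : K → Bool, F (Sum.elim a b) := by
  rw [← expect_prod fun a b => F (Sum.elim a b)]
  exact (Fintype.expect_equiv (Equiv.sumArrowEquivProdArrow J K Bool).symm _ _ fun p => rfl).symm

theorem expect_unit_arrow (F : Bool → ℝ) : 𝔼 v : Unit → Bool, F (v ()) = 𝔼 b, F b :=
  Fintype.expect_equiv (Equiv.funUnique Unit Bool) _ _ fun _ => rfl

/-- The infinite string that begins with `f` and continues with zeros. -/
def extend {m : ℕ} (f : Fin m → Bool) (j : ℕ) : Bool := if h : j < m then f ⟨j, h⟩ else false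

/-- This removes types that depend on earlier coins: instead of exactly `k` coins a party gets a
tape of a fixed length `m`, so that the averages can be reordered. -/
theorem expect_read {k m : ℕ} (h : k ≤ m) (F : (Fin k → Bool) → ℝ) :
    𝔼 τ : Fin m → Bool, F (fun j => extend τ j) = 𝔼 r, F r := by
  rw [← expect_comp_injective (Fin.castLE h) (Fin.castLE_injective h)]
  refine Fintype.expect_equiv (Equiv.refl _) _ _ fun τ => ?_
  congr 1
  funext j
  have : (j : ℕ) < m := by omega
  simp [extend, this]
  rfl

theorem expect_curry₃ {n m : ℕ} (F : (Fin n → Bool → Fin m → Bool) → ℝ) :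
    𝔼 v : Fin n × Bool × Fin m → Bool, F (fun i b j => v (i, b, j)) = 𝔼 δ, F δ :=
  Fintype.expect_equiv ((Equiv.curry _ _ _).trans
    (Equiv.arrowCongr (Equiv.refl _) (Equiv.curry _ _ _))) _ _ fun _ => rfl

theorem expect_read_fam {n m : ℕ} {k : Fin n → Bool → ℕ} (h : ∀ i b, k i b ≤ m)
    (F : (∀ i b, Fin (k i b) → Bool) → ℝ) :
    𝔼 δ : Fin n → Bool → Fin m → Bool, F (fun i b j => extend (δ i b) j) = 𝔼 d, F d := by
  let e : ((Σ p : Fin n × Bool, Fin (k p.1 p.2)) → Bool) ≃ (∀ i b, Fin (k i b) → Bool) :=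
    { toFun v i b j := v ⟨(i, b), j⟩
      invFun d p := d p.1.1 p.1.2 p.2
      left_inv _ := rfl
      right_inv _ := rfl }
  rw [← Fintype.expect_equiv e (fun v => F (e v)) F fun _ => rfl, ← expect_comp_injective
    (K := Fin n × Bool × Fin m)
    (fun p : Σ p : Fin n × Bool, Fin (k p.1 p.2) => (p.1.1, p.1.2, Fin.castLE (h _ _) p.2)),
    ← expect_curry₃]
  · refine Fintype.expect_equiv (Equiv.refl _) _ _ fun τ => ?_
    congr 1
    funext i b j
    have : (j : ℕ) < m := j.2.trans_le (h i b)
    simp [extend, this, e]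
    rfl
  · rintro ⟨⟨i, b⟩, j⟩ ⟨⟨i', b'⟩, j'⟩ h
    simp only [Prod.mk.injEq] at h
    obtain ⟨rfl, rfl, h⟩ := h
    rw [Fin.castLE_injective _ h]

end Restriction

/-! ### Replacing parts of random families. -/

section Resampling

theorem patch_self {β : Type} {n : ℕ} (f : Fin n → Bool → β) (i : Fin n) (b : Bool) :
    patch f i b (f i b) = f := by
  funext i' b'
  unfold patch
  split_ifs with h
  · rw [h.1, h.2]
  · rfl

@[simp] theorem patch_same {β : Type} {n : ℕ} (f : Fin n → Bool → β) (i : Fin n) (b : Bool)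
    (y : β) : patch f i b y i b = y := by simp [patch]

theorem patch_of_ne {β : Type} {n : ℕ} (f : Fin n → Bool → β) (i : Fin n) (b : Bool)
    (y : β) {i' : Fin n} {b' : Bool} (h : ¬(i' = i ∧ b' = b)) : patch f i b y i' b' = f i' b' :=
  if_neg h

theorem patch_patch {β : Type} {n : ℕ} (f : Fin n → Bool → β) (i : Fin n) (b : Bool) (y z : β) :
    patch (patch f i b y) i b z = patch f i b z := by
  funext i' b'
  unfold patch
  split_ifs <;> rfl

/-- Replacing one member of a uniformly random family by a new one. -/
theorem expect_patch {β : Type} {n : ℕ} [Fintype β] [DecidableEq β] [Nonempty β] (i : Fin n)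
    (b : Bool) (F : (Fin n → Bool → β) → ℝ) : 𝔼 f, 𝔼 y, F (patch f i b y) = 𝔼 f, F f := by
  -- Swapping the member `(i, b)` with the new value is an involution of the pairs, hence preserves
  -- averages.
  let σ : (Fin n → Bool → β) × β → (Fin n → Bool → β) × β := fun p => (patch p.1 i b p.2, p.1 i b)
  have hσ : Function.Involutive σ := fun p => by
    simp only [σ, patch_patch, patch_same, patch_self]
  calc 𝔼 f, 𝔼 y, F (patch f i b y) = 𝔼 p : (Fin n → Bool → β) × β, F (patch p.1 i b p.2) :=
        (expect_prod fun f y => F (patch f i b y)).symm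
    _ = 𝔼 p : (Fin n → Bool → β) × β, F p.1 :=
        Fintype.expect_equiv hσ.toPerm _ (fun p => F p.1) fun _ => rfl
    _ = 𝔼 f, F f := by
        rw [expect_prod fun f (_ : β) => F f]
        simp only [Fintype.expect_const]

theorem expect_xorBits {n : ℕ} (v : Fin n → Bool) (F : (Fin n → Bool) → ℝ) :
    𝔼 u, F (xorBits u v) = 𝔼 u, F u := by
  have hσ : Function.Involutive fun u : Fin n → Bool => xorBits u v := fun u => by
    funext j; simp [xorBits]
  exact Fintype.expect_equiv hσ.toPerm _ _ fun _ => rfl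

end Resampling

/-! ### Sampling an index -/

/-- The number with the given binary digits. -/
def horner (l : List Bool) : ℕ := l.foldl (fun a b => 2 * a + b.toNat) 0

theorem hornerMod_eq {n : ℕ} (hn : 0 < n) (l : List Bool) : hornerMod n l = horner l % n := by
  induction l using List.reverseRecOn with
  | nil => simp [hornerMod, horner]
  | append_singleton l b ih =>
    rw [hornerMod, horner, List.foldl_append, List.foldl_append, ← hornerMod, ← horner, ih]
    simp only [List.foldl_cons, List.foldl_nil, if_neg hn.ne']
    rw [Nat.add_mod, Nat.mul_mod_mod, ← Nat.add_mod]

/-- The strings of `k` digits run once through all numbers below `2 ^ k`; the induction splits off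
the last digit. -/
theorem expect_horner (k : ℕ) (g : ℕ → ℝ) :
    𝔼 v : Fin k → Bool, g (horner (List.ofFn v)) = (∑ j ∈ Finset.range (2 ^ k), g j) / 2 ^ k := by
  induction k generalizing g with
  | zero => simp [horner]
  | succ k ih =>
    have hsum : ∀ m, ∑ j ∈ Finset.range (m * 2), g j =
        ∑ j ∈ Finset.range m, (g (2 * j) + g (2 * j + 1)) := by
      intro m
      induction m with
      | zero => simp
      | succ m ih =>
        rw [Finset.sum_range_succ, ← ih, add_mul, one_mul, Finset.sum_range_succ,
          Finset.sum_range_succ, mul_comm m 2, add_assoc]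
    rw [← Fintype.expect_equiv (Fin.snocEquiv fun _ => Bool) (fun p => g (2 * horner (List.ofFn p.2)
      + p.1.toNat)) _ fun p => ?_, expect_prod fun (b : Bool) (v : Fin k → Bool) =>
        g (2 * horner (List.ofFn v) + b.toNat), Finset.expect_comm,
      ih fun j => 𝔼 b : Bool, g (2 * j + b.toNat), pow_succ, hsum, pow_succ, ← div_div,
      div_right_comm]
    · rw [Finset.sum_div _ _ (2 : ℝ)]
      congr 1
      refine Finset.sum_congr rfl fun (j : ℕ) _ => ?_
      rw [Fintype.expect_eq_sum_div_card]
      simp [add_comm]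
    · rw [List.ofFn_succ', List.concat_eq_append, horner, horner, List.foldl_append]
      simp [Fin.snocEquiv]

/-- Only the complete periods are counted; the incomplete one contributes a nonnegative amount. -/
theorem sum_range_mod_ge {n : ℕ} (N : ℕ) {ψ : ℕ → ℝ} (hψ : ∀ i, 0 ≤ ψ i) :
    (N / n : ℕ) * ∑ i ∈ Finset.range n, ψ i ≤ ∑ j ∈ Finset.range N, ψ (j % n) := by
  have h : ∀ q : ℕ, ∑ j ∈ Finset.range (n * q), ψ (j % n) = q * ∑ i ∈ Finset.range n, ψ i := by
    intro q
    induction q with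
    | zero => simp
    | succ q ih =>
      rw [Nat.mul_succ, Finset.sum_range_add, ih, Nat.cast_succ, add_mul, one_mul]
      congr 1
      refine Finset.sum_congr rfl fun i hi => ?_
      rw [Nat.mul_add_mod, Nat.mod_eq_of_lt (Finset.mem_range.1 hi)]
  rw [← h]
  exact Finset.sum_le_sum_of_subset_of_nonneg
    (Finset.range_subset_range.2 (Nat.mul_div_le N n)) fun _ _ _ => hψ _

/-- The index obtained from `n` random digits is almost uniform. -/
theorem expect_index_ge {n : ℕ} (hn : 0 < n) {φ : Fin n → ℝ} (h0 : ∀ i, 0 ≤ φ i)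
    (h1 : ∀ i, φ i ≤ 1) : (∑ i, φ i) / n - n / 2 ^ n ≤
      𝔼 v : Fin n → Bool, φ ⟨hornerMod n (List.ofFn v), hornerMod_lt hn _⟩ := by
  let ψ : ℕ → ℝ := fun j => if h : j < n then φ ⟨j, h⟩ else 0
  have hψ : ∀ j, 0 ≤ ψ j := fun j => by simp only [ψ]; split_ifs; exacts [h0 _, le_rfl]
  have e1 : ∀ v : Fin n → Bool, φ ⟨hornerMod n (List.ofFn v), hornerMod_lt hn _⟩ =
      ψ (horner (List.ofFn v) % n) := fun v => by
    simp only [ψ, dif_pos (Nat.mod_lt _ hn), hornerMod_eq hn]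
  simp only [e1]
  rw [expect_horner n fun j => ψ (j % n)]
  have e2 : ∑ i ∈ Finset.range n, ψ i = ∑ i, φ i := by
    rw [Finset.sum_range]; simp [ψ]
  have h2 := sum_range_mod_ge (n := n) (2 ^ n) hψ
  rw [e2] at h2
  have h3 : ∑ i, φ i ≤ n := by
    simpa using Finset.sum_le_sum fun i (_ : i ∈ Finset.univ) => h1 i
  have h4 : 0 ≤ ∑ i, φ i := Finset.sum_nonneg fun i _ => h0 i
  -- Every residue is hit at least `⌊2^n / n⌋` times. Rounding costs at most one hit for each
  -- residue, in total at most `∑ φ / 2^n ≤ n / 2^n`.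
  have h5 : (2 : ℝ) ^ n / n - 1 ≤ (2 ^ n / n : ℕ) := by
    have := Nat.lt_div_mul_add (a := 2 ^ n) hn
    have hn' : (0 : ℝ) < n := by exact_mod_cast hn
    rw [sub_le_iff_le_add, div_le_iff₀ hn', add_mul, one_mul]
    exact_mod_cast this.le
  have h6 := mul_le_mul_of_nonneg_right h5 h4
  rw [le_div_iff₀ (by positivity), sub_mul]
  have h7 : (n : ℝ) / 2 ^ n * 2 ^ n = n := by field_simp
  have h8 : (∑ i, φ i) / n * 2 ^ n = 2 ^ n / n * ∑ i, φ i := by ring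
  rw [h7, h8]
  linarith

/-! ### Parallel sessions -/

/-- A transcript is determined by the local condition that each message is the right answer to the
preceding ones. Simulated executions are identified with real ones by checking this condition. -/
theorem interact_unique {A B : List Data → Data} {T : List (Data × Data)}
    (hA : ∀ j (hj : j < T.length), T[j].1 = A ((T.take j).map Prod.snd))
    (hB : ∀ j (hj : j < T.length), T[j].2 = B ((T.take (j + 1)).map Prod.fst)) :
    interact A B T.length = T := by
  have : ∀ k ≤ T.length, interact A B k = T.take k := by
    intro k
    induction k with
    | zero => intro _; rfl
    | succ k ih =>
      intro hk
      have hk' : k < T.length := hk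
      have h2 := hB k hk'
      rw [List.take_add_one, List.getElem?_eq_getElem hk', List.map_append] at h2
      rw [interact_succ, ih (by omega), List.take_add_one, List.getElem?_eq_getElem hk', ← hA k hk']
      congr 1
      exact congrArg (fun d => [d]) (Prod.ext rfl h2.symm)
  rw [this _ le_rfl, List.take_length]

theorem interact_fst (A B : List Data → Data) {j k : ℕ} (h : j < (interact A B k).length) :
    (interact A B k)[j].1 = A (((interact A B k).take j).map Prod.snd) := by
  rw [interact_getElem, interact_take _ _ (by simp at h; omega)]

theorem interact_snd (A B : List Data → Data) {j k : ℕ} (h : j < (interact A B k).length) :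
    (interact A B k)[j].2 = B (((interact A B k).take (j + 1)).map Prod.fst) := by
  rw [interact_getElem, interact_take _ _ (by simp at h; omega), interact_succ]
  simp

theorem Data.nth_ofFn {n : ℕ} (f : Fin n → Data) (i : Fin n) :
    (Data.ofList (List.ofFn f)).nth i = f i := by
  simp [Data.nth_ofList]

@[simp] theorem Data.fam_ofFam {n : ℕ} (f : Fin n → Bool → Data) (i : Fin n) (b : Bool) :
    (Data.ofFam f).fam i b = f i b := by
  rw [Data.fam, Data.ofFam, Data.nth_ofFn]
  cases b <;> rfl

@[simp] theorem length_session {n : ℕ} (t : List (Data × Data)) (i : Fin n) (b : Bool) :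
    (session t i b).length = t.length := by simp [session]

theorem session_getElem {n : ℕ} (t : List (Data × Data)) (i : Fin n) (b : Bool) (j : ℕ)
    (hj : j < (session t i b).length) :
    (session t i b)[j] = ((t[j]'(by simpa using hj)).1.fam i b,
      (t[j]'(by simpa using hj)).2.fam i b) := by
  simp [session]

theorem session_take_map_fst {n : ℕ} (t : List (Data × Data)) (i : Fin n) (b : Bool) (j : ℕ) :
    ((session t i b).take j).map Prod.fst = ((t.take j).map Prod.fst).map fun d => d.fam i b := by
  simp [session, ← List.map_take]

theorem session_take_map_snd {n : ℕ} (t : List (Data × Data)) (i : Fin n) (b : Bool) (j : ℕ) :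
    ((session t i b).take j).map Prod.snd = ((t.take j).map Prod.snd).map fun d => d.fam i b := by
  simp [session, ← List.map_take]

theorem session_interact_fst {n : ℕ} (A : Fin n → Bool → List Data → Data) (B : List Data → Data)
    (k : ℕ) (i : Fin n) (b : Bool) {j : ℕ}
    (hj : j < (session (interact (parallel A) B k) i b).length) :
    (session (interact (parallel A) B k) i b)[j].1 =
      A i b (((session (interact (parallel A) B k) i b).take j).map Prod.snd) := by
  rw [session_getElem, interact_fst, session_take_map_snd, parallel, Data.fam_ofFam]

theorem session_interact_snd {n : ℕ} (A : List Data → Data) (B : Fin n → Bool → List Data → Data)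
    (k : ℕ) (i : Fin n) (b : Bool) {j : ℕ}
    (hj : j < (session (interact A (parallel B) k) i b).length) :
    (session (interact A (parallel B) k) i b)[j].2 =
      B i b (((session (interact A (parallel B) k) i b).take (j + 1)).map Prod.fst) := by
  rw [session_getElem, interact_snd, session_take_map_fst, parallel, Data.fam_ofFam]

theorem CommitmentScheme.opens_session (C : CommitmentScheme) {n k : ℕ}
    (x : List Bool) (m : Fin n → Bool → List Bool) (c : Fin n → Bool → C.SenderCoins k x)
    (S : List Data → Data) (i : Fin n) (b : Bool) :
    C.Opens k x (session (interact (parallel fun i b => C.send k x (m i b) (c i b)) S C.rounds) i b)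
      (m i b) (c i b) :=
  ⟨by simp, fun _ hj => session_interact_fst _ _ _ _ _ hj⟩

/-- Replaying the first party's messages of one session. -/
theorem interact_relay_fst {n k : ℕ} (A : Fin n → Bool → List Data → Data) (S : List Data → Data)
    (i : Fin n) (b : Bool) (l : List Data)
    (hl : ∀ j, j < k → l.getD j .nil = ((session (interact (parallel A) S k) i b).getD j
      (.nil, .nil)).1) :
    interact (parallel fun i' b' l' => if decide (i' = i) && decide (b' = b)
      then (Data.ofList l).nth l'.length else A i' b' l') S k = interact (parallel A) S k := by
  conv_lhs => rw [← length_interact (parallel A) S k]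
  refine interact_unique (fun j hj => ?_) fun j hj => interact_snd _ _ hj
  have hj' : j < k := by simpa using hj
  rw [interact_fst, parallel, parallel]
  congr 1
  funext i' b'
  by_cases h : i' = i ∧ b' = b
  · obtain ⟨rfl, rfl⟩ := h
    simp only [decide_true, Bool.and_self, if_true]
    rw [Data.nth_ofList]
    have h1 : (((interact (parallel A) S k).take j).map Prod.snd).length = j := by
      simp; omega
    rw [List.length_map, h1, hl j hj', List.getD_eq_getElem _ _ (by simpa using hj'),
      session_interact_fst, session_take_map_snd]
  · rw [if_neg (by simpa using h)]

/-- Replaying the second party's messages of one session. -/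
theorem interact_relay_snd {n k : ℕ} (A : List Data → Data) (B : Fin n → Bool → List Data → Data)
    (i : Fin n) (b : Bool) (l : List Data)
    (hl : ∀ j, j < k → l.getD j .nil = ((session (interact A (parallel B) k) i b).getD j
      (.nil, .nil)).2) :
    interact A (parallel fun i' b' l' => if i' = i ∧ b' = b
      then (Data.ofList l).nth (l'.length - 1) else B i' b' l') k = interact A (parallel B) k := by
  conv_lhs => rw [← length_interact A (parallel B) k]
  refine interact_unique (fun j hj => interact_fst _ _ hj) fun j hj => ?_
  have hj' : j < k := by simpa using hj
  rw [interact_snd, parallel, parallel]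
  congr 1
  funext i' b'
  by_cases h : i' = i ∧ b' = b
  · obtain ⟨rfl, rfl⟩ := h
    rw [if_pos ⟨rfl, rfl⟩, Data.nth_ofList]
    have h1 : (((interact A (parallel B) k).take (j + 1)).map Prod.fst).length = j + 1 := by
      simp; omega
    rw [List.length_map, h1, Nat.add_sub_cancel, hl j hj',
      List.getD_eq_getElem _ _ (by simpa using hj'), session_interact_snd, session_take_map_fst]
  · rw [if_neg h]

/-- The strategy of the first party in one of several parallel sessions, when the second party is
honest in the others. -/
def sessionStrategy {n : ℕ} (A : List Data → Data) (B : Fin n → Bool → List Data → Data)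
    (i : Fin n) (b : Bool) (l : List Data) : Data :=
  (A ((interact A (parallel fun i' b' l' => if i' = i ∧ b' = b
    then (Data.ofList l).nth (l'.length - 1) else B i' b' l') l.length).map Prod.snd)).fam i b

/-- A cheating first party in many parallel sessions yields a cheating party in a single one, which
plays the other sessions in its head. So stand-alone binding covers each parallel session. -/
theorem interact_sessionStrategy {n k : ℕ} (A : List Data → Data)
    (B : Fin n → Bool → List Data → Data) (i : Fin n) (b : Bool) :
    interact (sessionStrategy A B i b) (B i b) k = session (interact A (parallel B) k) i b := by
  conv_lhs => rw [← length_interact A (parallel B) k, ← length_session _ i b]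
  refine interact_unique (fun j hj => ?_) fun j hj => session_interact_snd _ _ _ _ _ hj
  have hj' : j < k := by simpa using hj
  have h1 : (((session (interact A (parallel B) k) i b).take j).map Prod.snd).length = j := by
    simp; omega
  rw [sessionStrategy, h1, interact_relay_snd, session_getElem, interact_fst,
    interact_take _ _ hj'.le]
  intro j' hj''
  rw [← interact_take A (parallel B) hj'.le, session, session, List.map_take]
  simp only [List.getD_eq_getElem?_getD, List.getElem?_map, List.getElem?_take_of_lt hj'']
  generalize (interact A (parallel B) k)[j']? = o
  cases o <;> rfl

/-- The honest party of session `(i, b)` is never consulted by the simulation, so the strategy is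
fixed before the coins of that session are drawn. -/
theorem sessionStrategy_congr {n : ℕ} (A : List Data → Data)
    {B B' : Fin n → Bool → List Data → Data} (i : Fin n) (b : Bool)
    (h : ∀ i' b', ¬(i' = i ∧ b' = b) → B i' b' = B' i' b') :
    sessionStrategy A B i b = sessionStrategy A B' i b := by
  have : (fun l : List Data => fun i' b' l' => if i' = i ∧ b' = b
      then (Data.ofList l).nth (l'.length - 1) else B i' b' l') = fun l i' b' l' =>
      if i' = i ∧ b' = b then (Data.ofList l).nth (l'.length - 1) else B' i' b' l' := by
    funext l i' b' l'
    split_ifs with h'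
    · rfl
    · rw [h _ _ h']
  funext l
  simp only [sessionStrategy, congrFun this l]

namespace Ingredients

variable (I : Ingredients) {n : ℕ} (S : List Data → Data) (ρ : Fin n → Bool → Fin n → Bool)
    (c : Fin n → Bool → I.sbc.SenderCoins n []) (i : Fin n) (b : Bool)

theorem commitTranscript_patch (v : Fin n → Bool) (r : I.sbc.SenderCoins n []) :
    I.commitTranscript S (patch ρ i b v) (patch c i b r) =
      interact (parallel fun i' b' => if i' = i ∧ b' = b then I.sbc.send n [] (List.ofFn v) r
        else I.sbc.send n [] (List.ofFn (ρ i' b')) (c i' b')) S I.sbc.rounds := by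
  rw [commitTranscript]
  congr 2
  funext i' b'
  unfold patch
  split_ifs <;> rfl

/-- Relaying the messages of a sender in session `(i, b)`. -/
theorem relayTranscript_eq (v : Fin n → Bool) (r : I.sbc.SenderCoins n []) (l : List Data) (k : ℕ)
    (hk : k ≤ I.sbc.rounds) (hl : ∀ j, j < k → l.getD j .nil = ((session (I.commitTranscript S
      (patch ρ i b v) (patch c i b r)) i b).getD j (.nil, .nil)).1) :
    (I.relayTranscript S ρ c i b l).take k =
      (I.commitTranscript S (patch ρ i b v) (patch c i b r)).take k := by
  rw [commitTranscript_patch] at *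
  rw [relayTranscript, interact_take _ _ hk, interact_take _ _ hk]
  refine Eq.trans ?_ (interact_relay_fst (k := k) _ S i b l fun j hj => ?_)
  · congr 2
    funext i' b' l'
    by_cases h : i' = i ∧ b' = b
    · simp [h]
    · rw [if_neg (by simpa using h), if_neg (by simpa using h), if_neg h]
  · rw [hl j hj, session, session, ← interact_take _ _ hk, List.map_take]
    simp only [List.getD_eq_getElem?_getD, List.getElem?_take_of_lt hj]

/-- A receiver that relays the messages of session `(i, b)` sees the transcript of that session. -/
theorem interact_relay (v : Fin n → Bool) (r : I.sbc.SenderCoins n []) (B : List Data → Data)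
    (hB : ∀ l, 1 ≤ l.length → l.length ≤ I.sbc.rounds → B l =
      ((Data.cons .nil (.ofTranscript (I.relayTranscript S ρ c i b l))).nth l.length).tail.fam i b) :
    interact (I.sbc.send n [] (List.ofFn v) r) B I.sbc.rounds =
      session (I.commitTranscript S (patch ρ i b v) (patch c i b r)) i b := by
  set T := I.commitTranscript S (patch ρ i b v) (patch c i b r) with hT
  have hlen : T.length = I.sbc.rounds := by rw [hT, commitTranscript, length_interact]
  have hlen' : (session T i b).length = I.sbc.rounds := by simpa using hlen
  conv_lhs => rw [← hlen']
  refine interact_unique (fun j hj => ?_) fun j hj => ?_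
  · have hT' := hT.trans (I.commitTranscript_patch S ρ c i b v r)
    clear_value T
    subst hT'
    rw [session_interact_fst, if_pos ⟨rfl, rfl⟩]
  · have hj' : j < I.sbc.rounds := by simpa [hlen] using hj
    set l := ((session T i b).take (j + 1)).map Prod.fst with hl
    have hll : l.length = j + 1 := by simp [hl, hlen]; omega
    rw [hB l (by omega) (by omega), hll, Data.nth, Data.tail_cons, Data.ofTranscript,
      Data.nth_ofList, session_getElem]
    -- After `j + 1` messages of the outer sender the relayed execution is correct in its first `j +
    -- 1` rounds; its later rounds, in which missing messages are read as `nil`, do not matter.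
    have h1 := I.relayTranscript_eq S ρ c i b v r l (j + 1) hj' fun j' hj'' => by
      rw [hl, ← hT]
      simp only [List.getD_eq_getElem?_getD, List.map_take, List.getElem?_take_of_lt hj'',
        List.getElem?_map]
      cases (session T i b)[j']? <;> rfl
    have h2 : j < (I.relayTranscript S ρ c i b l).length := by
      rw [relayTranscript, length_interact]; exact hj'
    have h3 : (I.relayTranscript S ρ c i b l)[j] = T[j]'(by omega) := by
      have h4 := congrArg (fun t => t[j]?) h1
      simp only [List.getElem?_take_of_lt (Nat.lt_succ_self j)] at h4
      rw [List.getElem?_eq_getElem h2, List.getElem?_eq_getElem (by rw [← hT]; omega)] at h4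
      exact Option.some_injective _ h4
    simp [List.getD_eq_getElem?_getD, h2, h3]

end Ingredients

/-! ### The distribution of the random choices -/

section Layout

variable {n m : ℕ}

/-- Position `j` of part `(r, k)` of a tape with `n + 1` rows of eight parts of length `m`. -/
def position (p : Fin (n + 1) × Fin 8 × Fin m) : Fin ((n + 1) * 8 * m) :=
  ⟨(p.1 * 8 + p.2.1) * m + p.2.2, by
    obtain ⟨r, k, j⟩ := p
    have h : r.val * 8 + k + 1 ≤ (n + 1) * 8 := by omega
    have := Nat.mul_le_mul_right m h
    rw [add_mul _ 1 m, one_mul] at this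
    exact lt_of_lt_of_le (Nat.add_lt_add_left j.2 _) this⟩

theorem position_injective : Function.Injective (position (n := n) (m := m)) := by
  rintro ⟨r, k, j⟩ ⟨r', k', j'⟩ h
  have h := congrArg Fin.val h
  simp only [position] at h
  have hm : 0 < m := j.pos
  have e1 := congrArg (· / m) h
  have e2 := congrArg (· % m) h
  simp only [Nat.mul_comm _ m, Nat.mul_add_div hm, Nat.div_eq_of_lt j.2, Nat.div_eq_of_lt j'.2,
    Nat.mul_add_mod, Nat.mod_eq_of_lt j.2, Nat.mod_eq_of_lt j'.2, add_zero] at e1 e2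
  simp only [Prod.mk.injEq, Fin.ext_iff]
  omega

theorem chunk_extend (ω : Fin ((n + 1) * 8 * m) → Bool) (r : Fin (n + 1)) (k : Fin 8) :
    chunk m (extend ω) r k = extend fun j => ω (position (r, k, j)) := by
  funext j
  by_cases hj : j < m
  · have := (position (n := n) (r, k, ⟨j, hj⟩)).2
    simp only [position] at this
    simp only [chunk, extend, if_pos hj, dif_pos hj, dif_pos this]
    rfl
  · simp only [chunk, extend, if_neg hj, dif_neg hj]

theorem extend_castLE {k : ℕ} (h : k ≤ m) (f : Fin m → Bool) (j : Fin k) :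
    extend f j = f (Fin.castLE h j) := by
  rw [extend, dif_pos (j.2.trans_le h)]
  rfl

variable (n m) in
/-- The bits used for the random choices. -/
abbrev ChoiceBits (s k : ℕ) : Type :=
  Fin s ⊕ Fin n ⊕ Unit ⊕ Unit ⊕ Fin n ⊕ (Fin n × Bool × Fin n) ⊕ (Fin n × Bool × Fin k) ⊕
    (Fin n × Bool × Fin m) ⊕ Fin m

/-- The places of the bits on the tape. -/
def place {s k : ℕ} (hs : s ≤ m) (hn : n ≤ m) (h1 : 0 < m) (hk : k ≤ m) :
    ChoiceBits n m s k → Fin (n + 1) × Fin 8 × Fin m :=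
  Sum.elim (fun j => (Fin.last n, 0, Fin.castLE hs j)) <|
  Sum.elim (fun j => (Fin.last n, 1, Fin.castLE hn j)) <|
  Sum.elim (fun _ => (Fin.last n, 2, ⟨0, h1⟩)) <|
  Sum.elim (fun _ => (Fin.last n, 3, ⟨0, h1⟩)) <|
  Sum.elim (fun j => (Fin.last n, 5, Fin.castLE hn j)) <|
  Sum.elim (fun p => (p.1.castSucc, if p.2.1 then 1 else 0, Fin.castLE hn p.2.2)) <|
  Sum.elim (fun p => (p.1.castSucc, if p.2.1 then 3 else 2, Fin.castLE hk p.2.2)) <|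
  Sum.elim (fun p => (p.1.castSucc, if p.2.1 then 5 else 4, p.2.2)) fun j => (Fin.last n, 4, j)

/-- Bits of families lie in the first `n` rows and all others in the last row; within a row
different kinds of bits occupy different parts. -/
theorem place_injective {s k : ℕ} (hs : s ≤ m) (hn : n ≤ m) (h1 : 0 < m) (hk : k ≤ m) :
    Function.Injective (place hs hn h1 hk) := by
  have hl : ∀ i : Fin n, ¬(i.castSucc = Fin.last n) := fun i => Fin.castSucc_ne_last i
  have hl' : ∀ i : Fin n, ¬(Fin.last n = i.castSucc) := fun i => (Fin.castSucc_ne_last i).symm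
  have hb : ∀ (b b' : Bool) (k k' : Fin 8), k ≠ k' →
      (if b then k else k') = (if b' then k else k') → b = b' := by
    intro b b' k k' h
    cases b <;> cases b' <;> simp [h, h.symm]
  have hb' : ∀ (b b' : Bool) (k k' l l' : Fin 8), k ≠ l → k ≠ l' → k' ≠ l → k' ≠ l' →
      ¬ (if b then k else k') = (if b' then l else l') := by
    intro b b' k k' l l' h1 h2 h3 h4
    cases b <;> cases b' <;> simpa
  rintro (j | j | j | j | j | ⟨i, b, j⟩ | ⟨i, b, j⟩ | ⟨i, b, j⟩ | j)
    (j' | j' | j' | j' | j' | ⟨i', b', j'⟩ | ⟨i', b', j'⟩ | ⟨i', b', j'⟩ | j') h <;>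
  simp only [place, Sum.elim_inl, Sum.elim_inr, Prod.mk.injEq, hl, hl', false_and,
    Fin.castSucc_inj, (Fin.castLE_injective _).eq_iff, true_and, reduceCtorEq] at h ⊢
  all_goals first
    | exact (hb' _ _ _ _ _ _ (by decide) (by decide) (by decide) (by decide) h.2.1).elim
    | (obtain ⟨rfl, h, rfl⟩ := h
       rw [hb _ _ _ _ (by decide) h])
    | (exact absurd h.1 (by decide))
    | (rw [h])

end Layout

variable {I : Ingredients} {S : PPT}

/-- The random choices read from a random tape are independent and uniform. -/
theorem expect_choices {n m : ℕ} (hs : S.coins.eval n ≤ m) (hn : n ≤ m) (h1 : 0 < m)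
    (hk : I.sbc.sender.coins.eval (n + ([] : List Bool).length) ≤ m) (F : Choices I S n → ℝ) :
    𝔼 ω : Fin ((n + 1) * 8 * m) → Bool, F (Choices.ofTape I S n m (extend ω)) =
      𝔼 s, 𝔼 v : Fin n → Bool, 𝔼 b, 𝔼 g, 𝔼 u, 𝔼 ρ, 𝔼 c, 𝔼 δ : Fin n → Bool → Fin m → Bool,
        𝔼 τ : Fin m → Bool, F ⟨s, v, b, g, extend τ, u, ρ, c, fun i b => extend (δ i b)⟩ := by
  let K := I.sbc.sender.coins.eval (n + ([] : List Bool).length)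
  let mk : (ChoiceBits n m (S.coins.eval n) K → Bool) → Choices I S n := fun w =>
    { coins := fun j => w (.inl j)
      digits := fun j => w (.inr (.inl j))
      bit := w (.inr (.inr (.inl ())))
      guess := w (.inr (.inr (.inr (.inl ()))))
      mask := fun j => w (.inr (.inr (.inr (.inr (.inl j)))))
      ρ := fun i b j => w (.inr (.inr (.inr (.inr (.inr (.inl (i, b, j)))))))
      c := fun i b j => w (.inr (.inr (.inr (.inr (.inr (.inr (.inl (i, b, j))))))))
      δ := fun i b => extend fun j => w (.inr (.inr (.inr (.inr (.inr (.inr (.inr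
        (.inl (i, b, j)))))))))
      proofTape := extend fun j => w (.inr (.inr (.inr (.inr (.inr (.inr (.inr (.inr j)))))))) }
  -- The choices depend only on the bits at the chosen places, and these places are distinct.
  have hmk : ∀ ω : Fin ((n + 1) * 8 * m) → Bool,
      Choices.ofTape I S n m (extend ω) = mk (ω ∘ position ∘ place hs hn h1 hk) := by
    intro ω
    have e1 : ∀ k : Fin 8, chunk m (extend ω) n k = extend fun j => ω (position (Fin.last n, k, j)) :=
      fun k => chunk_extend ω (Fin.last n) k
    have e2 : ∀ (i : Fin n) (b : Bool) (k k' : Fin 8), chunk m (extend ω) i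
        (if b then (k : ℕ) else k') = extend fun j => ω (position (i.castSucc, if b then k else k', j)) := by
      intro i b k k'
      rw [← chunk_extend]
      cases b <;> rfl
    have e0 : ∀ f : Fin m → Bool, extend f 0 = f ⟨0, h1⟩ := fun f => dif_pos h1
    have e10 := e1 0; have e11 := e1 1; have e12 := e1 2; have e13 := e1 3; have e14 := e1 4
    have e15 := e1 5
    have e20 := fun i b => e2 i b 1 0; have e21 := fun i b => e2 i b 3 2
    have e22 := fun i b => e2 i b 5 4
    simp only [Fin.isValue, Fin.coe_ofNat_eq_mod,
      Nat.reduceMod] at e10 e11 e12 e13 e14 e15 e20 e21 e22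
    simp only [Choices.ofTape, e10, e11, e12, e13, e14, e15, e20, e21, e22, e0,
      extend_castLE hs, extend_castLE hn, extend_castLE hk, mk]
    rfl
  simp only [hmk]
  rw [expect_comp_injective (position ∘ place hs hn h1 hk)
    (position_injective.comp (place_injective hs hn h1 hk)) fun w => F (mk w)]
  -- The summands of `ChoiceBits` are in the order of the averages on the right, so they can be
  -- split off one after the other.
  rw [expect_sum_arrow]
  refine Finset.expect_congr rfl fun s _ => ?_
  rw [expect_sum_arrow]
  refine Finset.expect_congr rfl fun v _ => ?_
  rw [expect_sum_arrow, ← expect_unit_arrow]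
  refine Finset.expect_congr rfl fun b _ => ?_
  rw [expect_sum_arrow, ← expect_unit_arrow]
  refine Finset.expect_congr rfl fun g _ => ?_
  rw [expect_sum_arrow]
  refine Finset.expect_congr rfl fun u _ => ?_
  rw [expect_sum_arrow, ← expect_curry₃]
  refine Finset.expect_congr rfl fun ρ _ => ?_
  rw [expect_sum_arrow, ← expect_curry₃ (m := K)]
  refine Finset.expect_congr rfl fun c _ => ?_
  rw [expect_sum_arrow, ← expect_curry₃]
  rfl

/-! ### Lengths -/

theorem Data.size_ofFam_le {n B : ℕ} {f : Fin n → Bool → Data} (h : ∀ i b, (f i b).size ≤ B) :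
    (Data.ofFam f).size ≤ n * (2 * B + 2) + 1 := by
  rw [Data.ofFam, Data.size_ofList, List.map_ofFn, List.sum_ofFn]
  refine Nat.add_le_add_right ((Finset.sum_le_card_nsmul _ _ (2 * B + 2) fun i _ => ?_).trans ?_) 1
  · have := h i false
    have := h i true
    simp [Data.size]; omega
  · simp

theorem Data.size_bits_ofFn {k : ℕ} (f : Fin k → Bool) :
    (Data.ofBits (List.ofFn f)).size = 6 * k + 1 := by simp [Data.size_ofBits]

@[simp] theorem Data.bit_nth_bits {k : ℕ} (f : Fin k → Bool) (j : ℕ) :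
    ((Data.ofBits (List.ofFn f)).nth j).toBit = extend f j := by
  rw [Data.ofBits, Data.nth_ofList, extend]
  by_cases h : j < k <;> simp [h]

@[simp] theorem Data.toBits_bits {k : ℕ} (f : Fin k → Bool) :
    (Data.ofBits (List.ofFn f)).toBits k = f := by
  funext j
  rw [Data.toBits, Data.bit_nth_bits, extend, dif_pos j.2]

/-- The coins that determine the coin tossing. -/
abbrev TossCoins (I : Ingredients) (S : PPT) : Type :=
  Σ n, S.Coins n × (Fin n → Bool → Fin n → Bool) × (Fin n → Bool → I.sbc.SenderCoins n [])

def TossCoins.enc {I : Ingredients} {S : PPT} (p : TossCoins I S) : Data :=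
  .cons (.unary p.1) (.cons (.ofBits (List.ofFn p.2.1))
    (.cons (.ofFam fun i b => .ofBits (List.ofFn (p.2.2.1 i b)))
      (.ofFam fun i b => .ofBits (List.ofFn (p.2.2.2 i b)))))

section

variable {P : PromiseProblem} {I : Ingredients} {S : PPT}

/-- Encodings of the coins have polynomial length in `n`, hence so has all that is computed from
them. The security definitions ask for such a bound on statements, witnesses and auxiliary inputs.
-/
theorem Eff.size_le_tossCoins {g : TossCoins I S → Data} (hg : Eff TossCoins.enc g) :
    ∃ p : Polynomial ℕ, ∀ n s ρ c, (g ⟨n, s, ρ, c⟩).size ≤ p.eval n := by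
  obtain ⟨p, hp⟩ := hg.size_le
  let K := I.sbc.sender.coins
  let q : Polynomial ℕ := 2 * .X + 1 + (6 * S.coins + 1) + (.X * (2 * (6 * .X + 1) + 2) + 1) +
    (.X * (2 * (6 * K + 1) + 2) + 1) + 3
  refine ⟨p.comp q, fun n s ρ c => (hp _).trans ?_⟩
  rw [Polynomial.eval_comp]
  refine p.eval_mono_nat ?_
  have h1 := Data.size_ofFam_le (f := fun i b => Data.ofBits (List.ofFn (ρ i b)))
    fun i b => (Data.size_bits_ofFn (ρ i b)).le
  have h2 := Data.size_ofFam_le (f := fun i b => Data.ofBits (List.ofFn (c i b)))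
    fun i b => (Data.size_bits_ofFn (c i b)).le
  simp only [TossCoins.enc, Data.size, Data.size_unary, Data.size_bits_ofFn, q, K,
    Polynomial.eval_add, Polynomial.eval_mul, Polynomial.eval_X, Polynomial.eval_ofNat,
    Polynomial.eval_one, List.length_nil, add_zero] at *
  omega

theorem effTossCoins_n : Eff TossCoins.enc fun p : TossCoins I S => .unary p.1 := (Eff.refl _).fst

theorem effTossCoins_strategy :
    Eff.Strat TossCoins.enc fun p : TossCoins I S => S.next (.unary p.1) p.2.1 :=
  Eff.next S effTossCoins_n (Eff.refl (TossCoins.enc (I := I) (S := S))).tail.head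

theorem effTossCoins_ρ : Eff (Eff.ctxFam TossCoins.enc fun p : TossCoins I S => p.1)
    fun p => .ofBits (List.ofFn (p.1.2.2.1 p.2.1 p.2.2)) :=
  ((Eff.refl (TossCoins.enc (I := I) (S := S))).tail.tail.head.liftFam.fam
    (n := fun p : Σ a : TossCoins I S, Fin a.1 × Bool => p.1.1)
    Eff.ctxFam_index Eff.ctxFam_bit).of_eq fun p => by simp [TossCoins.enc]

theorem effTossCoins_c : Eff (Eff.ctxFam TossCoins.enc fun p : TossCoins I S => p.1)
    fun p => .ofBits (List.ofFn (p.1.2.2.2 p.2.1 p.2.2)) :=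
  ((Eff.refl (TossCoins.enc (I := I) (S := S))).tail.tail.tail.liftFam.fam
    (n := fun p : Σ a : TossCoins I S, Fin a.1 × Bool => p.1.1)
    Eff.ctxFam_index Eff.ctxFam_bit).of_eq fun p => by simp [TossCoins.enc]

theorem effTossCoins_transcript : Eff TossCoins.enc fun p : TossCoins I S =>
    .ofTranscript (I.commitTranscript (S.next (.unary p.1) p.2.1) p.2.2.1 p.2.2.2) :=
  Eff.commitTranscript I effTossCoins_n effTossCoins_strategy effTossCoins_ρ effTossCoins_c

theorem effTossCoins_instances (hgen : IsSampler P I.gen) :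
    Eff (Eff.ctxFam TossCoins.enc fun p : TossCoins I S => p.1) fun p =>
      .ofBits (I.instances (S.next (.unary p.1.1) p.1.2.1) (I.commitTranscript
        (S.next (.unary p.1.1) p.1.2.1) p.1.2.2.1 p.1.2.2.2) p.1.2.2.1 p.2.1 p.2.2) :=
  Eff.instances I (n := fun p : TossCoins I S => p.1)
    (S := fun p => S.next (.unary p.1) p.2.1)
    (t := fun p => I.commitTranscript (S.next (.unary p.1) p.2.1) p.2.2.1 p.2.2.2)
    (ρ := fun p => p.2.2.1) hgen effTossCoins_n effTossCoins_strategy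
    effTossCoins_transcript effTossCoins_ρ

variable (I S)

/-- The sender's strategy, given its coins. -/
abbrev strategyOf {S : PPT} {n : ℕ} (s : S.Coins n) : List Data → Data := S.next (.unary n) s

/-- The transcript of the coin tossing. -/
abbrev tossOf {S : PPT} {n : ℕ} (s : S.Coins n) (ρ : Fin n → Bool → Fin n → Bool)
    (c : Fin n → Bool → I.sbc.SenderCoins n []) : List (Data × Data) :=
  I.commitTranscript (strategyOf s) ρ c

/-- The instances in an honest execution. -/
abbrev instancesOf {S : PPT} {n : ℕ} (s : S.Coins n) (ρ : Fin n → Bool → Fin n → Bool)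
    (c : Fin n → Bool → I.sbc.SenderCoins n []) : Fin n → Bool → List Bool :=
  I.instances (strategyOf s) (tossOf I s ρ c) ρ

/-- The statement proved in an honest execution. -/
abbrev statementOf {S : PPT} {n : ℕ} (s : S.Coins n) (ρ : Fin n → Bool → Fin n → Bool)
    (c : Fin n → Bool → I.sbc.SenderCoins n []) : Data :=
  Ingredients.provenStatement (strategyOf s) (tossOf I s ρ c) (instancesOf I s ρ c)

theorem effTossCoins_statement {P : PromiseProblem} {I : Ingredients} {S : PPT}
    (hgen : IsSampler P I.gen) : Eff TossCoins.enc fun p : TossCoins I S =>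
      statementOf I p.2.1 p.2.2.1 p.2.2.2 :=
  Eff.provenStatement (S := fun p : TossCoins I S => strategyOf p.2.1)
    (t := fun p => tossOf I p.2.1 p.2.2.1 p.2.2.2)
    (x := fun p => instancesOf I p.2.1 p.2.2.1 p.2.2.2) effTossCoins_n
    effTossCoins_strategy effTossCoins_transcript (effTossCoins_instances hgen)

/-- Tapes of length `m` are long enough for all parties. -/
structure Adequate (n m : ℕ) : Prop where
  coins : S.coins.eval n ≤ m
  size : n ≤ m
  pos : 0 < m
  sbc : I.sbc.sender.coins.eval (n + ([] : List Bool).length) ≤ m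
  proof : ∀ (s : S.Coins n) ρ c, I.wi.prover.coins.eval (n + (statementOf I s ρ c).size) ≤ m
  receiver : ∀ v : Fin n → Bool, I.idc.receiver.coins.eval (n + (I.gen (List.ofFn v)).length) ≤ m

theorem length_gen_le {P : PromiseProblem} {I : Ingredients} (hgen : IsSampler P I.gen) :
    ∃ p : Polynomial ℕ, ∀ n, ∀ v : Fin n → Bool, (I.gen (List.ofFn v)).length ≤ p.eval n := by
  obtain ⟨p, hp⟩ := (Eff.gen I hgen (Eff.refl Data.ofBits)).size_le
  refine ⟨p.comp (6 * .X + 1), fun n v => ?_⟩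
  have := hp (List.ofFn v)
  rw [Data.size_ofBits, Data.size_bits_ofFn] at this
  simp only [Polynomial.eval_comp, Polynomial.eval_add, Polynomial.eval_mul, Polynomial.eval_X,
    Polynomial.eval_ofNat, Polynomial.eval_one]
  omega

/-- Lengths of statements and instances are bounded by polynomials in `n`; composing these with the
monotone coin polynomials gives one tape length for all parties. -/
theorem exists_adequate {P : PromiseProblem} {I : Ingredients} (hgen : IsSampler P I.gen)
    (S : PPT) : ∃ M : Polynomial ℕ, ∀ n, Adequate I S n (M.eval n) := by
  obtain ⟨p, hp⟩ := length_gen_le hgen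
  obtain ⟨q, hq⟩ := Eff.size_le_tossCoins (effTossCoins_statement (S := S) hgen)
  refine ⟨S.coins + .X + 1 + I.sbc.sender.coins + I.wi.prover.coins.comp (.X + q) +
    I.idc.receiver.coins.comp (.X + p), fun n => ?_⟩
  simp only [Polynomial.eval_add, Polynomial.eval_comp, Polynomial.eval_X, Polynomial.eval_one]
  constructor
  · omega
  · omega
  · omega
  · simp only [List.length_nil, add_zero]; omega
  · intro s ρ c
    have := I.wi.prover.coins.eval_mono_nat (Nat.add_le_add_left (hq n s ρ c) n)
    simp only at this
    refine this.trans ?_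
    omega
  · intro v
    have := I.idc.receiver.coins.eval_mono_nat (Nat.add_le_add_left (hp n v) n)
    omega

/-! ### The sender breaks binding only if it equivocates -/

/-- The probability that the sender equivocates in session `(i, b)` of an execution with witness
bit `β`. -/
noncomputable def equivocationProb {n : ℕ} (m : ℕ) (β : Bool) (i : Fin n) (b : Bool) : ℝ :=
  𝔼 s : S.Coins n, 𝔼 ρ, 𝔼 c, 𝔼 δ : Fin n → Bool → Fin m → Bool, 𝔼 τ : Fin m → Bool,
    ind (I.equivocatesAfterRead (strategyOf s) (tossOf I s ρ c) (instancesOf I s ρ c)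
      (I.bitWitness ρ c β) (extend τ) (fun i b => extend (δ i b)) i b = true)

variable {I S}

/-- Families of bits with different exclusive ors differ somewhere, and at such a place the two
decommitments open the same session to different bits. -/
theorem equivocates_of_opens {n : ℕ} {A : List Data → Data} {h : List Data}
    {x : Fin n → Bool → List Bool} {d : (i : Fin n) → (b : Bool) → I.idc.ReceiverCoins n (x i b)}
    {o : Ingredients.Outcome n}
    (ho : o = ⟨x, session (I.bindingTranscript A h x d),
      A (h ++ (I.bindingTranscript A h x d).map Prod.snd)⟩)
    (h0 : I.Opens o o.output.head false) (h1 : I.Opens o o.output.tail true) :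
    ∃ i b, I.equivocates A h x d i b = true := by
  subst ho
  obtain ⟨μ, r, hD, hop, hx⟩ := h0
  obtain ⟨μ', r', hD', hop', hx'⟩ := h1
  have : ∃ i b, μ i b ≠ μ' i b := by
    by_contra! hne
    rw [show μ = μ' from funext fun i => funext fun b => hne i b, hx'] at hx
    exact Bool.noConfusion hx
  obtain ⟨i, b, hib⟩ := this
  refine ⟨i, b, ?_⟩
  have e1 := hop i b
  have e2 := hop' i b
  simp only at hD hD' e1 e2
  simp only [Ingredients.equivocates, CommitmentScheme.opensTwice, hD, hD', Data.fam_ofFam,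
    Data.head_cons, Data.tail_cons, Data.toBit_ofBit, Bool.and_eq_true,
    CommitmentScheme.replays_iff]
  refine ⟨by simpa using hib, ?_, ?_⟩
  · rwa [Data.toBits_bits]
  · rwa [Data.toBits_bits]

theorem ind_exists_le {n : ℕ} (p : Fin n → Bool → Prop) :
    ind (∃ i b, p i b) ≤ ∑ i, ∑ b, ind (p i b) := by
  by_cases h : ∃ i b, p i b
  · obtain ⟨i, b, hib⟩ := h
    rw [ind_true ⟨i, b, hib⟩, ← ind_true hib]
    refine (Finset.single_le_sum (f := fun b => ind (p i b)) (fun b _ => ind_nonneg _)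
      (Finset.mem_univ b)).trans ?_
    exact Finset.single_le_sum (f := fun i => ∑ b, ind (p i b))
      (fun i _ => Finset.sum_nonneg fun b _ => ind_nonneg _) (Finset.mem_univ i)
  · rw [ind_false h]
    exact Finset.sum_nonneg fun i _ => Finset.sum_nonneg fun b _ => ind_nonneg _

/-- The outcome of the commit phase with the given coins. -/
def outcomeOf {n : ℕ} (s : S.Coins n) (ρ : Fin n → Bool → Fin n → Bool)
    (c : Fin n → Bool → I.sbc.SenderCoins n []) (r : I.wi.ProverCoins n (statementOf I s ρ c))
    (d : ∀ i b, I.idc.ReceiverCoins n (instancesOf I s ρ c i b)) : Ingredients.Outcome n :=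
  let h := Ingredients.history (tossOf I s ρ c) (instancesOf I s ρ c)
  let h' := h ++ (I.proofTranscript n (strategyOf s) h (statementOf I s ρ c)
    (I.bitWitness ρ c false) r).map Prod.fst ++ [.nil]
  let t := I.bindingTranscript (strategyOf s) h' (instancesOf I s ρ c) d
  ⟨instancesOf I s ρ c, session t, strategyOf s (h' ++ t.map Prod.snd)⟩

/-- The stages with explicit coins unfold to those of `commitPhase`, so only the random choices have
to be turned into averages. -/
theorem breakProb_eq (n : ℕ) : I.breakProb S n = 𝔼 s : S.Coins n,
    𝔼 ρ : Fin n → Bool → Fin n → Bool, 𝔼 c : Fin n → Bool → I.sbc.SenderCoins n [],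
    𝔼 r : I.wi.ProverCoins n (statementOf I s ρ c),
    𝔼 d : (∀ i b, I.idc.ReceiverCoins n (instancesOf I s ρ c i b)),
    ind (outcomeOf (I := I) s ρ c r d ∈ {o : Ingredients.Outcome n | I.Opens o o.output.head false ∧
      I.Opens o o.output.tail true}) := by
  refine (Pr_bind _ _).trans (Finset.expect_congr rfl fun s _ => ?_)
  refine (Pr_bind _ _).trans (Finset.expect_congr rfl fun ρ _ => ?_)
  refine (Pr_bind _ _).trans (Finset.expect_congr rfl fun c _ => ?_)
  refine (Pr_bind _ _).trans (Finset.expect_congr rfl fun r _ => ?_)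
  refine (Pr_bind _ _).trans (Finset.expect_congr rfl fun d _ => ?_)
  exact Pr_pure _ _

/-- The numbers of these coins depend on the instances; here they are traded for tapes of the common
length `m`. -/
theorem expect_execution {n m : ℕ} (hm : Adequate I S n m) (s : S.Coins n)
    (ρ : Fin n → Bool → Fin n → Bool) (c : Fin n → Bool → I.sbc.SenderCoins n [])
    (F : I.wi.ProverCoins n (statementOf I s ρ c) →
      (∀ i b, I.idc.ReceiverCoins n (instancesOf I s ρ c i b)) → ℝ) :
    𝔼 r, 𝔼 d, F r d = 𝔼 δ : Fin n → Bool → Fin m → Bool, 𝔼 τ : Fin m → Bool,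
      F (fun j => extend τ j) (fun i b j => extend (δ i b) j) := by
  rw [Finset.expect_comm]
  refine (expect_read_fam (m := m) (fun i b => hm.receiver _) fun d => 𝔼 r, F r d).symm.trans ?_
  refine Finset.expect_congr rfl fun δ _ => ?_
  exact (expect_read (hm.proof s ρ c) fun r => F r _).symm

theorem breakProb_le {n m : ℕ} (hm : Adequate I S n m) :
    I.breakProb S n ≤ ∑ i : Fin n, ∑ b, equivocationProb I S m false i b := by
  rw [breakProb_eq]
  simp only [equivocationProb, ← Finset.expect_sum_comm]
  refine expect_mono fun s => expect_mono fun ρ => expect_mono fun c => ?_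
  refine (expect_execution hm s ρ c _).le.trans ?_
  refine expect_mono fun δ => expect_mono fun τ => ?_
  refine le_trans (ind_mono fun h => ?_) (ind_exists_le _)
  exact equivocates_of_opens rfl h.1 h.2

end

/-! ### Exchanging the witness -/

section

variable {P : PromiseProblem} {I : Ingredients} {S : PPT}

variable (I S) in
/-- `equivocationVerifier` as an algorithm. -/
noncomputable def verifierAlgorithm : PPT := ⟨_, polyTime_equivocationVerifier (I := I) S, 0⟩

/-- The auxiliary input of `equivocationVerifier`. -/
def verifierInput {n m : ℕ} (s : S.Coins n) (h : List Data) (x : Fin n → Bool → List Bool)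
    (δ : Fin n → Bool → Fin m → Bool) (i : Fin n) (b : Bool) : Data :=
  .cons (.ofBits (List.ofFn s)) (.cons (.ofList h) (.cons (.ofFam fun i b => .ofBits (x i b))
    (.cons (.ofFam fun i b => .ofBits (List.ofFn (δ i b))) (.cons (.unary i) (.ofBit b)))))

theorem verifierAlgorithm_next {n k : ℕ} (s z : Data) (v : (verifierAlgorithm I S).Coins k) :
    (verifierAlgorithm I S).next (.cons (.unary n) (.cons s z)) v =
      equivocationVerifier I S n z := by
  funext l
  simp [PPT.next, verifierAlgorithm]

theorem equivocationVerifier_input {n m : ℕ} (s : S.Coins n) (h : List Data)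
    (x : Fin n → Bool → List Bool) (δ : Fin n → Bool → Fin m → Bool) (i : Fin n) (b : Bool)
    (l : List Data) : equivocationVerifier I S n (verifierInput s h x δ i b) l =
      if l.length = I.wi.rounds + 1 then .verdict (I.equivocatesRead (strategyOf s) (h ++ l) x
        (fun i b => extend (δ i b)) i b) else strategyOf s (h ++ l) := by
  have hi : (⟨i % n, Nat.mod_lt _ i.pos⟩ : Fin n) = i := Fin.ext (Nat.mod_eq_of_lt i.2)
  simp [equivocationVerifier, verifierInput, i.pos, hi]

/-- All coins except those of the prover are fixed, inside the statement, the witness and the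
auxiliary input. The verifier acts as the sender up to its last activation, where it reports
equivocation. -/
theorem outputProb_verifier {n m : ℕ} (hm : Adequate I S n m) (s : S.Coins n)
    (ρ : Fin n → Bool → Fin n → Bool) (c : Fin n → Bool → I.sbc.SenderCoins n [])
    (δ : Fin n → Bool → Fin m → Bool) (w : Data) (i : Fin n) (b : Bool) :
    I.wi.outputProb (verifierAlgorithm I S) n (statementOf I s ρ c) w
      (verifierInput s (Ingredients.history (tossOf I s ρ c) (instancesOf I s ρ c))
        (instancesOf I s ρ c) δ i b) = 𝔼 τ : Fin m → Bool,
      ind (I.equivocatesAfterRead (strategyOf s) (tossOf I s ρ c) (instancesOf I s ρ c)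
        w (extend τ) (fun i b => extend (δ i b)) i b = true) := by
  refine Eq.trans ?_ (expect_read (hm.proof s ρ c) fun r : I.wi.ProverCoins n (statementOf I s ρ c) =>
    ind (I.equivocatesAfter (strategyOf s) (tossOf I s ρ c) (instancesOf I s ρ c) w r
      (fun i b j => extend (δ i b) j) i b = true)).symm
  refine (Pr_bind _ _).trans (Finset.expect_congr rfl fun r _ => ?_)
  refine (Pr_bind _ _).trans ((Finset.expect_congr rfl fun v _ => Pr_pure _ _).trans ?_)
  simp only [verifierAlgorithm_next]
  rw [Fintype.expect_const, interact_congr (fun _ _ => rfl) fun l _ hl =>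
    (equivocationVerifier_input s _ _ δ i b l).trans (if_neg (by omega)),
    equivocationVerifier_input, if_pos (by simp)]
  simp only [Set.mem_ofPred_eq, Data.verdict_ne_nil, ← List.append_assoc]
  rfl

theorem exists_size_bound (hgen : IsSampler P I.gen) (M : Polynomial ℕ) :
    ∃ p : Polynomial ℕ, ∀ n, ∀ (s : S.Coins n) (ρ : Fin n → Bool → Fin n → Bool)
      (c : Fin n → Bool → I.sbc.SenderCoins n []), (statementOf I s ρ c).size ≤ p.eval n ∧
      (∀ β, (I.bitWitness ρ c β).size ≤ p.eval n) ∧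
      ∀ (δ : Fin n → Bool → Fin (M.eval n) → Bool) i b, (verifierInput s (Ingredients.history
        (tossOf I s ρ c) (instancesOf I s ρ c)) (instancesOf I s ρ c) δ i b).size ≤ p.eval n := by
  obtain ⟨p₁, h₁⟩ := Eff.size_le_tossCoins (effTossCoins_statement (S := S) hgen)
  have hw := fun β => Eff.size_le_tossCoins (Eff.bitWitness I (n := fun p : TossCoins I S => p.1)
    (ρ := fun p => p.2.2.1) (c := fun p => p.2.2.2) (b := fun _ => β) effTossCoins_n effTossCoins_ρ effTossCoins_c (.const (.ofBit β)))
  obtain ⟨p₂, h₂⟩ := hw false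
  obtain ⟨p₃, h₃⟩ := hw true
  obtain ⟨p₄, h₄⟩ := Eff.size_le_tossCoins (Eff.history (t := fun p => tossOf I p.2.1 p.2.2.1 p.2.2.2)
    (x := fun p => instancesOf I p.2.1 p.2.2.1 p.2.2.2) effTossCoins_n
    effTossCoins_transcript (effTossCoins_instances (S := S) hgen))
  obtain ⟨p₅, h₅⟩ := Eff.size_le_tossCoins (effTossCoins_n.ofFam (φ := fun p i b =>
    .ofBits (instancesOf I p.2.1 p.2.2.1 p.2.2.2 i b)) (effTossCoins_instances (S := S) hgen))
  refine ⟨p₁ + p₂ + p₃ + p₄ + p₅ + 6 * S.coins + .X * (2 * (6 * M + 1) + 2) + 2 * .X + 20,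
    fun n s ρ c => ?_⟩
  simp only [Polynomial.eval_add, Polynomial.eval_mul, Polynomial.eval_X, Polynomial.eval_ofNat,
    Polynomial.eval_one]
  refine ⟨(h₁ n s ρ c).trans (by omega), ?_, fun δ i b => ?_⟩
  · rintro (_ | _)
    · exact (h₂ n s ρ c).trans (by omega)
    · exact (h₃ n s ρ c).trans (by omega)
  · have h₆ := Data.size_ofFam_le (f := fun i b => Data.ofBits (List.ofFn (δ i b)))
      fun i b => (Data.size_bits_ofFn (δ i b)).le
    have h₇ := h₄ n s ρ c
    have h₈ := h₅ n s ρ c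
    have h₉ : (Data.ofBit b).size = 5 := by cases b <;> rfl
    have := i.2
    simp only [verifierInput, Data.size, Data.size_bits_ofFn, Data.size_unary, h₉]
    simp only at h₇ h₈
    omega

/-- The receiver prepares both halves `β = 0` and `β = 1` honestly, so both witnesses are valid for
the statement, whatever the sender does. -/
theorem consistent_bitWitness {n : ℕ} (s : S.Coins n) (ρ : Fin n → Bool → Fin n → Bool)
    (c : Fin n → Bool → I.sbc.SenderCoins n []) (β : Bool) :
    I.consistent n (statementOf I s ρ c) (I.bitWitness ρ c β) :=
  ⟨_, _, _, β, _, _, rfl, rfl, fun i =>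
    ⟨I.sbc.opens_session [] (fun i b => List.ofFn (ρ i b)) c (strategyOf s) i β, rfl⟩⟩

/-- Witness indistinguishability is uniform over statements, witnesses and auxiliary inputs, so it
holds with one bound for every choice of the other coins and survives averaging over them. -/
theorem exists_equivocationProb_sub_le (hgen : IsSampler P I.gen)
    (hwi : I.wi.IsWIProof I.consistent) {M : Polynomial ℕ}
    (hM : ∀ n, Adequate I S n (M.eval n)) : ∃ ν, Negligible ν ∧ ∀ n i b,
      |equivocationProb I S (n := n) (M.eval n) false i b -
        equivocationProb I S (M.eval n) true i b| ≤ ν n := by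
  obtain ⟨p, hp⟩ := exists_size_bound (S := S) hgen M
  obtain ⟨ν, hν, h⟩ := hwi.indistinguishable p (verifierAlgorithm I S)
  refine ⟨ν, hν, fun n i b => ?_⟩
  refine abs_expect_sub_le fun s => abs_expect_sub_le fun ρ => abs_expect_sub_le fun c =>
    abs_expect_sub_le fun δ => ?_
  rw [← outputProb_verifier (hM n), ← outputProb_verifier (hM n)]
  obtain ⟨h₁, h₂, h₃⟩ := hp n s ρ c
  exact h n _ _ _ _ h₁ (h₂ _) (h₂ _) (h₃ δ i b) (consistent_bitWitness s ρ c _)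
    (consistent_bitWitness s ρ c _)

end

/-! ### Hiding the target -/

theorem expect_extend_congr {k k' : ℕ} (h : k = k') (G : (ℕ → Bool) → ℝ) :
    𝔼 a : Fin k → Bool, G (extend a) = 𝔼 a : Fin k' → Bool, G (extend a) := by
  subst h; rfl

/-- The index with the given digits. -/
def indexOf {n : ℕ} (hn : 0 < n) (v : Fin n → Bool) : Fin n :=
  ⟨hornerMod n (List.ofFn v), hornerMod_lt hn _⟩

section

variable {A B C D : Type} [Fintype A] [Fintype B] [Fintype C] [Fintype D]

theorem expect_rotate₃ (X : A → B → C → ℝ) :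
    𝔼 a, 𝔼 b, 𝔼 c, X a b c = 𝔼 c, 𝔼 a, 𝔼 b, X a b c :=
  (Finset.expect_congr rfl fun _ _ => Finset.expect_comm _ _ _).trans (Finset.expect_comm _ _ _)

theorem expect_rotate₄ (X : A → B → C → D → ℝ) :
    𝔼 a, 𝔼 b, 𝔼 c, 𝔼 d, X a b c d = 𝔼 d, 𝔼 a, 𝔼 b, 𝔼 c, X a b c d :=
  (Finset.expect_congr rfl fun _ _ => expect_rotate₃ _).trans (Finset.expect_comm _ _ _)

variable {α β : Type} [Fintype α] [Fintype β] [DecidableEq α] [DecidableEq β] [Nonempty α]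
  [Nonempty β] {n : ℕ} (i : Fin n) (b : Bool)

theorem expect_patch_right (X : (Fin n → Bool → β) → C → D → ℝ) :
    𝔼 c, 𝔼 δ, 𝔼 τ, 𝔼 r, X (patch c i b r) δ τ = 𝔼 c, 𝔼 δ, 𝔼 τ, X c δ τ :=
  (Finset.expect_congr rfl fun _ _ => expect_rotate₃ _).trans
    (expect_patch i b fun c => 𝔼 δ, 𝔼 τ, X c δ τ)

/-- The fresh values `u` and `r` are moved next to the families whose members they replace, where
`expect_patch` absorbs them. -/
theorem expect_patch_both (X : (Fin n → Bool → α) → (Fin n → Bool → β) → C → D → ℝ) :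
    𝔼 u, 𝔼 ρ, 𝔼 c, 𝔼 δ, 𝔼 τ, 𝔼 r, X (patch ρ i b u) (patch c i b r) δ τ =
      𝔼 ρ, 𝔼 c, 𝔼 δ, 𝔼 τ, X ρ c δ τ :=
  (Finset.expect_comm _ _ _).trans <|
    (Finset.expect_congr rfl fun ρ _ => Finset.expect_congr rfl fun u _ =>
      expect_patch_right i b (X (patch ρ i b u))).trans
    (expect_patch i b fun ρ => 𝔼 c, 𝔼 δ, 𝔼 τ, X ρ c δ τ)

/-- Here only the coins are resampled; `u` stays free and ends up innermost, to be averaged with all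
the rest fixed. -/
theorem expect_rotate_patch (X : A → B → (Fin n → Bool → β) → C → D → ℝ) :
    𝔼 u, 𝔼 ρ, 𝔼 c, 𝔼 δ, 𝔼 τ, 𝔼 r, X u ρ (patch c i b r) δ τ =
      𝔼 ρ, 𝔼 c, 𝔼 δ, 𝔼 τ, 𝔼 u, X u ρ c δ τ :=
  (Finset.expect_comm _ _ _).trans <| Finset.expect_congr rfl fun ρ _ =>
    (Finset.expect_congr rfl fun u _ => expect_patch_right i b (X u ρ)).trans
      (expect_rotate₄ fun c δ τ u => X u ρ c δ τ).symm

end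

section

variable {P : PromiseProblem} {I : Ingredients} {S : PPT}

variable (I S) in
/-- The probability that the sender equivocates in session `(i, b)` if this instance is sampled
independently. -/
noncomputable def independentProb {n : ℕ} (m : ℕ) (i : Fin n) (b : Bool) : ℝ :=
  𝔼 s : S.Coins n, 𝔼 ρ, 𝔼 c, 𝔼 δ : Fin n → Bool → Fin m → Bool, 𝔼 τ : Fin m → Bool,
    𝔼 y : Fin n → Bool, ind (I.equivocatesOn (strategyOf s) (tossOf I s ρ c) ρ c (extend τ)
      (fun i b => extend (δ i b)) i b (I.gen (List.ofFn y)) = true)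

/-- Once the transcript `t` is given, the test ignores the string and the coins of the target: its
instance is overwritten by `y` and the witness is for `!b`. This lets an adversary who sees only the
transcript of the target session run the test. -/
theorem equivocatesOn_patch {n : ℕ} (s : List Data → Data) (t : List (Data × Data))
    (ρ : Fin n → Bool → Fin n → Bool) (c : Fin n → Bool → I.sbc.SenderCoins n [])
    (τ : ℕ → Bool) (δ : Fin n → Bool → ℕ → Bool) (i : Fin n) (b : Bool) (y : List Bool)
    (v : Fin n → Bool) (r : I.sbc.SenderCoins n []) :
    I.equivocatesOn s t (patch ρ i b v) (patch c i b r) τ δ i b y =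
      I.equivocatesOn s t ρ c τ δ i b y := by
  have h1 : patch (I.instances s t (patch ρ i b v)) i b y = patch (I.instances s t ρ) i b y := by
    funext i' b'
    by_cases h : i' = i ∧ b' = b
    · simp [patch, h]
    · simp [patch, h, Ingredients.instances]
  have h2 : I.bitWitness (patch ρ i b v) (patch c i b r) (!b) = I.bitWitness ρ c (!b) := by
    simp [Ingredients.bitWitness, patch]
  rw [Ingredients.equivocatesOn, Ingredients.equivocatesOn, h1, h2]

theorem equivocatesOn_instance {n : ℕ} (s : List Data → Data) (t : List (Data × Data))
    (ρ : Fin n → Bool → Fin n → Bool) (c : Fin n → Bool → I.sbc.SenderCoins n [])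
    (τ : ℕ → Bool) (δ : Fin n → Bool → ℕ → Bool) (i : Fin n) (b : Bool) :
    I.equivocatesOn s t ρ c τ δ i b
      (I.gen (List.ofFn (xorBits (ρ i b) (Ingredients.tossed n s t i b)))) =
      I.equivocatesAfterRead s t (I.instances s t ρ) (I.bitWitness ρ c (!b)) τ δ i b := by
  rw [Ingredients.equivocatesOn]
  congr 1
  exact patch_self (I.instances s t ρ) i b

theorem Choices.attack_nil {n : ℕ} (ch : Choices I S n) (hn : 0 < n) : ch.attack [] =
    .cons (.ofBits (List.ofFn ch.mask)) (.ofBits (List.ofFn (ch.ρ (ch.index hn) ch.bit))) := by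
  simp [attack, hn]

/-- The outcome of an attack on a commitment to `v`. -/
theorem Choices.attack_outcome {n : ℕ} (ch : Choices I S n) (hn : 0 < n) (v : Fin n → Bool)
    (r : I.sbc.SenderCoins n []) :
    let ρ := patch ch.ρ (ch.index hn) ch.bit v
    let c := patch ch.c (ch.index hn) ch.bit r
    let t := I.commitTranscript ch.strategy ρ c
    ch.attack ((interact (I.sbc.send n [] (List.ofFn v) r) ch.attack I.sbc.rounds).map Prod.fst
      ++ [.nil]) = .verdict (I.equivocatesOn ch.strategy t ρ c ch.proofTape ch.δ
        (ch.index hn) ch.bit (I.gen (List.ofFn (xorBits ch.mask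
          (Ingredients.tossed n ch.strategy t (ch.index hn) ch.bit))))) := by
  intro ρ c t
  rw [I.interact_relay ch.strategy ch.ρ ch.c (ch.index hn) ch.bit v r ch.attack fun l h1 h2 => by
    have h0 : l ≠ [] := by rintro rfl; simp at h1
    have h3 : l.length ≠ I.sbc.rounds + 1 := by omega
    simp [attack, hn, h0, h3, relay]]
  have hlen : t.length = I.sbc.rounds := by simp only [t, Ingredients.commitTranscript, length_interact]
  set l := (session t (ch.index hn) ch.bit).map Prod.fst ++ [.nil] with hl
  -- At the final activation all messages of the target session are known, so the relayed execution
  -- is the complete real one.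
  have hrelay : ch.relay hn l = t := by
    have h := I.relayTranscript_eq ch.strategy ch.ρ ch.c (ch.index hn) ch.bit v r l _ le_rfl
      fun j hj => by
        change _ = ((session t (ch.index hn) ch.bit).getD j (.nil, .nil)).1
        have hj' : j < (session t (ch.index hn) ch.bit).length := by simpa [hlen] using hj
        rw [List.getD_eq_getElem _ _ hj', hl, List.getD_append _ _ _ _ (by simpa using hj'),
          List.getD_eq_getElem _ _ (by simpa using hj'), List.getElem_map]
    rwa [List.take_of_length_le (by simp [Ingredients.relayTranscript]),
      List.take_of_length_le hlen.le] at h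
  have hll : l.length = I.sbc.rounds + 1 := by simp [hl, hlen]
  change ch.attack l = _
  simp only [attack, hn, dif_pos, hll, decide_false, decide_true,
    relayTest, hrelay, if_true, Nat.succ_ne_zero, Bool.false_eq_true, if_false]
  congr 1
  exact (equivocatesOn_patch _ _ _ _ _ _ _ _ _ _ _).symm

variable (S) in
/-- The adversary against hiding. -/
noncomputable def hidingAdversary (hgen : IsSampler P I.gen) (M : Polynomial ℕ) : PPT :=
  ⟨_, polyTime_attack S M hgen, (.X + 1) * 8 * M⟩

theorem hidingAdversary_next (hgen : IsSampler P I.gen) (M : Polynomial ℕ) {n : ℕ}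
    (a : (hidingAdversary S hgen M).Coins n) : (hidingAdversary S hgen M).next (.unary n) a =
      (Choices.ofTape I S n (M.eval n) (extend a)).attack := by
  -- The type of the choices depends on the length parameter, so the equality of lengths is
  -- substituted in a general statement.
  have h : ∀ (k : ℕ) (ω : ℕ → Bool) (l l' : List Data), k = n → ω = extend a → l = l' →
      (Choices.ofTape I S k (M.eval k) ω).attack l =
        (Choices.ofTape I S n (M.eval n) (extend a)).attack l' := by
    rintro k ω l l' rfl rfl rfl; rfl
  funext l
  exact h _ _ _ _ (by simp) (funext fun j => Data.bit_nth_bits a j) (by simp)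

theorem expect_hidingAdversary (hgen : IsSampler P I.gen) (M : Polynomial ℕ)
    (hM : ∀ n, Adequate I S n (M.eval n)) {n : ℕ} (F : Choices I S n → ℝ) :
    𝔼 a : (hidingAdversary S hgen M).Coins n, F (Choices.ofTape I S n (M.eval n) (extend a)) =
      𝔼 s, 𝔼 v : Fin n → Bool, 𝔼 b, 𝔼 g, 𝔼 u, 𝔼 ρ, 𝔼 c,
        𝔼 δ : Fin n → Bool → Fin (M.eval n) → Bool, 𝔼 τ : Fin (M.eval n) → Bool,
          F ⟨s, v, b, g, extend τ, u, ρ, c, fun i b => extend (δ i b)⟩ := by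
  rw [← expect_choices (hM n).coins (hM n).size (hM n).pos (hM n).sbc]
  exact expect_extend_congr (by simp [hidingAdversary])
    fun ω => F (Choices.ofTape I S n (M.eval n) ω)

variable (I) in
/-- The sender equivocates if the target is sampled with `u` and the coin toss of the sender. -/
noncomputable def maskedTest {n m : ℕ} (s : S.Coins n) (i : Fin n) (b : Bool) (u : Fin n → Bool)
    (ρ : Fin n → Bool → Fin n → Bool) (c : Fin n → Bool → I.sbc.SenderCoins n [])
    (δ : Fin n → Bool → Fin m → Bool) (τ : Fin m → Bool) : ℝ :=
  ind (I.equivocatesOn (strategyOf s) (tossOf I s ρ c) ρ c (extend τ) (fun i b => extend (δ i b))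
    i b (I.gen (List.ofFn (xorBits u (Ingredients.tossed n (strategyOf s) (tossOf I s ρ c) i b))))
      = true)

/-- One formula covers both experiments: they differ only in the string placed in the target
commitment, while the target instance always comes from the mask `u`. -/
theorem hidingExp_eq (hgen : IsSampler P I.gen) (M : Polynomial ℕ)
    (hM : ∀ n, Adequate I S n (M.eval n)) {n : ℕ} (hn : 0 < n) (second : Bool) :
    I.sbc.hidingExp (hidingAdversary S hgen M) n second = 𝔼 v, 𝔼 b, 𝔼 s : S.Coins n, 𝔼 u, 𝔼 ρ,
      𝔼 c, 𝔼 δ : Fin n → Bool → Fin (M.eval n) → Bool, 𝔼 τ : Fin (M.eval n) → Bool, 𝔼 r,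
        maskedTest I s (indexOf hn v) b u (patch ρ (indexOf hn v) b
          (if second then ρ (indexOf hn v) b else u)) (patch c (indexOf hn v) b r) δ τ := by
  let F : Choices I S n → ℝ := fun ch => 𝔼 r : I.sbc.SenderCoins n [],
    ind (ch.attack ((interact (I.sbc.send n [] (List.ofFn
      (if second then ch.ρ (ch.index hn) ch.bit else ch.mask)) r) ch.attack
        I.sbc.rounds).map Prod.fst ++ [.nil]) ≠ .nil)
  have h : I.sbc.hidingExp (hidingAdversary S hgen M) n second =
      𝔼 a : (hidingAdversary S hgen M).Coins n,
        F (Choices.ofTape I S n (M.eval n) (extend a)) := by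
    refine (Pr_bind _ _).trans (Finset.expect_congr rfl fun a _ => ?_)
    refine (Pr_bind _ _).trans (Finset.expect_congr rfl fun r _ => (Pr_pure _ _).trans ?_)
    simp only [hidingAdversary_next, Choices.attack_nil _ hn, Data.head_cons, Data.tail_cons,
      Data.toBits_bits, Set.mem_ofPred_eq]
  rw [h, expect_hidingAdversary hgen M hM]
  refine Eq.trans (Finset.expect_congr rfl fun s _ => Finset.expect_congr rfl fun v _ =>
    Finset.expect_congr rfl fun b _ => ?_) (expect_rotate₃ fun v b s => _).symm
  refine (Fintype.expect_const _).trans ?_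
  refine Finset.expect_congr rfl fun u _ => Finset.expect_congr rfl fun ρ _ =>
    Finset.expect_congr rfl fun c _ => Finset.expect_congr rfl fun δ _ =>
    Finset.expect_congr rfl fun τ _ => Finset.expect_congr rfl fun r _ => ?_
  rw [Choices.attack_outcome _ hn, Data.verdict_ne_nil]
  rfl

/-- The committed string is the mask that generates the target instance, so this is an honest
execution, except that the proof uses the witness for `!b`. -/
theorem hidingExp_first (hgen : IsSampler P I.gen) {M : Polynomial ℕ}
    (hM : ∀ n, Adequate I S n (M.eval n)) {n : ℕ} (hn : 0 < n) :
    I.sbc.hidingExp (hidingAdversary S hgen M) n false = 𝔼 v, 𝔼 b,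
      equivocationProb I S (M.eval n) (!b) (indexOf hn v) b := by
  rw [hidingExp_eq hgen M hM hn]
  refine Finset.expect_congr rfl fun v _ => Finset.expect_congr rfl fun b _ =>
    Finset.expect_congr rfl fun s _ => ?_
  simp only [Bool.false_eq_true, if_false]
  have h := expect_patch_both (α := Fin n → Bool) (β := I.sbc.SenderCoins n [])
    (C := Fin n → Bool → Fin (M.eval n) → Bool) (D := Fin (M.eval n) → Bool) (indexOf hn v) b
    fun ρ c δ τ =>
    ind (I.equivocatesAfterRead (strategyOf s) (tossOf I s ρ c) (instancesOf I s ρ c)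
      (I.bitWitness ρ c (!b)) (extend τ) (fun i b => extend (δ i b)) (indexOf hn v) b = true)
  refine Eq.trans ?_ h
  refine Finset.expect_congr rfl fun u _ => Finset.expect_congr rfl fun ρ _ =>
    Finset.expect_congr rfl fun c _ => Finset.expect_congr rfl fun δ _ =>
    Finset.expect_congr rfl fun τ _ => Finset.expect_congr rfl fun r _ => ?_
  have h := equivocatesOn_instance (I := I) (strategyOf s)
    (tossOf I s (patch ρ (indexOf hn v) b u) (patch c (indexOf hn v) b r))
    (patch ρ (indexOf hn v) b u) (patch c (indexOf hn v) b r) (extend τ)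
    (fun i b => extend (δ i b)) (indexOf hn v) b
  rw [patch_same] at h
  exact congrArg (fun z => ind (z = true)) h

/-- The committed string is `ρ i b`, so the coin toss `σ` is determined without `u`. With everything
else fixed, `u ⊕ σ` is uniform and the target instance is a fresh sample. -/
theorem hidingExp_second (hgen : IsSampler P I.gen) {M : Polynomial ℕ}
    (hM : ∀ n, Adequate I S n (M.eval n)) {n : ℕ} (hn : 0 < n) :
    I.sbc.hidingExp (hidingAdversary S hgen M) n true = 𝔼 v, 𝔼 b,
      independentProb I S (M.eval n) (indexOf hn v) b := by
  rw [hidingExp_eq hgen M hM hn]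
  refine Finset.expect_congr rfl fun v _ => Finset.expect_congr rfl fun b _ =>
    Finset.expect_congr rfl fun s _ => ?_
  simp only [if_true, patch_self]
  refine (expect_rotate_patch (indexOf hn v) b (maskedTest I s (indexOf hn v) b)).trans ?_
  refine Finset.expect_congr rfl fun ρ _ =>
    Finset.expect_congr rfl fun c _ => Finset.expect_congr rfl fun δ _ =>
    Finset.expect_congr rfl fun τ _ => ?_
  simp only [maskedTest]
  exact expect_xorBits _ fun y => ind (I.equivocatesOn (strategyOf s) (tossOf I s ρ c) ρ c
    (extend τ) (fun i b => extend (δ i b)) (indexOf hn v) b (I.gen (List.ofFn y)) = true)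

end

/-! ### Binding on no-instances -/

section

variable {P : PromiseProblem} {I : Ingredients} {S : PPT}

theorem CommitmentScheme.opens_of_opensTwice (C : CommitmentScheme) {n : ℕ} {x : List Bool}
    {t : List (Data × Data)} {d₀ d₁ : Data} (h : C.opensTwice n x t d₀ d₁ = true) :
    ∃ m m' : List Bool, m.length = 1 ∧ m'.length = 1 ∧ m ≠ m' ∧
      ∃ s s' : C.SenderCoins n x, C.Opens n x t m s ∧ C.Opens n x t m' s' := by
  simp only [opensTwice, Bool.and_eq_true, replays_iff] at h
  exact ⟨_, _, rfl, rfl, by simpa using h.1, _, _, h.2.1, h.2.2⟩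

/-- With the receiver's coins in all other sessions fixed, the sender becomes an unbounded party in
the target session alone, and statistical binding applies to the coins of that session. -/
theorem exists_expect_equivocates_le (hidc : I.idc.IsInstanceDependent P) (p : Polynomial ℕ) :
    ∃ ν, Negligible ν ∧ ∀ n m (A : List Data → Data) (h : List Data) (x : Fin n → Bool → List Bool)
      (i : Fin n) (b : Bool), x i b ∈ P.no → (x i b).length ≤ p.eval n →
      I.idc.receiver.coins.eval (n + (x i b).length) ≤ m →
      𝔼 δ : Fin n → Bool → Fin m → Bool,
        ind (I.equivocatesRead A h x (fun i b => extend (δ i b)) i b = true) ≤ ν n := by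
  obtain ⟨ν, hν, H⟩ := hidc.isBinding p
  refine ⟨ν, hν, fun n m A h x i b hx hp hm => ?_⟩
  -- The coins of the target session are drawn last, after a strategy that does not depend on them.
  rw [← expect_patch i b]
  refine expect_le_const fun δ => ?_
  let B : (Fin n → Bool → Fin m → Bool) → Fin n → Bool → List Data → Data :=
    fun δ i b => I.idc.receive n (x i b) fun j => extend (δ i b) j
  refine le_trans ?_ (H n _ hx hp (sessionStrategy (fun l => A (h ++ l)) (B δ) i b))
  rw [Pr_unif, ← expect_read hm]
  refine expect_mono fun z => ind_mono fun hz => ?_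
  have h1 : session (I.bindingTranscript A h x fun i' b' j => extend (patch δ i b z i' b') j) i b =
      interact (sessionStrategy (fun l => A (h ++ l)) (B δ) i b)
        (I.idc.receive n (x i b) fun j => extend z j) I.idc.rounds := by
    refine (interact_sessionStrategy _ (B (patch δ i b z)) i b).symm.trans ?_
    rw [sessionStrategy_congr (B := B (patch δ i b z)) (B' := B δ) _ i b fun i' b' h' => by
      simp only [B, patch_of_ne _ _ _ _ h']]
    simp only [B, patch_same]
  have h2 := I.idc.opens_of_opensTwice hz
  rw [h1] at h2
  exact h2

/-! ### Negligible error terms. -/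

theorem Negligible.abs {ν : ℕ → ℝ} (h : Negligible ν) : Negligible fun n => |ν n| := by
  intro k
  simpa [abs_mul] using (h k).abs

theorem negligible_index : Negligible fun n => (n : ℝ) / 2 ^ n := by
  intro k
  refine (tendsto_pow_const_div_const_pow_of_one_lt (k + 1) one_lt_two).congr fun n => ?_
  rw [pow_succ, mul_div_assoc]

/-- An error term that makes the bounds trivial at `n = 0`, where no session can be chosen. -/
theorem negligible_ite_zero : Negligible fun n => if n = 0 then (1 : ℝ) else 0 := by
  refine (Asymptotics.superpolynomialDecay_zero _ _).congr' ?_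
  filter_upwards [eventually_ne_atTop 0] with n hn
  rw [if_neg hn]; rfl

/-! ### The decider -/

variable (S) in
/-- The decider. -/
noncomputable def decider (hgen : IsSampler P I.gen) (M : Polynomial ℕ) : PPT :=
  ⟨_, polyTime_answer S M hgen, (.X + 1) * 8 * M⟩

theorem decider_next (hgen : IsSampler P I.gen) (M : Polynomial ℕ) {n : ℕ}
    (a : (decider S hgen M).Coins n) (y : List Bool) :
    (decider S hgen M).next (.cons (.unary n) (.ofBits y)) a [] =
      (Choices.ofTape I S n (M.eval n) (extend a)).answer y := by
  have h : ∀ (k : ℕ) (ω : ℕ → Bool) (y' : List Bool), k = n → ω = extend a → y' = y →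
      (Choices.ofTape I S k (M.eval k) ω).answer y' =
        (Choices.ofTape I S n (M.eval n) (extend a)).answer y := by
    rintro k ω l rfl rfl rfl; rfl
  exact h _ _ _ (by simp) (funext fun j => Data.bit_nth_bits a j) (by simp)

variable (P) in
/-- `d` is the correct answer for the instance `y`. -/
def IsCorrect (y : List Bool) (d : Data) : Prop :=
  (d ≠ .nil ∧ y ∈ P.yes) ∨ (d = .nil ∧ y ∈ P.no)

/-- Equality holds in all four cases. A positive test moves the success probability from 1/2 to 1 on
a yes-instance and from 1/2 to 0 on a no-instance; the subtracted indicator accounts for the latter.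
-/
theorem expect_guess_ge {y : List Bool} (hy : y ∈ P.yes ∪ P.no) (t : Bool) :
    1 / 2 + 1 / 2 * ind (t = true) - ind (t = true ∧ y ∈ P.no) ≤
      𝔼 g, ind (IsCorrect P y (.verdict (if t then true else g))) := by
  have hd : ∀ {b : Bool}, Data.verdict b = .nil ↔ b = false := fun {b} => by
    cases b <;> simp [Data.verdict]
  rw [Fintype.expect_eq_sum_div_card]
  simp only [IsCorrect, Data.verdict_ne_nil, hd]
  rcases hy with hy | hy
  · have := P.disjoint.notMem_of_mem_left hy
    cases t <;> norm_num [hy, this, ind]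
  · have := P.disjoint.notMem_of_mem_right hy
    cases t <;> norm_num [hy, this, ind]

theorem expect_rotate_first {A B C D E G U : Type} [Fintype A] [Fintype B] [Fintype C] [Fintype D]
    [Fintype E] [Fintype G] [Fintype U] [Nonempty U] (X : G → A → B → C → D → E → ℝ) :
    𝔼 g, 𝔼 _u : U, 𝔼 a, 𝔼 b, 𝔼 c, 𝔼 d, 𝔼 e, X g a b c d e =
      𝔼 a, 𝔼 b, 𝔼 c, 𝔼 d, 𝔼 e, 𝔼 g, X g a b c d e := by
  refine (Finset.expect_congr rfl fun g _ => Fintype.expect_const _).trans ?_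
  refine (Finset.expect_comm _ _ _).trans (Finset.expect_congr rfl fun a _ => ?_)
  refine (Finset.expect_comm _ _ _).trans (Finset.expect_congr rfl fun b _ => ?_)
  exact (expect_rotate₄ fun c d e g => X g a b c d e).symm

theorem successProb_decider (hgen : IsSampler P I.gen) {M : Polynomial ℕ}
    (hM : ∀ n, Adequate I S n (M.eval n)) {n : ℕ} (hn : 0 < n) :
    successProb P I.gen (decider S hgen M) n = 𝔼 v, 𝔼 b, 𝔼 s : S.Coins n, 𝔼 ρ,
      𝔼 c, 𝔼 δ : Fin n → Bool → Fin (M.eval n) → Bool, 𝔼 τ : Fin (M.eval n) → Bool,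
        𝔼 y : Fin n → Bool, 𝔼 g, ind (IsCorrect P (I.gen (List.ofFn y)) (.verdict
          (if I.equivocatesOn (strategyOf s) (tossOf I s ρ c) ρ c (extend τ)
            (fun i b => extend (δ i b)) (indexOf hn v) b (I.gen (List.ofFn y))
          then true else g))) := by
  let F : Choices I S n → ℝ := fun ch => 𝔼 y : Fin n → Bool,
    ind (IsCorrect P (I.gen (List.ofFn y)) (ch.answer (I.gen (List.ofFn y))))
  have h : successProb P I.gen (decider S hgen M) n = 𝔼 a : (decider S hgen M).Coins n,
      F (Choices.ofTape I S n (M.eval n) (extend a)) := by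
    refine ((Pr_bind _ _).trans (Finset.expect_congr rfl fun y _ => ?_)).trans
      (Finset.expect_comm _ _ _)
    refine (Pr_bind _ _).trans (Finset.expect_congr rfl fun a _ => (Pr_pure _ _).trans ?_)
    simp only [decider_next]
    rfl
  rw [h, expect_extend_congr (k' := (n + 1) * 8 * M.eval n) (by simp [decider])
    fun ω => F (Choices.ofTape I S n (M.eval n) ω),
    expect_choices (hM n).coins (hM n).size (hM n).pos (hM n).sbc]
  refine Eq.trans (Finset.expect_congr rfl fun s _ => Finset.expect_congr rfl fun v _ =>
    Finset.expect_congr rfl fun b _ => ?_) (expect_rotate₃ fun v b s => _).symm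
  simp only [F, Choices.answer, dif_pos hn]
  exact expect_rotate_first (A := Fin n → Bool → Fin n → Bool)
    (B := Fin n → Bool → I.sbc.SenderCoins n []) (C := Fin n → Bool → Fin (M.eval n) → Bool)
    (D := Fin (M.eval n) → Bool) (E := Fin n → Bool) (G := Bool) (U := Fin n → Bool)
    fun g ρ c δ τ y => ind (IsCorrect P (I.gen (List.ofFn y)) (.verdict
          (if I.equivocatesOn (strategyOf s) (tossOf I s ρ c) ρ c (extend τ)
            (fun i b => extend (δ i b)) (indexOf hn v) b (I.gen (List.ofFn y))
          then true else g)))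

theorem exists_successProb_ge (hgen : IsSampler P I.gen) (hidc : I.idc.IsInstanceDependent P)
    {M : Polynomial ℕ} (hM : ∀ n, Adequate I S n (M.eval n)) : ∃ ν, Negligible ν ∧
    ∀ n (hn : 0 < n), 1 / 2 + 1 / 2 * (𝔼 v, 𝔼 b, independentProb I S (M.eval n) (indexOf hn v) b)
      - ν n ≤ successProb P I.gen (decider S hgen M) n := by
  obtain ⟨p, hp⟩ := length_gen_le hgen
  obtain ⟨ν, hν, H⟩ := exists_expect_equivocates_le hidc p
  -- The bound must also hold for a `y` that is not a no-instance, where the average is 0; hence the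
  -- absolute value.
  refine ⟨_, hν.abs, fun n hn => ?_⟩
  rw [successProb_decider hgen hM hn]
  have h1 : ∀ (v : Fin n → Bool) b (s : S.Coins n) ρ c,
      𝔼 δ : Fin n → Bool → Fin (M.eval n) → Bool, 𝔼 τ : Fin (M.eval n) → Bool,
        𝔼 y : Fin n → Bool, ind (I.equivocatesOn (strategyOf s) (tossOf I s ρ c) ρ c (extend τ)
            (fun i b => extend (δ i b)) (indexOf hn v) b (I.gen (List.ofFn y)) = true ∧
              I.gen (List.ofFn y) ∈ P.no) ≤ |ν n| := by
    intro v b s ρ c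
    -- The receiver's tapes `δ` are moved inside, because binding concerns them for a fixed instance
    -- and a fixed course of the proof.
    rw [← expect_rotate₃ fun (τ : Fin (M.eval n) → Bool) (y : Fin n → Bool)
      (δ : Fin n → Bool → Fin (M.eval n) → Bool) =>
        ind (I.equivocatesOn (strategyOf s) (tossOf I s ρ c) ρ c (extend τ)
            (fun i b => extend (δ i b)) (indexOf hn v) b (I.gen (List.ofFn y)) = true ∧
              I.gen (List.ofFn y) ∈ P.no)]
    refine expect_le_const fun τ => expect_le_const fun y => ?_
    by_cases hy : I.gen (List.ofFn y) ∈ P.no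
    · refine le_trans ?_ (le_abs_self _)
      have hx := patch_same (I.instances (strategyOf s) (tossOf I s ρ c) ρ) (indexOf hn v) b
        (I.gen (List.ofFn y))
      refine (expect_mono fun δ => ind_mono fun h => h.1).trans (H n (M.eval n) _ _ _
        (indexOf hn v) b (by rwa [hx]) (by rw [hx]; exact hp n y)
        (by rw [hx]; exact (hM n).receiver y))
    · refine expect_le_const fun δ => ?_
      rw [ind_false fun h => hy h.2]
      exact abs_nonneg _
  have h2 : 𝔼 v, 𝔼 b, 𝔼 s : S.Coins n, 𝔼 ρ,
      𝔼 c, 𝔼 δ : Fin n → Bool → Fin (M.eval n) → Bool, 𝔼 τ : Fin (M.eval n) → Bool,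
        𝔼 y : Fin n → Bool, ind (I.equivocatesOn (strategyOf s) (tossOf I s ρ c) ρ c (extend τ)
            (fun i b => extend (δ i b)) (indexOf hn v) b (I.gen (List.ofFn y)) = true ∧
              I.gen (List.ofFn y) ∈ P.no) ≤ |ν n| :=
    expect_le_const fun v => expect_le_const fun b => expect_le_const fun s =>
      expect_le_const fun ρ => expect_le_const fun c => h1 v b s ρ c
  refine (sub_le_sub_left h2 _).trans ?_
  have hc : (1 / 2 : ℝ) = 𝔼 _v : Fin n → Bool, 𝔼 _b : Bool, 𝔼 _s : S.Coins n,
      𝔼 _ρ : Fin n → Bool → Fin n → Bool, 𝔼 _c : Fin n → Bool → I.sbc.SenderCoins n [],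
      𝔼 _δ : Fin n → Bool → Fin (M.eval n) → Bool, 𝔼 _τ : Fin (M.eval n) → Bool,
        𝔼 _y : Fin n → Bool, 1 / 2 := by simp only [Fintype.expect_const]
  unfold independentProb
  nth_rw 1 [hc]
  simp only [Finset.mul_expect, ← Finset.expect_add_distrib, ← Finset.expect_sub_distrib]
  refine expect_mono fun v => expect_mono fun b => expect_mono fun s => expect_mono fun ρ =>
    expect_mono fun c => expect_mono fun δ => expect_mono fun τ => expect_mono fun y => ?_
  exact expect_guess_ge (hgen.2 ▸ ⟨_, rfl⟩) _

end

/-! ### The security of the protocol -/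

section

variable {P : PromiseProblem} {I : Ingredients} {S : PPT}

theorem Pr_nonneg {α : Type} (p : PMF α) (E : Set α) : 0 ≤ Pr p E := ENNReal.toReal_nonneg

theorem breakProb_le_one (n : ℕ) : I.breakProb S n ≤ 1 := by
  rw [breakProb_eq]
  exact expect_le_const fun s => expect_le_const fun ρ => expect_le_const fun c =>
    expect_le_const fun r => expect_le_const fun d => ind_le_one _

theorem equivocationProb_mem {n m : ℕ} (β : Bool) (i : Fin n) (b : Bool) :
    0 ≤ equivocationProb I S m β i b ∧ equivocationProb I S m β i b ≤ 1 :=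
  ⟨Finset.expect_nonneg fun _ _ => Finset.expect_nonneg fun _ _ => Finset.expect_nonneg fun _ _ =>
    Finset.expect_nonneg fun _ _ => Finset.expect_nonneg fun _ _ => ind_nonneg _,
  expect_le_const fun _ => expect_le_const fun _ => expect_le_const fun _ =>
    expect_le_const fun _ => expect_le_const fun _ => ind_le_one _⟩

theorem exists_independentProb_ge (hgen : IsSampler P I.gen) (hsbc : I.sbc.CompHiding)
    (hwi : I.wi.IsWIProof I.consistent) {M : Polynomial ℕ}
    (hM : ∀ n, Adequate I S n (M.eval n)) : ∃ ν, Negligible ν ∧ ∀ n (hn : 0 < n),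
      I.breakProb S n / (2 * n) - ν n ≤
        𝔼 v, 𝔼 b, independentProb I S (M.eval n) (indexOf hn v) b := by
  obtain ⟨ν₁, hν₁, h₁⟩ := hsbc (hidingAdversary S hgen M)
  obtain ⟨ν₂, hν₂, h₂⟩ := exists_equivocationProb_sub_le hgen hwi hM
  refine ⟨_, (negligible_index.add hν₁).add hν₂, fun n hn => ?_⟩
  have e₁ := h₁ n
  rw [hidingExp_first hgen hM hn, hidingExp_second hgen hM hn] at e₁
  -- For `b = 1` the honest witness, with bit 0, already avoids the target; only for `b = 0` is it
  -- exchanged.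
  have e₂ : ∀ (i : Fin n) b, equivocationProb I S (M.eval n) false i b - ν₂ n ≤
      equivocationProb I S (M.eval n) (!b) i b := by
    have h0 : 0 ≤ ν₂ n := (abs_nonneg _).trans (h₂ n ⟨0, hn⟩ false)
    rintro i (_ | _)
    · have := (abs_le.1 (h₂ n i false)).2
      rw [Bool.not_false]
      linarith
    · rw [Bool.not_true]
      linarith
  have e₃ : (𝔼 v, 𝔼 b, equivocationProb I S (M.eval n) false (indexOf hn v) b) - ν₂ n ≤
      𝔼 v, 𝔼 b, equivocationProb I S (M.eval n) (!b) (indexOf hn v) b := by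
    have hc : ν₂ n = 𝔼 _v : Fin n → Bool, 𝔼 _b : Bool, ν₂ n := by
      simp only [Fintype.expect_const]
    rw [hc, ← Finset.expect_sub_distrib]
    refine expect_mono fun v => ?_
    rw [← Finset.expect_sub_distrib]
    exact expect_mono fun b => e₂ _ _
  have e₄ := expect_index_ge hn (φ := fun i => 𝔼 b, equivocationProb I S (M.eval n) false i b)
    (fun i => Finset.expect_nonneg fun b _ => (equivocationProb_mem _ _ _).1)
    (fun i => expect_le_const fun b => (equivocationProb_mem _ _ _).2)
  have e₅ := breakProb_le (hM n)
  have e₆ : (∑ i : Fin n, 𝔼 b, equivocationProb I S (M.eval n) false i b) =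
      (∑ i : Fin n, ∑ b, equivocationProb I S (M.eval n) false i b) / 2 := by
    rw [Finset.sum_div]
    exact Finset.sum_congr rfl fun i _ => by rw [Fintype.expect_eq_sum_div_card]; simp
  -- The union bound over 2n sessions, read as a bound for a uniformly random session.
  have e₇ : I.breakProb S n / (2 * n) ≤
      (∑ i : Fin n, 𝔼 b, equivocationProb I S (M.eval n) false i b) / n := by
    rw [e₆, div_div]
    gcongr
  have e₈ := (abs_le.1 e₁).2
  simp only [indexOf, Pi.add_apply] at *
  linarith

theorem exists_decider (hgen : IsSampler P I.gen) (hsbc : I.sbc.CompHiding)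
    (hwi : I.wi.IsWIProof I.consistent) (hidc : I.idc.IsInstanceDependent P) (S : PPT) :
    ∃ D : PPT, ∃ ν : ℕ → ℝ, Negligible ν ∧
      ∀ n : ℕ, 1 / 2 + I.breakProb S n / (4 * n) - ν n ≤ successProb P I.gen D n := by
  obtain ⟨M, hM⟩ := exists_adequate hgen S
  obtain ⟨ν₁, hν₁, h₁⟩ := exists_independentProb_ge hgen hsbc hwi hM
  obtain ⟨ν₂, hν₂, h₂⟩ := exists_successProb_ge hgen hidc hM
  refine ⟨decider S hgen M, _, (hν₁.abs.add hν₂.abs).add negligible_ite_zero, fun n => ?_⟩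
  simp only [Pi.add_apply]
  rcases Nat.eq_zero_or_pos n with rfl | hn
  -- At `n = 0` the quotient by `4 * n` is 0 and the extra error term is 1, so nonnegativity of the
  -- success probability suffices.
  · have := Pr_nonneg _ _ |>.trans_eq (Eq.refl (successProb P I.gen (decider S hgen M) 0))
    have := abs_nonneg (ν₁ 0)
    have := abs_nonneg (ν₂ 0)
    simp only [Nat.cast_zero, mul_zero, div_zero, if_true]
    linarith
  · have e₁ := h₁ n hn
    have e₂ := h₂ n hn
    have e₃ := le_abs_self (ν₁ n)
    have e₄ := le_abs_self (ν₂ n)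
    have e₅ : I.breakProb S n / (4 * n) = 1 / 2 * (I.breakProb S n / (2 * n)) := by
      field_simp; norm_num
    have e₆ := abs_nonneg (ν₁ n)
    rw [if_neg hn.ne', e₅]
    linarith

/-- Comparing the lower bound with hardness gives `breakProb ≤ 4n (ν + ν')`, and negligible
functions absorb the factor `4n`. At `n = 0` the trivial bound 1 is used. -/
theorem compBinding_of_deciders {P : PromiseProblem} {I : Ingredients}
    (h : ∀ S : PPT, ∃ D : PPT, ∃ ν : ℕ → ℝ, Negligible ν ∧
      ∀ n : ℕ, 1 / 2 + I.breakProb S n / (4 * n) - ν n ≤ successProb P I.gen D n)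
    (hard : HardOnAverage P I.gen) : I.CompBinding := by
  intro S
  obtain ⟨D, ν, hν, hD⟩ := h S
  obtain ⟨ν', hν', hD'⟩ := hard.2 D
  refine ⟨_, (((hν.add hν').param_mul).const_mul 4).add negligible_ite_zero, fun n => ?_⟩
  simp only [Pi.add_apply]
  rcases Nat.eq_zero_or_pos n with rfl | hn
  · simpa using breakProb_le_one 0
  · have hn' : (0 : ℝ) < 4 * n := by positivity
    have e := (hD n).trans (hD' n)
    have e' : I.breakProb S n / (4 * n) ≤ ν n + ν' n := by linarith
    rw [div_le_iff₀ hn'] at e'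
    rw [if_neg hn.ne', add_zero]
    simp only [Pi.mul_apply, Pi.add_apply]
    linarith

end

theorem mainTheorem5 (P : PromiseProblem) (I : Ingredients)
    (hgen : IsSampler P I.gen)
    (hsbc : I.sbc.IsStatBindingCommitment)
    (hwi : I.wi.IsWIProof I.consistent)
    (hidc : I.idc.IsInstanceDependent P) :
    (HardOnAverage P I.gen → I.CompBinding) ∧
    ∀ S : PPT, ∃ D : PPT, ∃ ν : ℕ → ℝ, Negligible ν ∧
      ∀ n : ℕ, 1 / 2 + I.breakProb S n / (4 * n) - ν n ≤ successProb P I.gen D n := by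
  have h := exists_decider hgen hsbc.isHiding hwi hidc
  exact ⟨compBinding_of_deciders h, h⟩
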